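/- **Theorem 2 (Easiness for single-photon-state input).** Fix an integer $d\ge 1$ and real constants $k>0$, $\gamma>1$, $c_1>0$, $c_2>0$ and $0<\kappa<\frac{d\,k^{2/d}}{8c_1}$ (so $\kappa=1$ is allowed if $c_1<d\,k^{2/d}/8$, and for every $c_1>0$ some $\kappa>0$ is allowed). *Setting.* $M=kN^\gamma$ bosonic modes form a $d$-dimensional rectangular box of lattice sites which is tiled by $N\ge 1$ cubes (sublattices) $\mathcal L_1,\dots,\mathcal L_N$ of integer edge length $L=(M/N)^{1/d}$. A single photon is put into one central site $s_\alpha$ of each $\mathcal L_\alpha$ (the same position in every cube); all other modes are in the vacuum. A circuit of depth $D$ consists of $D$ steps. In a step, which belongs to a direction $i\in\{1,\dots,d\}$ and a parity, beam splitters act on all pairs of neighbouring modes $x,x+e_i$ for which $x_i$ has this parity; the $2d$ kinds of steps follow each other periodically in a fixed order. Each beam splitter acts on its two modes by $\begin{pmatrix}\cos\theta&e^{i\phi}\sin\theta\\-e^{-i\phi}\sin\theta&\cos\theta\end{pmatrix}$ with all angles $\theta,\phi$ independent and uniform on $[0,2\pi)$. Let $U$ be the resulting $M\times M$ unitary, $\hat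 a_x\to\sum_y U_{xy}\hat a_y$, so that the output state is $\prod_\alpha\big(\sum_x U_{x,s_\alpha}\hat a_x^\dagger\big)|0\rangle$. Let $\mathcal D$ be the distribution of the photon numbers of all modes in this state (Born's rule), let $\mathcal D_{\rm dist}$ be the distribution of the photon numbers when, independently for each $\alpha$, the photon from $s_\alpha$ is found in mode $x$ with probability $|U_{x,s_\alpha}|^2$, and let $\eta=\max_\alpha\sum_{x\notin\mathcal L_\alpha}|U_{x,s_\alpha}|^2$ be the largest leakage rate. $\|\cdot\|$ is the total variation distance $\frac12\sum_n|P_1(n)-P_2(n)|$, and $c=2\sqrt{\eta kN^{\gamma+1}}$. *Claim.* There are a randomized classical algorithm $A$, integers $a,b$, constants $K$ and $\kappa'>0$, and a function $f(N)=o(N^{c_2})$, all depending only on $d,k,\gamma,c_1,c_2,\kappa$, such that the following holds for all such $N,L$, all boxes, and all depths $D\le c_1N^{2(\gamma-1)/d-c_2}$. 1. For every circuit, $\|\mathcal D-\mathcal D_{\rm dist}\|\le\frac12\big[(c+1)^N-Nc-1\big]$. 2. For every circuit and every $p\ge0$, given the entries of $U$ with $p$ binary digits, $A$ always stops after at most $b(N+p)^b$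 bit operations and samples from $\mathcal D_{\rm dist}$ up to total variation distance $bN^b2^{-p}$. 3. With probability at least $1-\delta$ over the random beam splitters, where $\delta\le K\exp(-\kappa'N^{c_2})$, we have $\eta\le\exp(-\kappa N^{c_2})$ and $\frac12[(c+1)^N-Nc-1]\le\exp(-\kappa N^{c_2}+f(N))$, and the sampling problem is easy: given the entries of $U$ with $aN^a$ binary digits, $A$ stops after at most $bN^b$ bit operations and its output distribution $\mathcal D_a$ satisfies $\|\mathcal D-\mathcal D_a\|\le\exp(-\kappa N^{c_2}+f(N))$. -/

import Mathlib

open scoped ENNReal Asymptotics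

noncomputable section

namespace LinearOptics

/-! ### The lattice, its sublattices and the sources -/

/-- The modes: a `d`-dimensional box of `∏ i, (m i * L)` lattice sites, tiled by `∏ i, m i` cubes of
edge length `L`. -/
abbrev Mode {d : ℕ} (m : Fin d → ℕ) (L : ℕ) : Type := (i : Fin d) → Fin (m i * L)

/-- The labels of the sublattices (cubes of edge length `L`), equivalently of the sources. -/
abbrev Cell {d : ℕ} (m : Fin d → ℕ) : Type := (i : Fin d) → Fin (m i)

variable {d : ℕ} {m : Fin d → ℕ} {L : ℕ}

/-- The sublattice that contains the mode `x`. -/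
def cellOf (x : Mode m L) : Cell m := fun i =>
  ⟨(x i : ℕ) / L, Nat.div_lt_of_lt_mul (lt_of_lt_of_eq (x i).isLt (Nat.mul_comm _ _))⟩

/-- The source of the sublattice `α`; all sources have the same position `o` in their cubes. -/
def source (o : Fin d → Fin L) (α : Cell m) : Mode m L := fun i =>
  ⟨(α i : ℕ) * L + (o i : ℕ), by
    calc (α i : ℕ) * L + (o i : ℕ) < (α i : ℕ) * L + L := by
          exact Nat.add_lt_add_left (o i).isLt _
      _ = ((α i : ℕ) + 1) * L := by ring
      _ ≤ m i * L := Nat.mul_le_mul_right L (α i).isLt⟩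

/-- The position `o` is a central site of a cube of edge length `L`: the central one if `L` is odd,
one of the two middle ones in each coordinate if `L` is even. -/
def IsCentral (o : Fin d → Fin L) : Prop :=
  ∀ i, 2 * (o i : ℕ) ≤ L ∧ L ≤ 2 * (o i : ℕ) + 2

/-! ### Random beam splitter arrays -/

/-- In the step `(i, b)` the modes `x` and `x + eᵢ` are coupled whenever `x i` has parity `b`
and `x + eᵢ` is still in the box. This is the mode coupled to `x` (`x` itself if there is none). -/
def partner (i : Fin d) (b : Fin 2) (x : Mode m L) : Mode m L :=
  if (x i : ℕ) % 2 = b then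
    if h : (x i : ℕ) + 1 < m i * L then Function.update x i ⟨(x i : ℕ) + 1, h⟩ else x
  else Function.update x i ⟨(x i : ℕ) - 1, lt_of_le_of_lt (Nat.sub_le _ _) (x i).isLt⟩

/-- The matrix of one step of beam splitters, `a_x ↦ ∑ y, (layer x y) a_y`. The beam splitter on
`x` and `x + eᵢ` has the angles `(θ, φ) = w x`; the other values of `w` are not used. -/
def layer (i : Fin d) (b : Fin 2) (w : Mode m L → ℝ × ℝ) :
    Matrix (Mode m L) (Mode m L) ℂ := fun x y =>
  if partner i b x = x then (if y = x then 1 else 0)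
  else if (x i : ℕ) % 2 = b then
    if y = x then (Real.cos (w x).1 : ℂ)
    else if y = partner i b x then
      Complex.exp (Complex.I * ((w x).2 : ℂ)) * (Real.sin (w x).1 : ℂ)
    else 0
  else
    if y = x then (Real.cos (w (partner i b x)).1 : ℂ)
    else if y = partner i b x then
      -Complex.exp (-(Complex.I * ((w (partner i b x)).2 : ℂ))) *
        (Real.sin (w (partner i b x)).1 : ℂ)
    else 0

/-- The order of the steps: a round consists of `2 * d` steps, one for each direction and each
parity, and the rounds are repeated periodically. -/
def IsSchedule (sched : ℕ → Fin d × Fin 2) : Prop :=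
  (∀ τ, sched (τ + 2 * d) = sched τ) ∧
    Function.Bijective (fun τ : Fin (2 * d) => sched (τ : ℕ))

/-- The angles of all beam splitters of a circuit of depth `D` (that is, with `D` steps). -/
abbrev Angles {d : ℕ} (m : Fin d → ℕ) (L D : ℕ) : Type := Fin D → Mode m L → ℝ × ℝ

/-- The matrix `U` of the circuit, `a_x ↦ ∑ y, U x y a_y`. -/
def circuit (sched : ℕ → Fin d × Fin 2) :
    (D : ℕ) → Angles m L D → Matrix (Mode m L) (Mode m L) ℂ
  | 0, _ => 1
  | D + 1, ω =>
      layer (sched D).1 (sched D).2 (ω (Fin.last D)) * circuit sched D (fun τ => ω τ.castSucc)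

/-- The uniform distribution on `[0, 2π)`. -/
def uniformAngle : MeasureTheory.Measure ℝ :=
  ProbabilityTheory.cond MeasureTheory.volume (Set.Ico 0 (2 * Real.pi))

/-- All angles are independent and uniform on `[0, 2π)`. -/
def circuitMeasure {d : ℕ} (m : Fin d → ℕ) (L D : ℕ) : MeasureTheory.Measure (Angles m L D) :=
  MeasureTheory.Measure.pi fun _ => MeasureTheory.Measure.pi fun _ =>
    uniformAngle.prod uniformAngle

/-! ### Leakage, and the two distributions of photon numbers -/

/-- The leakage rate of the source of `α` to the outside of its sublattice. -/
def leakage (o : Fin d → Fin L) (U : Matrix (Mode m L) (Mode m L) ℂ) (α : Cell m) : ℝ :=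
  ∑ x : Mode m L, if cellOf x = α then 0 else ‖U x (source o α)‖ ^ 2

/-- The largest leakage rate `η` of a source. -/
def maxLeakage (o : Fin d → Fin L) (U : Matrix (Mode m L) (Mode m L) ℂ) : ℝ :=
  ⨆ α : Cell m, leakage o U α

/-- The output state `∏ α, (∑ x, U x s_α a†_x) |0⟩`, in the representation of the Fock space in
which `a†_x` is the multiplication by the variable `x`, the vacuum is `1`, and the number state
with occupation numbers `t` is the monomial of exponents `t` divided by `√(∏ x, (t x)!)`. -/
def outputState (o : Fin d → Fin L) (U : Matrix (Mode m L) (Mode m L) ℂ) :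
    MvPolynomial (Mode m L) ℂ :=
  ∏ α : Cell m, ∑ x : Mode m L, MvPolynomial.C (U x (source o α)) * MvPolynomial.X x

/-- The ideal distribution: by Born's rule, the probability of the outcome `t` is the squared
modulus of the amplitude of the number state `t` in the output state. -/
def idealProb (o : Fin d → Fin L) (U : Matrix (Mode m L) (Mode m L) ℂ) (t : Mode m L → ℕ) : ℝ :=
  ‖(Real.sqrt (∏ x, ((t x).factorial : ℝ)) : ℂ) *
    (outputState o U).coeff (Finsupp.equivFunOnFinite.symm t)‖ ^ 2

/-- The occupation numbers when the photon of the source `α` is found in the mode `f α`. -/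
def occupation (f : Cell m → Mode m L) : Mode m L → ℕ := fun x =>
  (Finset.univ.filter fun α => f α = x).card

/-- The distribution of photon numbers for distinguishable photons: independently for all `α`, the
photon of the source `α` is found in the mode `x` with probability `|U x s_α|²`. -/
def distinguishableProb (o : Fin d → Fin L) (U : Matrix (Mode m L) (Mode m L) ℂ)
    (t : Mode m L → ℕ) : ℝ :=
  ∑ f : Cell m → Mode m L,
    if occupation f = t then ∏ α, ‖U (f α) (source o α)‖ ^ 2 else 0

/-- The total variation distance, as an extended real (so that no convergence is presupposed). -/
def tvDist {Ω : Type} (P Q : Ω → ℝ) : ℝ≥0∞ := (∑' t, ENNReal.ofReal |P t - Q t|) / 2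

/-- The bound `½ [(c + 1) ^ N - N c - 1]` with `c = 2 √(η k N ^ (γ + 1))`. -/
def errorBound (k γ : ℝ) (N : ℕ) (η : ℝ) : ℝ :=
  ((2 * Real.sqrt (η * k * (N : ℝ) ^ (γ + 1)) + 1) ^ N
    - N * (2 * Real.sqrt (η * k * (N : ℝ) ^ (γ + 1))) - 1) / 2

/-! ### Randomized classical algorithms

A random access machine over the integers with a read-only input array, a work memory, fair coin
flips and logarithmic (bit) cost. The control flow is structured and all loops are bounded, so that
every program terminates; this only restricts the available algorithms. -/

/-- Programs. The arguments `x`, `y`, `z` are numbers of registers. -/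
inductive Prog : Type
  | const (x : ℕ) (v : ℤ) : Prog
  | add (x y z : ℕ) : Prog
  | sub (x y z : ℕ) : Prog
  | mul (x y z : ℕ) : Prog
  /-- Register `x` receives the cell of the input whose address is in register `y`. -/
  | read (x y : ℕ) : Prog
  /-- Register `x` receives the cell of the work memory whose address is in register `y`. -/
  | load (x y : ℕ) : Prog
  /-- The memory cell whose address is in register `x` receives the content of register `y`. -/
  | store (x y : ℕ) : Prog
  /-- Register `x` receives a fair random bit. -/
  | flip (x : ℕ) : Prog
  | seq (p q : Prog) : Prog
  /-- Run `p` if register `x` is positive, and `q` otherwise. -/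
  | ifPos (x : ℕ) (p q : Prog) : Prog
  /-- Run `p` as many times as register `x` says at the start of the loop. -/
  | loop (x : ℕ) (p : Prog) : Prog

/-- The state of the machine, with the cost of the computation so far. -/
structure State : Type where
  reg : ℕ → ℤ
  mem : ℕ → ℤ
  cost : ℕ

/-- The number of binary digits. -/
def bits (v : ℤ) : ℕ := v.natAbs.size

/-- Charge `n` units. -/
def State.tick (n : ℕ) (s : State) : State := { s with cost := s.cost + n }

/-- Write `v` to register `x`, and charge `n` units. -/
def State.set (x : ℕ) (v : ℤ) (n : ℕ) (s : State) : State :=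
  { s with reg := Function.update s.reg x v, cost := s.cost + n }

/-- The distribution of the final state of a program on the input `inp`. -/
def Prog.run (inp : ℕ → ℤ) : Prog → State → PMF State
  | .const x v, s => PMF.pure (s.set x v (1 + bits v))
  | .add x y z, s => PMF.pure (s.set x (s.reg y + s.reg z) (1 + bits (s.reg y) + bits (s.reg z)))
  | .sub x y z, s => PMF.pure (s.set x (s.reg y - s.reg z) (1 + bits (s.reg y) + bits (s.reg z)))
  | .mul x y z, s =>
      PMF.pure (s.set x (s.reg y * s.reg z) ((1 + bits (s.reg y)) * (1 + bits (s.reg z))))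
  | .read x y, s =>
      PMF.pure (s.set x (inp (s.reg y).toNat) (1 + bits (s.reg y) + bits (inp (s.reg y).toNat)))
  | .load x y, s =>
      PMF.pure (s.set x (s.mem (s.reg y).toNat)
        (1 + bits (s.reg y) + bits (s.mem (s.reg y).toNat)))
  | .store x y, s =>
      PMF.pure { s with
        mem := Function.update s.mem (s.reg x).toNat (s.reg y)
        cost := s.cost + (1 + bits (s.reg x) + bits (s.reg y)) }
  | .flip x, s => (PMF.uniformOfFintype Bool).bind fun b => PMF.pure (s.set x (if b then 1 else 0) 1)
  | .seq p q, s => (p.run inp s).bind fun s' => q.run inp s'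
  | .ifPos x p q, s =>
      if 0 < s.reg x then p.run inp (s.tick (1 + bits (s.reg x)))
      else q.run inp (s.tick (1 + bits (s.reg x)))
  | .loop x p, s =>
      Nat.rec (motive := fun _ => PMF State) (PMF.pure (s.tick (1 + bits (s.reg x))))
        (fun _ acc => acc.bind fun s' => p.run inp (s'.tick 1)) (s.reg x).toNat

/-- The number of the mode `x` in the mixed radix enumeration of all modes. -/
def modeIndex (x : Mode m L) : ℕ := (finPiFinEquiv x : ℕ)

/-- The input: the numbers of the source modes, then the real parts and then the imaginary parts
of the entries of `U`, row by row, each given as `⌊2 ^ p * entry⌋`. -/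
def inputArray (o : Fin d → Fin L) (p : ℕ) (U : Matrix (Mode m L) (Mode m L) ℂ) : ℕ → ℤ :=
  fun a =>
    (List.ofFn (fun j : Fin (∏ i, m i) => (modeIndex (source o (finPiFinEquiv.symm j)) : ℤ))
      ++ List.ofFn (fun q : Fin ((∏ i, (m i * L)) * (∏ i, (m i * L))) =>
          ⌊(2 : ℝ) ^ p * (U (finPiFinEquiv.symm q.divNat) (finPiFinEquiv.symm q.modNat)).re⌋)
      ++ List.ofFn (fun q : Fin ((∏ i, (m i * L)) * (∏ i, (m i * L))) =>
          ⌊(2 : ℝ) ^ p * (U (finPiFinEquiv.symm q.divNat) (finPiFinEquiv.symm q.modNat)).im⌋)).getD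
      a 0

/-- Initially the registers `0`, `1`, `2` hold the number of sources, the number of modes and the
precision `p`; all other registers and the work memory are zero. -/
def initState {d : ℕ} (m : Fin d → ℕ) (L p : ℕ) : State where
  reg := fun x =>
    if x = 0 then ((∏ i, m i : ℕ) : ℤ)
    else if x = 1 then ((∏ i, (m i * L) : ℕ) : ℤ)
    else if x = 2 then (p : ℤ) else 0
  mem := fun _ => 0
  cost := 0

/-- The distribution of the final state when `A` is given the entries of `U` with `p` bits. -/
def finalState (A : Prog) (o : Fin d → Fin L) (p : ℕ) (U : Matrix (Mode m L) (Mode m L) ℂ) :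
    PMF State :=
  A.run (inputArray o p U) (initState m L p)

/-- The distribution of the outcome: the photon number of each mode is read off from the memory
cell with the number of the mode. -/
def outputProb (A : Prog) (o : Fin d → Fin L) (p : ℕ) (U : Matrix (Mode m L) (Mode m L) ℂ)
    (t : Mode m L → ℕ) : ℝ :=
  (((finalState A o p U).map fun s => fun x : Mode m L => (s.mem (modeIndex x)).toNat) t).toReal

/-- Given the matrix `U` with `p` bits per entry, the algorithm `A` always stops within `T` steps
(bit operations) and samples from `P` up to `ε` in total variation distance. -/
def SamplesWithin (A : Prog) (o : Fin d → Fin L) (p T : ℕ)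
    (U : Matrix (Mode m L) (Mode m L) ℂ) (P : (Mode m L → ℕ) → ℝ) (ε : ℝ) : Prop :=
  (∀ s ∈ (finalState A o p U).support, s.cost ≤ T) ∧
    tvDist P (outputProb A o p U) ≤ ENNReal.ofReal ε

end LinearOptics

end

open LinearOptics

/-!
The photons leave their sublattices only with exponentially small probability, and photons that do
not meet are distinguishable, so that they can be sampled one by one.

*Interference.* By Born's rule, the probability of an outcome is a sum over pairs of assignments of
the photons to modes that differ by a permutation (`interference_sum`), and the identity permutation
gives the distribution for distinguishable photons. The terms of a permutation factorize into
overlaps of the moduli of the amplitudes of two photons (`sum_interference_le`). For different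
photons such an overlap is at most `2 √η`, since in each mode at least one of the two has leaked
(`overlap_le`). Counting the permutations by the set of moved points (`sum_pow_card_support_le`)
gives `½ [(c + 1) ^ N - N c - 1]`.

*Leakage.* The mean of `|U x s|²` over the angles is the transition probability of a random walk
which in every step moves to a uniformly chosen member of the coupled pair of its site
(`lintegral_circuit`). In each direction the steps alternate between the two parities
(`exists_parity`), so the centre of the pair that is coupled next performs a simple random walk, and
the reflections at the boundary of the box do not increase the mean of `cosh (l * displacement)`
beyond the factor `cosh l` for each step of that direction (`sum_walkProb_cosh_le`). There are about
`D / d` such steps, and leaving the cube from its centre needs a displacement of half an edge. With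
the best `l` the leakage is `exp (- d k^(2/d) N^c₂ / (8 c₁))` up to corrections of lower order in
the exponent, and Markov's inequality gives the statement on the probability
(`exists_measure_maxLeakage_le`).

*Algorithm.* For each source, a uniform number with `2 p` binary digits is compared with the
cumulative sums of the squared moduli of the rounded entries. The program is verified against an
abstract sampler by couplings (`couples_samplerProg`), with an invariant for the cost; the law of
the sampler is a product of laws of single photons, which differ from the ideal ones by the rounding
errors (`tvDist_outputProb_le`).
-/

namespace LinearOptics

variable {d : ℕ} {m : Fin d → ℕ} {L : ℕ}

/-! ### Beam splitter steps preserve the norm -/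

theorem partner_of_ne (i j : Fin d) (b : Fin 2) (x : Mode m L) (h : j ≠ i) :
    partner i b x j = x j := by
  unfold partner
  split_ifs <;> simp [Function.update_of_ne h]

theorem partner_val (i : Fin d) (b : Fin 2) (x : Mode m L) :
    (partner i b x i : ℕ) =
      if (x i : ℕ) % 2 = b then (if (x i : ℕ) + 1 < m i * L then (x i : ℕ) + 1 else x i)
      else (x i : ℕ) - 1 := by
  unfold partner
  split_ifs <;> simp

theorem partner_eq_iff (i : Fin d) (b : Fin 2) (x y : Mode m L) :
    partner i b x = y ↔ (∀ j, j ≠ i → x j = y j) ∧ (partner i b x i : ℕ) = y i := by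
  constructor
  · rintro rfl
    exact ⟨fun j hj => (partner_of_ne i j b x hj).symm, rfl⟩
  · rintro ⟨h1, h2⟩
    funext j
    by_cases hj : j = i
    · subst hj; exact Fin.ext h2
    · rw [partner_of_ne i j b x hj, h1 j hj]

theorem partner_involutive (i : Fin d) (b : Fin 2) :
    Function.Involutive (partner (m := m) (L := L) i b) := by
  intro x
  rw [partner_eq_iff]
  refine ⟨fun j hj => partner_of_ne i j b x hj, ?_⟩
  rw [partner_val, partner_val]
  have := (x i).isLt
  have := b.isLt
  split_ifs <;> omega

/-- The two members of a coupled pair have coordinates of different parity. -/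
theorem partner_parity (i : Fin d) (b : Fin 2) (x : Mode m L) (h : partner i b x ≠ x) :
    ((partner i b x i : ℕ) % 2 = b ↔ ¬ (x i : ℕ) % 2 = b) := by
  have hv := partner_val i b x
  have hne : (partner i b x i : ℕ) ≠ x i := by
    intro h'
    exact h ((partner_eq_iff i b x x).2 ⟨fun _ _ => rfl, h'⟩)
  have := b.isLt
  have := (x i).isLt
  split_ifs at hv <;> omega

/-- The amplitude of the mode `x` after a step only depends on the amplitudes of `x` and of its
partner. -/
theorem layer_mulVec (i : Fin d) (b : Fin 2) (w : Mode m L → ℝ × ℝ) (v : Mode m L → ℂ)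
    (x : Mode m L) :
    (layer i b w).mulVec v x =
      if partner i b x = x then v x
      else if (x i : ℕ) % 2 = b then
        Real.cos (w x).1 * v x +
          Complex.exp (Complex.I * ((w x).2 : ℂ)) * (Real.sin (w x).1 : ℂ) * v (partner i b x)
      else Real.cos (w (partner i b x)).1 * v x +
          -Complex.exp (-(Complex.I * ((w (partner i b x)).2 : ℂ))) *
        (Real.sin (w (partner i b x)).1 : ℂ) * v (partner i b x) := by
  have two : ∀ (z : Mode m L) (a c : ℂ), z ≠ x →
      ∑ y, (if y = x then a else if y = z then c else 0) * v y = a * v x + c * v z := by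
    intro z a c hz
    have h : ∀ y : Mode m L, (if y = x then a else if y = z then c else 0) * v y =
        (if y = x then a * v y else 0) + (if y = z then c * v y else 0) := by
      intro y
      by_cases hy : y = x
      · subst hy; simp [hz.symm]
      · simp [hy]
    simp only [h, Finset.sum_add_distrib, Finset.sum_ite_eq', Finset.mem_univ, if_true]
  unfold Matrix.mulVec dotProduct layer
  by_cases h1 : partner i b x = x
  · simp [h1]
  · by_cases h2 : (x i : ℕ) % 2 = b
    · simp only [if_neg h1, if_pos h2]
      exact two _ _ _ h1
    · simp only [if_neg h1, if_neg h2]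
      exact two _ _ _ h1

/-- Squared modulus of the amplitude at the first output of a beam splitter. -/
theorem normSq_beamSplitter (θ φ : ℝ) (u v : ℂ) :
    ‖(Real.cos θ : ℂ) * u + Complex.exp (Complex.I * (φ : ℂ)) * (Real.sin θ : ℂ) * v‖ ^ 2 =
      Real.cos θ ^ 2 * ‖u‖ ^ 2 + Real.sin θ ^ 2 * ‖v‖ ^ 2 +
        2 * (Real.cos θ * Real.sin θ) *
          ((v * (starRingEnd ℂ) u).re * Real.cos φ - (v * (starRingEnd ℂ) u).im * Real.sin φ) := by
  have he : Complex.exp (Complex.I * (φ : ℂ)) = Real.cos φ + Real.sin φ * Complex.I := by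
    rw [mul_comm, Complex.exp_mul_I]; simp
  rw [he]
  simp only [← Complex.normSq_eq_norm_sq, Complex.normSq_apply, Complex.add_re, Complex.add_im,
    Complex.mul_re, Complex.mul_im, Complex.ofReal_re, Complex.ofReal_im, Complex.I_re,
    Complex.I_im, Complex.conj_re, Complex.conj_im]
  have h := Real.sin_sq_add_cos_sq φ
  have : Real.sin φ ^ 2 = 1 - Real.cos φ ^ 2 := by linarith
  ring_nf
  simp only [this]
  ring

/-- Squared modulus of the amplitude at the second output of a beam splitter. -/
theorem normSq_beamSplitter' (θ φ : ℝ) (u v : ℂ) :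
    ‖(Real.cos θ : ℂ) * v + -Complex.exp (-(Complex.I * (φ : ℂ))) * (Real.sin θ : ℂ) * u‖ ^ 2 =
      Real.cos θ ^ 2 * ‖v‖ ^ 2 + Real.sin θ ^ 2 * ‖u‖ ^ 2 -
        2 * (Real.cos θ * Real.sin θ) *
          ((v * (starRingEnd ℂ) u).re * Real.cos φ - (v * (starRingEnd ℂ) u).im * Real.sin φ) := by
  have h := normSq_beamSplitter (-θ) (-φ) v u
  have e : (Real.cos θ : ℂ) * v + -Complex.exp (-(Complex.I * (φ : ℂ))) * (Real.sin θ : ℂ) * u =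
      (Real.cos (-θ) : ℂ) * v +
        Complex.exp (Complex.I * ((-φ : ℝ) : ℂ)) * (Real.sin (-θ) : ℂ) * u := by
    rw [Real.cos_neg, Real.sin_neg]; push_cast; ring_nf
  rw [e, h]
  simp only [Real.cos_neg, Real.sin_neg, Complex.mul_re, Complex.mul_im, Complex.conj_re,
    Complex.conj_im]
  ring

theorem sum_normSq_layer_mulVec (i : Fin d) (b : Fin 2) (w : Mode m L → ℝ × ℝ)
    (v : Mode m L → ℂ) :
    ∑ x, ‖(layer i b w).mulVec v x‖ ^ 2 = ∑ x, ‖v x‖ ^ 2 := by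
  set e : Equiv.Perm (Mode m L) := (partner_involutive i b).toPerm with he
  have hswap : ∀ g : Mode m L → ℝ, ∑ x, g (partner i b x) = ∑ x, g x := fun g =>
    Equiv.sum_comp e g
  -- each coupled pair keeps its total weight, so the sum is symmetrized over the pairs
  have key : ∀ x, ‖(layer i b w).mulVec v x‖ ^ 2 + ‖(layer i b w).mulVec v (partner i b x)‖ ^ 2 =
      ‖v x‖ ^ 2 + ‖v (partner i b x)‖ ^ 2 := by
    intro x
    have hinv := partner_involutive i b x
    rw [layer_mulVec, layer_mulVec]
    by_cases h : partner i b x = x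
    · simp [h]
    · have hp := partner_parity i b x h
      simp only [hinv, if_neg h, if_neg (Ne.symm h)]
      by_cases hx : (x i : ℕ) % 2 = b
      · have hx' : ¬ (partner i b x i : ℕ) % 2 = b := by tauto
        rw [if_pos hx, if_neg hx', normSq_beamSplitter, normSq_beamSplitter']
        have := Real.sin_sq_add_cos_sq (w x).1
        linear_combination (‖v x‖ ^ 2 + ‖v (partner i b x)‖ ^ 2) * this
      · have hx' : (partner i b x i : ℕ) % 2 = b := by tauto
        rw [if_neg hx, if_pos hx', normSq_beamSplitter, normSq_beamSplitter']
        have := Real.sin_sq_add_cos_sq (w (partner i b x)).1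
        linear_combination (‖v x‖ ^ 2 + ‖v (partner i b x)‖ ^ 2) * this
  have h := Finset.sum_congr rfl fun x (_ : x ∈ Finset.univ) => key x
  rw [Finset.sum_add_distrib, Finset.sum_add_distrib,
    hswap (fun x => ‖(layer i b w).mulVec v x‖ ^ 2), hswap (fun x => ‖v x‖ ^ 2)] at h
  linarith

theorem circuit_succ_apply (sched : ℕ → Fin d × Fin 2) (D : ℕ) (ω : Angles m L (D + 1))
    (x s : Mode m L) :
    circuit sched (D + 1) ω x s = (layer (sched D).1 (sched D).2 (ω (Fin.last D))).mulVec
      (fun y => circuit sched D (fun τ => ω τ.castSucc) y s) x := rfl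

theorem sum_normSq_circuit (sched : ℕ → Fin d × Fin 2) (D : ℕ) (ω : Angles m L D)
    (s : Mode m L) : ∑ x, ‖circuit sched D ω x s‖ ^ 2 = 1 := by
  induction D with
  | zero => simp [circuit, Matrix.one_apply, apply_ite (fun z : ℂ => ‖z‖ ^ 2)]
  | succ D ih =>
    simp only [circuit_succ_apply]
    rw [sum_normSq_layer_mulVec]
    exact ih _

theorem norm_circuit_le_one (sched : ℕ → Fin d × Fin 2) (D : ℕ) (ω : Angles m L D)
    (x s : Mode m L) : ‖circuit sched D ω x s‖ ≤ 1 := by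
  have h := Finset.single_le_sum (f := fun x => ‖circuit sched D ω x s‖ ^ 2)
    (fun _ _ => by positivity) (Finset.mem_univ x)
  rw [sum_normSq_circuit] at h
  exact (sq_le_one_iff₀ (norm_nonneg _)).1 h

/-! ### Total variation distance of image distributions -/

/-- Two distributions on the outcomes whose difference at `t` is bounded by the weight `B` of the
configurations with outcome `t`. -/
theorem tvDist_le_of_fiber {Ω ι : Type} [Fintype ι] [DecidableEq Ω] (P Q : Ω → ℝ) (g : ι → Ω)
    (B : ι → ℝ) (hB : ∀ f, 0 ≤ B f)
    (h : ∀ t, |P t - Q t| ≤ ∑ f, if g f = t then B f else 0) :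
    tvDist P Q ≤ ENNReal.ofReal ((∑ f, B f) / 2) := by
  unfold tvDist
  rw [ENNReal.ofReal_div_of_pos (by norm_num), ENNReal.ofReal_ofNat]
  gcongr
  calc ∑' t, ENNReal.ofReal |P t - Q t|
      ≤ ∑' t, ENNReal.ofReal (∑ f, if g f = t then B f else 0) :=
        ENNReal.tsum_le_tsum fun t => ENNReal.ofReal_le_ofReal (h t)
    _ = ∑' t, ∑ f, (if t = g f then ENNReal.ofReal (B f) else 0) := by
        refine tsum_congr fun t => ?_
        rw [ENNReal.ofReal_sum_of_nonneg (fun f _ => by split_ifs <;> simp [hB])]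
        refine Finset.sum_congr rfl fun f _ => ?_
        by_cases hf : g f = t
        · simp [hf]
        · simp [hf, Ne.symm hf]
    _ = ∑ f, ∑' t, (if t = g f then ENNReal.ofReal (B f) else 0) :=
        Summable.tsum_finsetSum fun _ _ => ENNReal.summable
    _ = ENNReal.ofReal (∑ f, B f) := by
        simp only [tsum_ite_eq]
        rw [ENNReal.ofReal_sum_of_nonneg fun f _ => hB f]

theorem tvDist_triangle {Ω : Type} (P Q R : Ω → ℝ) :
    tvDist P R ≤ tvDist P Q + tvDist Q R := by
  unfold tvDist
  rw [← ENNReal.add_div, ← ENNReal.tsum_add]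
  gcongr with t
  rw [← ENNReal.ofReal_add (abs_nonneg _) (abs_nonneg _)]
  exact ENNReal.ofReal_le_ofReal (abs_sub_le _ _ _)

/-! ### Counting permutations -/

/-- The permutations `σ` with `f ∘ σ = g` are counted by the occupation numbers, if `f` and `g`
have the same occupation numbers. -/
theorem card_perm_comp_eq {S X : Type} [Fintype S] [DecidableEq S] [Fintype X] [DecidableEq X]
    (f g : S → X)
    (h : ∀ x, (Finset.univ.filter fun α => f α = x).card =
      (Finset.univ.filter fun α => g α = x).card) :
    (Finset.univ.filter fun σ : Equiv.Perm S => f ∘ σ = g).card =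
      ∏ x, ((Finset.univ.filter fun α => f α = x).card).factorial := by
  have e : ∀ x, {a // g a = x} ≃ {a // f a = x} := fun x =>
    Fintype.equivOfCardEq (by rw [Fintype.card_subtype, Fintype.card_subtype]; exact (h x).symm)
  set σ₀ : Equiv.Perm S := Equiv.ofFiberEquiv e
  have hσ₀ : f ∘ σ₀ = g := funext fun a => Equiv.ofFiberEquiv_map e a
  have hs : (Finset.univ.filter fun σ : Equiv.Perm S => f ∘ σ = g).card =
      (Finset.univ.filter fun σ : Equiv.Perm S => f ∘ σ = f).card := by
    refine Finset.card_bij' (fun σ _ => σ * σ₀⁻¹) (fun σ _ => σ * σ₀) ?_ ?_ ?_ ?_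
    · intro σ hσ
      simp only [Finset.mem_filter, Finset.mem_univ, true_and] at hσ ⊢
      funext a
      have h1 := congrFun hσ (σ₀⁻¹ a)
      have h2 := congrFun hσ₀ (σ₀⁻¹ a)
      simp only [Function.comp_apply, Equiv.Perm.mul_apply] at h1 h2 ⊢
      rw [h1, ← h2, ← Equiv.Perm.mul_apply, mul_inv_cancel, Equiv.Perm.one_apply]
    · intro σ hσ
      simp only [Finset.mem_filter, Finset.mem_univ, true_and] at hσ ⊢
      funext a
      have h1 := congrFun hσ (σ₀ a)
      have h2 := congrFun hσ₀ a
      simp only [Function.comp_apply, Equiv.Perm.mul_apply] at h1 h2 ⊢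
      rw [h1, ← h2]
    · intro σ _; simp
    · intro σ _; simp
  rw [hs, ← Fintype.card_subtype, DomMulAct.stabilizer_card]
  simp only [Fintype.card_subtype]

/-- The permutations other than the identity, weighted by `u` to the number of moved points: choose
the set of moved points, which has at least two elements, and their images. -/
theorem sum_pow_card_support_le {S : Type} [Fintype S] [DecidableEq S] (u : ℝ) (hu : 0 ≤ u) :
    ∑ σ ∈ Finset.univ.erase (1 : Equiv.Perm S), u ^ σ.support.card ≤
      (Fintype.card S * u + 1) ^ Fintype.card S
        - Fintype.card S * (Fintype.card S * u) - 1 := by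
  set n := Fintype.card S with hn
  set F : Finset (Finset S) := Finset.univ.filter fun T => 2 ≤ T.card with hF
  have hmaps : ∀ σ ∈ Finset.univ.erase (1 : Equiv.Perm S), σ.support ∈ F := by
    intro σ hσ
    simp only [hF, Finset.mem_filter, Finset.mem_univ, true_and]
    exact Equiv.Perm.two_le_card_support_of_ne_one (Finset.ne_of_mem_erase hσ)
  have hfib : ∀ T : Finset S, ((Finset.univ.erase (1 : Equiv.Perm S)).filter
      fun σ => σ.support = T).card ≤ n ^ T.card := by
    intro T
    have hc : Fintype.card (T → S) = n ^ T.card := by simp [hn]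
    rw [← hc, ← Finset.card_univ]
    refine Finset.card_le_card_of_injOn (fun σ (a : T) => σ a)
      (fun _ _ => Finset.mem_coe.2 (Finset.mem_univ _)) ?_
    intro σ hσ τ hτ hστ
    simp only [Finset.coe_filter, Finset.mem_erase, Set.mem_ofPred_eq] at hσ hτ
    ext a
    by_cases ha : a ∈ T
    · exact congrFun hστ ⟨a, ha⟩
    · have h1 : σ a = a := by rw [← hσ.2] at ha; exact Equiv.Perm.notMem_support.1 ha
      have h2 : τ a = a := by rw [← hτ.2] at ha; exact Equiv.Perm.notMem_support.1 ha
      rw [h1, h2]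
  have hall : ∑ T : Finset S, (n * u) ^ T.card = (n * u + 1) ^ n := by
    have := Finset.sum_pow_mul_eq_add_pow (n * u : ℝ) 1 (Finset.univ : Finset S)
    simpa [hn] using this
  have hlow : ∑ T ∈ Finset.univ.filter (fun T : Finset S => ¬ 2 ≤ T.card), (n * u) ^ T.card =
      1 + n * (n * u) := by
    have hsplit : Finset.univ.filter (fun T : Finset S => ¬ 2 ≤ T.card) =
        Finset.powersetCard 0 Finset.univ ∪ Finset.powersetCard 1 Finset.univ := by
      ext T
      simp only [Finset.mem_filter, Finset.mem_univ, true_and, Finset.mem_union,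
        Finset.mem_powersetCard, Finset.subset_univ]
      omega
    rw [hsplit, Finset.sum_union]
    · rw [Finset.sum_congr rfl (fun T hT => by rw [(Finset.mem_powersetCard.1 hT).2]),
        Finset.sum_congr (s₁ := Finset.powersetCard 1 Finset.univ) rfl
          (fun T hT => by rw [(Finset.mem_powersetCard.1 hT).2])]
      simp [hn]
    · rw [Finset.disjoint_left]
      intro T h0 h1
      have h2 := (Finset.mem_powersetCard.1 h0).2
      have h3 := (Finset.mem_powersetCard.1 h1).2
      omega
  calc ∑ σ ∈ Finset.univ.erase (1 : Equiv.Perm S), u ^ σ.support.card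
      = ∑ T ∈ F, ∑ σ ∈ (Finset.univ.erase (1 : Equiv.Perm S)).filter (fun σ => σ.support = T),
          u ^ σ.support.card := (Finset.sum_fiberwise_of_maps_to hmaps _).symm
    _ ≤ ∑ T ∈ F, (n * u) ^ T.card := by
        refine Finset.sum_le_sum fun T _ => ?_
        rw [Finset.sum_congr rfl (fun σ hσ => by rw [(Finset.mem_filter.1 hσ).2]),
          Finset.sum_const, nsmul_eq_mul, mul_pow]
        have := hfib T
        gcongr
        exact_mod_cast this
    _ = _ := by
        have := Finset.sum_filter_add_sum_filter_not Finset.univ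
          (fun T : Finset S => 2 ≤ T.card) (fun T => (n * u : ℝ) ^ T.card)
        rw [hall, hlow] at this
        linarith

/-! ### Boson interference as a sum over permutations -/

section Interference

variable {S X : Type} [Fintype S] [DecidableEq S] [Fintype X]

/-- The amplitude of an outcome is a sum over the assignments of the photons to modes. -/
theorem coeff_prod_linear [DecidableEq X] (V : S → X → ℂ) (t : X → ℕ) :
    (∏ α, ∑ x, MvPolynomial.C (V α x) * MvPolynomial.X x).coeff
      (Finsupp.equivFunOnFinite.symm t) =
      ∑ f : S → X, if (fun x => (Finset.univ.filter fun α => f α = x).card) = t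
        then ∏ α, V α (f α) else 0 := by
  rw [Finset.prod_univ_sum, Fintype.piFinset_univ, MvPolynomial.coeff_sum]
  refine Finset.sum_congr rfl fun f _ => ?_
  have hm : ∏ α, (MvPolynomial.C (V α (f α)) * MvPolynomial.X (f α) : MvPolynomial X ℂ) =
      MvPolynomial.monomial (∑ α, Finsupp.single (f α) 1) (∏ α, V α (f α)) := by
    rw [MvPolynomial.monomial_sum_index]
    rw [map_prod, Finset.prod_mul_distrib]
    rfl
  rw [hm, MvPolynomial.coeff_monomial]
  congr 1
  rw [Equiv.eq_symm_apply]
  refine propext (Eq.congr_left ?_)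
  funext x
  rw [Finsupp.equivFunOnFinite_apply, Finsupp.finsetSum_apply, Finset.card_filter]
  simp [Finsupp.single_apply]

/-- The bosonic factor `∏ x, (t x)!` turns the sum over the assignments with the same outcome as `f`
into a sum over permutations of the photons. -/
theorem interference_sum [DecidableEq X] (V : S → X → ℂ) (t : X → ℕ) (f : S → X)
    (hf : (fun x => (Finset.univ.filter fun α => f α = x).card) = t) :
    (∏ x, ((t x).factorial : ℂ)) * ∑ g : S → X,
      (if (fun x => (Finset.univ.filter fun α => g α = x).card) = t then ∏ α, V α (g α) else 0) =
    ∑ σ : Equiv.Perm S, ∏ α, V α (f (σ α)) := by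
  have hσ : ∀ σ : Equiv.Perm S,
      (fun x => (Finset.univ.filter fun α => f (σ α) = x).card) = t := by
    intro σ
    rw [← hf]
    funext x
    exact Finset.card_equiv σ (by simp)
  rw [Finset.mul_sum,
    ← Finset.sum_fiberwise (Finset.univ : Finset (Equiv.Perm S)) (fun σ => f ∘ σ)]
  refine Finset.sum_congr rfl fun g _ => ?_
  have : ∑ σ ∈ Finset.univ.filter (fun σ : Equiv.Perm S => f ∘ σ = g), ∏ α, V α (f (σ α)) =
      (Finset.univ.filter (fun σ : Equiv.Perm S => f ∘ σ = g)).card * ∏ α, V α (g α) := by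
    rw [← nsmul_eq_mul, ← Finset.sum_const]
    refine Finset.sum_congr rfl fun σ hσg => ?_
    rw [← (Finset.mem_filter.1 hσg).2]
    rfl
  rw [this]
  split_ifs with hg
  · rw [card_perm_comp_eq f g (fun x => (congrFun hf x).trans (congrFun hg x).symm)]
    push_cast
    congr 1
    refine Finset.prod_congr rfl fun x _ => ?_
    rw [← congrFun hf x]
  · rw [Finset.filter_eq_empty_iff.2]
    · simp
    · rintro σ - rfl
      exact hg (hσ σ)

/-- Born's rule as a sum over pairs of assignments of photons to modes that differ by a
permutation: the identity gives the distinguishable photons. -/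
theorem abs_born_sub_le [DecidableEq X] (V : S → X → ℂ) (t : X → ℕ) :
    |‖(Real.sqrt (∏ x, ((t x).factorial : ℝ)) : ℂ) *
        (∏ α, ∑ x, MvPolynomial.C (V α x) * MvPolynomial.X x).coeff
          (Finsupp.equivFunOnFinite.symm t)‖ ^ 2 -
      ∑ f : S → X, (if (fun x => (Finset.univ.filter fun α => f α = x).card) = t
        then ∏ α, ‖V α (f α)‖ ^ 2 else 0)| ≤
    ∑ f : S → X, if (fun x => (Finset.univ.filter fun α => f α = x).card) = t
      then ∑ σ ∈ Finset.univ.erase (1 : Equiv.Perm S), ∏ α, ‖V α (f α)‖ * ‖V α (f (σ α))‖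
      else 0 := by
  rw [coeff_prod_linear]
  set C : ℂ := ∑ f : S → X, if (fun x => (Finset.univ.filter fun α => f α = x).card) = t
        then ∏ α, V α (f α) else 0 with hC
  have h1 : ((‖(Real.sqrt (∏ x, ((t x).factorial : ℝ)) : ℂ) * C‖ ^ 2 : ℝ) : ℂ) =
      ∑ f : S → X, if (fun x => (Finset.univ.filter fun α => f α = x).card) = t
        then ∑ σ : Equiv.Perm S, ∏ α, V α (f α) * (starRingEnd ℂ) (V α (f (σ α))) else 0 := by
    rw [norm_mul, mul_pow, Complex.norm_real, Real.norm_eq_abs, sq_abs,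
      Real.sq_sqrt (by positivity), Complex.ofReal_mul, Complex.ofReal_pow, ← Complex.mul_conj',
      mul_left_comm]
    nth_rewrite 1 [hC]
    rw [Finset.sum_mul]
    refine Finset.sum_congr rfl fun f _ => ?_
    split_ifs with hf
    · have h2 := congrArg (starRingEnd ℂ) (interference_sum V t f hf)
      rw [← hC, map_mul, map_prod, map_sum (starRingEnd ℂ) (fun σ : Equiv.Perm S => _)] at h2
      simp only [Complex.conj_natCast, map_prod] at h2
      push_cast
      rw [h2, Finset.mul_sum]
      refine Finset.sum_congr rfl fun σ _ => ?_
      rw [← Finset.prod_mul_distrib]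
    · simp
  have h2 : ((∑ f : S → X, (if (fun x => (Finset.univ.filter fun α => f α = x).card) = t
        then ∏ α, ‖V α (f α)‖ ^ 2 else 0) : ℝ) : ℂ) =
      ∑ f : S → X, if (fun x => (Finset.univ.filter fun α => f α = x).card) = t
        then ∏ α, V α (f α) * (starRingEnd ℂ) (V α (f α)) else 0 := by
    push_cast
    refine Finset.sum_congr rfl fun f _ => ?_
    split_ifs
    · push_cast
      exact Finset.prod_congr rfl fun α _ => (Complex.mul_conj' _).symm
    · simp
  rw [← Real.norm_eq_abs, ← Complex.norm_real, Complex.ofReal_sub, h1, h2,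
    ← Finset.sum_sub_distrib]
  refine (norm_sum_le _ _).trans (Finset.sum_le_sum fun f _ => ?_)
  split_ifs with hf
  · rw [← Finset.add_sum_erase _ _ (Finset.mem_univ (1 : Equiv.Perm S))]
    simp only [Equiv.Perm.coe_one, id_eq, add_sub_cancel_left]
    refine (norm_sum_le _ _).trans (Finset.sum_le_sum fun σ _ => ?_)
    rw [norm_prod]
    simp
  · simp

/-- If the overlaps of the moduli of different photons are at most `u`, the interference terms
sum up to the weighted number of permutations. -/
theorem sum_interference_le (V : S → X → ℂ) (u : ℝ) (hu : 0 ≤ u)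
    (h1 : ∀ α, ∑ x, ‖V α x‖ ^ 2 = 1)
    (h2 : ∀ α β, α ≠ β → ∑ x, ‖V α x‖ * ‖V β x‖ ≤ u) :
    ∑ f : S → X, ∑ σ ∈ Finset.univ.erase (1 : Equiv.Perm S),
      ∏ α, ‖V α (f α)‖ * ‖V α (f (σ α))‖ ≤
      (Fintype.card S * u + 1) ^ Fintype.card S
        - Fintype.card S * (Fintype.card S * u) - 1 := by
  refine le_trans ?_ (sum_pow_card_support_le u hu)
  rw [Finset.sum_comm]
  refine Finset.sum_le_sum fun σ _ => ?_
  have hre : ∀ f : S → X, ∏ α, ‖V α (f α)‖ * ‖V α (f (σ α))‖ =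
      ∏ α, ‖V α (f α)‖ * ‖V (σ⁻¹ α) (f α)‖ := by
    intro f
    rw [Finset.prod_mul_distrib, Finset.prod_mul_distrib]
    congr 1
    rw [← Equiv.prod_comp σ (fun α => ‖V (σ⁻¹ α) (f α)‖)]
    simp
  simp only [hre]
  have := Finset.prod_univ_sum (fun _ : S => (Finset.univ : Finset X))
    (fun α x => ‖V α x‖ * ‖V (σ⁻¹ α) x‖)
  rw [Fintype.piFinset_univ] at this
  rw [← this, ← Equiv.Perm.support_inv]
  calc ∏ α, ∑ x, ‖V α x‖ * ‖V (σ⁻¹ α) x‖ ≤ ∏ α, (if α ∈ σ⁻¹.support then u else 1) := by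
        refine Finset.prod_le_prod (fun α _ => by positivity) fun α _ => ?_
        split_ifs with hα
        · exact h2 _ _ (Equiv.Perm.mem_support.1 hα).symm
        · rw [Equiv.Perm.notMem_support.1 hα, ← h1 α]
          exact le_of_eq (Finset.sum_congr rfl fun x _ => by ring)
    _ = u ^ σ⁻¹.support.card := by
        rw [Finset.prod_ite_mem, Finset.univ_inter, Finset.prod_const]

end Interference

/-! ### The error of treating the photons as distinguishable -/

theorem leakage_le_maxLeakage (o : Fin d → Fin L) (U : Matrix (Mode m L) (Mode m L) ℂ)
    (α : Cell m) : leakage o U α ≤ maxLeakage o U :=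
  le_ciSup (f := leakage o U) (Set.finite_range _).bddAbove α

theorem leakage_nonneg (o : Fin d → Fin L) (U : Matrix (Mode m L) (Mode m L) ℂ)
    (α : Cell m) : 0 ≤ leakage o U α :=
  Finset.sum_nonneg fun x _ => by split_ifs <;> positivity

theorem maxLeakage_nonneg (o : Fin d → Fin L) (U : Matrix (Mode m L) (Mode m L) ℂ) :
    0 ≤ maxLeakage o U := Real.iSup_nonneg fun α => leakage_nonneg o U α

/-- Two photons overlap at most by what leaks out of their sublattices: in every mode at least one
of them has leaked. -/
theorem overlap_le (o : Fin d → Fin L) (U : Matrix (Mode m L) (Mode m L) ℂ)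
    (hU : ∀ s, ∑ x, ‖U x s‖ ^ 2 = 1) (α β : Cell m) (h : α ≠ β) :
    ∑ x, ‖U x (source o α)‖ * ‖U x (source o β)‖ ≤ 2 * Real.sqrt (maxLeakage o U) := by
  have hleak : ∀ γ : Cell m, ∀ T : Finset (Mode m L), (∀ x ∈ T, cellOf x ≠ γ) →
      Real.sqrt (∑ x ∈ T, ‖U x (source o γ)‖ ^ 2) ≤ Real.sqrt (maxLeakage o U) := by
    intro γ T hT
    refine Real.sqrt_le_sqrt (le_trans ?_ (leakage_le_maxLeakage o U γ))
    unfold leakage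
    calc ∑ x ∈ T, ‖U x (source o γ)‖ ^ 2
        = ∑ x ∈ T, (if cellOf x = γ then 0 else ‖U x (source o γ)‖ ^ 2) :=
          Finset.sum_congr rfl fun x hx => by rw [if_neg (hT x hx)]
      _ ≤ _ := Finset.sum_le_sum_of_subset_of_nonneg (Finset.subset_univ _)
          fun x _ _ => by split_ifs <;> positivity
  have hone : ∀ γ : Cell m, ∀ T : Finset (Mode m L),
      Real.sqrt (∑ x ∈ T, ‖U x (source o γ)‖ ^ 2) ≤ 1 := by
    intro γ T
    rw [Real.sqrt_le_one]
    rw [← hU (source o γ)]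
    exact Finset.sum_le_sum_of_subset_of_nonneg (Finset.subset_univ _) fun x _ _ => by positivity
  rw [← Finset.sum_filter_add_sum_filter_not Finset.univ (fun x => cellOf x = α), two_mul]
  refine add_le_add ?_ ?_
  · refine (Real.sum_mul_le_sqrt_mul_sqrt _ _ _).trans ?_
    refine (mul_le_mul (hone α _) (hleak β _ fun x hx => ?_) (Real.sqrt_nonneg _)
      zero_le_one).trans_eq (one_mul _)
    rw [(Finset.mem_filter.1 hx).2]
    exact h
  · refine (Real.sum_mul_le_sqrt_mul_sqrt _ _ _).trans ?_
    exact (mul_le_mul (hleak α _ fun x hx => (Finset.mem_filter.1 hx).2) (hone β _)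
      (Real.sqrt_nonneg _) (Real.sqrt_nonneg _)).trans_eq (mul_one _)

/-- Bernoulli's inequality in the form that `(v + 1) ^ n - n v - 1` is monotone in `v`. -/
theorem add_one_pow_sub_mono (n : ℕ) {v w : ℝ} (hv : 0 ≤ v) (hvw : v ≤ w) :
    (v + 1) ^ n - n * v - 1 ≤ (w + 1) ^ n - n * w - 1 := by
  induction n with
  | zero => simp
  | succ n ih =>
    have h1 : (1 : ℝ) ≤ (v + 1) ^ n := one_le_pow₀ (by linarith)
    have h2 : (v + 1) ^ n ≤ (w + 1) ^ n := pow_le_pow_left₀ (by linarith) (by linarith) n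
    rw [pow_succ, pow_succ]
    push_cast
    nlinarith [mul_le_mul h2 hvw hv (by linarith)]

/-- The number of modes is at least that of the sources, so `c` dominates the number of sources
times the overlap `2 √η`. -/
theorem tvDist_ideal_distinguishable (k γ : ℝ) (N : ℕ) (o : Fin d → Fin L)
    (U : Matrix (Mode m L) (Mode m L) ℂ) (hU : ∀ s, ∑ x, ‖U x s‖ ^ 2 = 1)
    (hL : 0 < L) (hN : 0 < N) (hm : ∏ i, m i = N)
    (hM : ((∏ i, (m i * L) : ℕ) : ℝ) = k * (N : ℝ) ^ γ) :
    tvDist (idealProb o U) (distinguishableProb o U) ≤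
      ENNReal.ofReal (errorBound k γ N (maxLeakage o U)) := by
  set η := maxLeakage o U with hη
  have hη0 : 0 ≤ η := maxLeakage_nonneg o U
  set u := 2 * Real.sqrt η with hu
  have hu0 : 0 ≤ u := by positivity
  have hcard : Fintype.card (Cell m) = N := by simp [← hm]
  have hNM : (N : ℝ) ≤ k * (N : ℝ) ^ γ := by
    rw [← hM, ← hm]
    exact_mod_cast Finset.prod_le_prod' fun i _ => Nat.le_mul_of_pos_right _ hL
  have hN0 : (0 : ℝ) < N := by exact_mod_cast hN
  have hc : N * u ≤ 2 * Real.sqrt (η * k * (N : ℝ) ^ (γ + 1)) := by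
    have h1 : (N : ℝ) * Real.sqrt η = Real.sqrt (η * (N : ℝ) ^ 2) := by
      rw [Real.sqrt_mul hη0, Real.sqrt_sq hN0.le, mul_comm]
    have h2 : η * (N : ℝ) ^ 2 ≤ η * k * (N : ℝ) ^ (γ + 1) := by
      rw [Real.rpow_add hN0, Real.rpow_one, mul_assoc, sq, ← mul_assoc k]
      gcongr
    calc N * u = 2 * (N * Real.sqrt η) := by rw [hu]; ring
      _ ≤ _ := by rw [h1]; gcongr
  refine (tvDist_le_of_fiber _ _ (fun f : Cell m → Mode m L => occupation f) (fun f =>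
    ∑ σ ∈ Finset.univ.erase (1 : Equiv.Perm (Cell m)),
      ∏ α, ‖U (f α) (source o α)‖ * ‖U (f (σ α)) (source o α)‖)
    (fun f => Finset.sum_nonneg fun σ _ => Finset.prod_nonneg fun α _ => by positivity)
    (fun t => abs_born_sub_le (fun α x => U x (source o α)) t)).trans ?_
  refine ENNReal.ofReal_le_ofReal ?_
  unfold errorBound
  gcongr
  refine (sum_interference_le (fun α x => U x (source o α)) u hu0 (fun α => hU _)
    (fun α β h => overlap_le o U hU α β h)).trans ?_
  rw [hcard]
  exact add_one_pow_sub_mono N (by positivity) hc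

/-! ### Averaging over the angles gives a classical random walk -/

section RandomWalk

open MeasureTheory

theorem uniformAngle_eq : uniformAngle =
    (ENNReal.ofReal (2 * Real.pi))⁻¹ • volume.restrict (Set.Ico 0 (2 * Real.pi)) := by
  unfold uniformAngle ProbabilityTheory.cond
  rw [Real.volume_Ico, sub_zero]

instance : IsProbabilityMeasure uniformAngle := by
  unfold uniformAngle
  refine ProbabilityTheory.cond_isProbabilityMeasure_of_finite ?_ ?_ <;>
    rw [Real.volume_Ico, sub_zero]
  · simp [Real.pi_pos]
  · exact ENNReal.ofReal_ne_top

instance (D : ℕ) : IsProbabilityMeasure (circuitMeasure m L D) := by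
  unfold circuitMeasure
  infer_instance

theorem integral_uniformAngle (f : ℝ → ℝ) :
    ∫ θ, f θ ∂uniformAngle = (2 * Real.pi)⁻¹ * ∫ θ in (0 : ℝ)..2 * Real.pi, f θ := by
  rw [uniformAngle_eq, integral_smul_measure, ENNReal.toReal_inv,
    ENNReal.toReal_ofReal (by positivity), intervalIntegral.integral_of_le (by positivity),
    integral_Ico_eq_integral_Ioc, smul_eq_mul]

theorem integrable_uniformAngle (f : ℝ → ℝ) (hf : Continuous f) : Integrable f uniformAngle := by
  rw [uniformAngle_eq]
  refine Integrable.smul_measure ?_ (by simp [Real.pi_pos])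
  exact (hf.integrableOn_Icc (a := 0) (b := 2 * Real.pi)).mono_set Set.Ico_subset_Icc_self

/-- The interference terms of a beam splitter average out. -/
theorem lintegral_beamSplitter (a b r s : ℝ)
    (h : ∀ z : ℝ × ℝ, 0 ≤ Real.cos z.1 ^ 2 * a + Real.sin z.1 ^ 2 * b +
      Real.cos z.1 * Real.sin z.1 * (r * Real.cos z.2 + s * Real.sin z.2)) :
    ∫⁻ z, ENNReal.ofReal (Real.cos z.1 ^ 2 * a + Real.sin z.1 ^ 2 * b +
      Real.cos z.1 * Real.sin z.1 * (r * Real.cos z.2 + s * Real.sin z.2))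
      ∂(uniformAngle.prod uniformAngle) = ENNReal.ofReal ((a + b) / 2) := by
  have i1 : Integrable (fun z : ℝ × ℝ => Real.cos z.1 ^ 2 * a) (uniformAngle.prod uniformAngle) :=
    (integrable_uniformAngle (fun θ => Real.cos θ ^ 2) (by fun_prop)).mul_prod
      (integrable_uniformAngle (fun _ => a) (by fun_prop))
  have i2 : Integrable (fun z : ℝ × ℝ => Real.sin z.1 ^ 2 * b) (uniformAngle.prod uniformAngle) :=
    (integrable_uniformAngle (fun θ => Real.sin θ ^ 2) (by fun_prop)).mul_prod
      (integrable_uniformAngle (fun _ => b) (by fun_prop))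
  have i3 : Integrable (fun z : ℝ × ℝ => Real.cos z.1 * Real.sin z.1 *
      (r * Real.cos z.2 + s * Real.sin z.2)) (uniformAngle.prod uniformAngle) :=
    (integrable_uniformAngle (fun θ => Real.cos θ * Real.sin θ) (by fun_prop)).mul_prod
      (integrable_uniformAngle (fun φ => r * Real.cos φ + s * Real.sin φ) (by fun_prop))
  refine (ofReal_integral_eq_lintegral_ofReal ((i1.add i2).add i3)
    (Filter.Eventually.of_forall h)).symm.trans ?_
  congr 1
  have e1 := integral_prod_mul (μ := uniformAngle) (ν := uniformAngle)
    (fun θ => Real.cos θ ^ 2) (fun _ => a)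
  have e2 := integral_prod_mul (μ := uniformAngle) (ν := uniformAngle)
    (fun θ => Real.sin θ ^ 2) (fun _ => b)
  have e3 := integral_prod_mul (μ := uniformAngle) (ν := uniformAngle)
    (fun θ => Real.cos θ * Real.sin θ) (fun φ => r * Real.cos φ + s * Real.sin φ)
  rw [integral_add' (i1.add i2) i3, integral_add' i1 i2, e1, e2, e3]
  have z3 : ∫ φ, r * Real.cos φ + s * Real.sin φ ∂uniformAngle = 0 := by
    rw [integral_uniformAngle, intervalIntegral.integral_add
      (Continuous.intervalIntegrable (by fun_prop) _ _)
      (Continuous.intervalIntegrable (by fun_prop) _ _)]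
    simp
  have hpi := Real.pi_pos.ne'
  have z1 : ∫ θ, Real.cos θ ^ 2 ∂uniformAngle = 1 / 2 := by
    rw [integral_uniformAngle, integral_cos_sq]
    simp; field_simp
  have z2 : ∫ θ, Real.sin θ ^ 2 ∂uniformAngle = 1 / 2 := by
    rw [integral_uniformAngle, integral_sin_sq]
    simp; field_simp
  rw [z1, z2, z3]
  simp
  ring

theorem continuous_layer (i : Fin d) (b : Fin 2) (x y : Mode m L) :
    Continuous fun w : Mode m L → ℝ × ℝ => layer i b w x y := by
  unfold layer
  split_ifs <;> fun_prop

theorem continuous_circuit (sched : ℕ → Fin d × Fin 2) (D : ℕ) (x y : Mode m L) :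
    Continuous fun ω : Angles m L D => circuit sched D ω x y := by
  induction D generalizing x y with
  | zero => exact continuous_const
  | succ D ih =>
    simp only [circuit, Matrix.mul_apply]
    refine continuous_finsetSum _ fun z _ => ?_
    refine ((continuous_layer _ _ x z).comp (continuous_apply _)).mul ((ih z y).comp ?_)
    fun_prop

/-- One step with random angles, for fixed amplitudes before the step. -/
theorem lintegral_layer (i : Fin d) (b : Fin 2) (v : Mode m L → ℂ) (x : Mode m L) :
    ∫⁻ w, ENNReal.ofReal (‖(layer i b w).mulVec v x‖ ^ 2)
      ∂(Measure.pi fun _ : Mode m L => uniformAngle.prod uniformAngle) =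
      ENNReal.ofReal ((‖v x‖ ^ 2 + ‖v (partner i b x)‖ ^ 2) / 2) := by
  have hev : ∀ (z : Mode m L) (a b r s : ℝ),
      (∀ z : ℝ × ℝ, 0 ≤ Real.cos z.1 ^ 2 * a + Real.sin z.1 ^ 2 * b +
        Real.cos z.1 * Real.sin z.1 * (r * Real.cos z.2 + s * Real.sin z.2)) →
      ∫⁻ w, ENNReal.ofReal (Real.cos (w z).1 ^ 2 * a + Real.sin (w z).1 ^ 2 * b +
        Real.cos (w z).1 * Real.sin (w z).1 * (r * Real.cos (w z).2 + s * Real.sin (w z).2))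
        ∂(Measure.pi fun _ : Mode m L => uniformAngle.prod uniformAngle) =
        ENNReal.ofReal ((a + b) / 2) := by
    intro z a b r s h
    rw [← lintegral_beamSplitter a b r s h]
    exact (measurePreserving_eval
      (fun _ : Mode m L => uniformAngle.prod uniformAngle) z).lintegral_comp
      (f := fun z : ℝ × ℝ => ENNReal.ofReal (Real.cos z.1 ^ 2 * a + Real.sin z.1 ^ 2 * b +
        Real.cos z.1 * Real.sin z.1 * (r * Real.cos z.2 + s * Real.sin z.2)))
      (by fun_prop)
  simp only [layer_mulVec]
  by_cases h1 : partner i b x = x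
  · simp [h1]
  · simp only [if_neg h1]
    by_cases h2 : (x i : ℕ) % 2 = b
    · simp only [if_pos h2]
      have e : ∀ z : ℝ × ℝ, ‖(Real.cos z.1 : ℂ) * v x +
          Complex.exp (Complex.I * (z.2 : ℂ)) * (Real.sin z.1 : ℂ) * v (partner i b x)‖ ^ 2 =
          Real.cos z.1 ^ 2 * ‖v x‖ ^ 2 + Real.sin z.1 ^ 2 * ‖v (partner i b x)‖ ^ 2 +
          Real.cos z.1 * Real.sin z.1 *
            ((2 * (v (partner i b x) * (starRingEnd ℂ) (v x)).re) * Real.cos z.2 +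
              (-2 * (v (partner i b x) * (starRingEnd ℂ) (v x)).im) * Real.sin z.2) := by
        intro z
        rw [normSq_beamSplitter]
        ring
      simp only [e]
      exact hev x _ _ _ _ fun z => by rw [← e]; positivity
    · simp only [if_neg h2]
      have e : ∀ z : ℝ × ℝ, ‖(Real.cos z.1 : ℂ) * v x +
          -Complex.exp (-(Complex.I * (z.2 : ℂ))) * (Real.sin z.1 : ℂ) * v (partner i b x)‖ ^ 2 =
          Real.cos z.1 ^ 2 * ‖v x‖ ^ 2 + Real.sin z.1 ^ 2 * ‖v (partner i b x)‖ ^ 2 +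
          Real.cos z.1 * Real.sin z.1 *
            ((-2 * (v x * (starRingEnd ℂ) (v (partner i b x))).re) * Real.cos z.2 +
              (2 * (v x * (starRingEnd ℂ) (v (partner i b x))).im) * Real.sin z.2) := by
        intro z
        rw [normSq_beamSplitter']
        ring
      simp only [e]
      exact hev (partner i b x) _ _ _ _ fun z => by rw [← e]; positivity

/-- The random walk that starts in `s` and in each step moves to a uniformly chosen member of the
coupled pair of its site. -/
noncomputable def walkProb (sched : ℕ → Fin d × Fin 2) (s : Mode m L) : ℕ → Mode m L → ℝ
  | 0, x => if x = s then 1 else 0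
  | D + 1, x => (walkProb sched s D x +
      walkProb sched s D (partner (sched D).1 (sched D).2 x)) / 2

theorem walkProb_nonneg (sched : ℕ → Fin d × Fin 2) (s : Mode m L) (D : ℕ) (x : Mode m L) :
    0 ≤ walkProb sched s D x := by
  induction D generalizing x with
  | zero => unfold walkProb; split_ifs <;> simp
  | succ D ih => unfold walkProb; linarith [ih x, ih (partner (sched D).1 (sched D).2 x)]

/-- The mean transition probability of a photon is that of the random walk. -/
theorem lintegral_circuit (sched : ℕ → Fin d × Fin 2) (s : Mode m L) (D : ℕ) (x : Mode m L) :
    ∫⁻ ω, ENNReal.ofReal (‖circuit sched D ω x s‖ ^ 2) ∂(circuitMeasure m L D) =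
      ENNReal.ofReal (walkProb sched s D x) := by
  induction D generalizing x with
  | zero =>
    simp only [circuit, Matrix.one_apply, walkProb, lintegral_const, measure_univ, mul_one]
    by_cases h : x = s <;> simp [h]
  | succ D ih =>
    set μ : Measure (Mode m L → ℝ × ℝ) :=
      Measure.pi fun _ : Mode m L => uniformAngle.prod uniformAngle with hμ
    have hmp := measurePreserving_piFinSuccAbove (fun _ : Fin (D + 1) => μ) (Fin.last D)
    set F : (Mode m L → ℝ × ℝ) × Angles m L D → ℝ≥0∞ := fun z =>
      ENNReal.ofReal (‖(layer (sched D).1 (sched D).2 z.1).mulVec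
        (fun y => circuit sched D z.2 y s) x‖ ^ 2) with hF
    have hFc : Measurable F := by
      refine (ENNReal.continuous_ofReal.comp ((Continuous.norm ?_).pow 2)).measurable
      refine continuous_finsetSum _ fun z _ => ?_
      exact ((continuous_layer _ _ x z).comp continuous_fst).mul
        ((continuous_circuit sched D z s).comp continuous_snd)
    have h1 : ∫⁻ ω, ENNReal.ofReal (‖circuit sched (D + 1) ω x s‖ ^ 2)
        ∂(circuitMeasure m L (D + 1)) = ∫⁻ z, F z ∂(μ.prod (circuitMeasure m L D)) := by
      refine Eq.trans (lintegral_congr fun ω => ?_) (hmp.lintegral_comp hFc)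
      have he : MeasurableEquiv.piFinSuccAbove (fun _ => Mode m L → ℝ × ℝ) (Fin.last D) ω =
          (ω (Fin.last D), fun τ => ω τ.castSucc) :=
        Prod.ext rfl (funext fun j => congrArg ω (Fin.succAbove_last_apply j))
      rw [he]
      rfl
    rw [h1, lintegral_prod_symm _ hFc.aemeasurable]
    simp only [hF]
    have h2 : ∀ y : Angles m L D, ∫⁻ w, ENNReal.ofReal
        (‖(layer (sched D).1 (sched D).2 w).mulVec (fun z => circuit sched D y z s) x‖ ^ 2) ∂μ =
        (ENNReal.ofReal (‖circuit sched D y x s‖ ^ 2) + ENNReal.ofReal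
          (‖circuit sched D y (partner (sched D).1 (sched D).2 x) s‖ ^ 2)) / 2 := by
      intro y
      rw [hμ, lintegral_layer, ENNReal.ofReal_div_of_pos (by norm_num), ENNReal.ofReal_ofNat,
        ENNReal.ofReal_add (by positivity) (by positivity)]
    simp only [h2]
    have hmeas : ∀ y, Measurable fun ω : Angles m L D =>
        ENNReal.ofReal (‖circuit sched D ω y s‖ ^ 2) := fun y =>
      (ENNReal.continuous_ofReal.comp ((continuous_circuit sched D y s).norm.pow 2)).measurable
    simp only [div_eq_mul_inv]
    refine (lintegral_mul_const _ ((hmeas _).add (hmeas _))).trans ?_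
    refine (congrArg (· * (2 : ℝ≥0∞)⁻¹) ((lintegral_add_left (hmeas _) _).trans
      (congrArg₂ (· + ·) (ih _) (ih _)))).trans ?_
    rw [← ENNReal.ofReal_add (walkProb_nonneg _ _ _ _) (walkProb_nonneg _ _ _ _), walkProb,
      ENNReal.ofReal_div_of_pos (by norm_num), ENNReal.ofReal_ofNat, div_eq_mul_inv]

end RandomWalk

/-! ### The potential of a coordinate of the walk -/

/-- The steps of direction `i` alternate between the two parities: `β τ` is the parity of the next
such step, and `cnt τ` is the number of such steps before `τ`. -/
theorem exists_parity (hd : 0 < d) (sched : ℕ → Fin d × Fin 2) (hs : IsSchedule sched)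
    (i : Fin d) : ∃ (β : ℕ → Fin 2) (cnt : ℕ → ℕ), cnt 0 = 0 ∧
      (∀ τ, (sched τ).1 = i →
        (sched τ).2 = β τ ∧ β (τ + 1) = 1 - β τ ∧ cnt (τ + 1) = cnt τ + 1) ∧
      (∀ τ, (sched τ).1 ≠ i → β (τ + 1) = β τ ∧ cnt (τ + 1) = cnt τ) ∧
      ∀ τ, d * cnt τ ≤ τ + 2 * d := by
  obtain ⟨hper, hbij⟩ := hs
  have hmod : ∀ τ, sched τ = sched (τ % (2 * d)) := fun τ =>
    (Function.Periodic.map_mod_nat hper τ).symm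
  obtain ⟨t0, h0⟩ := hbij.2 (i, 0)
  obtain ⟨t1, h1⟩ := hbij.2 (i, 1)
  have hinj : ∀ (τ : ℕ) (b : Fin 2) (t : Fin (2 * d)), sched t = (i, b) → sched τ = (i, b) →
      τ % (2 * d) = t := by
    intro τ b t ht hτ
    rw [hmod] at hτ
    have := @hbij.1 ⟨τ % (2 * d), Nat.mod_lt _ (by omega)⟩ t (by simp only [hτ, ht])
    exact congrArg Fin.val this
  obtain ⟨lo, hi, b, hlt, hhi, hlo', hhi'⟩ : ∃ (lo hi : ℕ) (b : Fin 2), lo < hi ∧ hi < 2 * d ∧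
      (∀ τ, sched τ = (i, b) ↔ τ % (2 * d) = lo) ∧
      (∀ τ, sched τ = (i, 1 - b) ↔ τ % (2 * d) = hi) := by
    have e0 : ∀ τ, sched τ = (i, 0) ↔ τ % (2 * d) = t0 := fun τ =>
      ⟨hinj τ 0 t0 h0, fun h => by rw [hmod, h]; exact h0⟩
    have e1 : ∀ τ, sched τ = (i, 1) ↔ τ % (2 * d) = t1 := fun τ =>
      ⟨hinj τ 1 t1 h1, fun h => by rw [hmod, h]; exact h1⟩
    rcases lt_trichotomy (t0 : ℕ) t1 with h | h | h
    · exact ⟨t0, t1, 0, h, t1.isLt, e0, e1⟩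
    · exfalso
      have := (e0 t1).2 (by rw [h]; exact Nat.mod_eq_of_lt t1.isLt)
      rw [(e1 t1).2 (Nat.mod_eq_of_lt t1.isLt)] at this
      simp at this
    · exact ⟨t1, t0, 1, h, t0.isLt, e1, e0⟩
  have hcases : ∀ τ, (sched τ).1 = i →
      (sched τ).2 = b ∧ τ % (2 * d) = lo ∨ (sched τ).2 = 1 - b ∧ τ % (2 * d) = hi := by
    intro τ hτ
    have hb : (sched τ).2 = b ∨ (sched τ).2 = 1 - b := by
      generalize (sched τ).2 = c
      clear * -
      revert b c; decide
    rcases hb with hb | hb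
    · exact Or.inl ⟨hb, (hlo' τ).1 (Prod.ext hτ hb)⟩
    · exact Or.inr ⟨hb, (hhi' τ).1 (Prod.ext hτ hb)⟩
  have hne : ∀ τ, (sched τ).1 ≠ i → τ % (2 * d) ≠ lo ∧ τ % (2 * d) ≠ hi := by
    refine fun τ hτ => ⟨fun h => hτ ?_, fun h => hτ ?_⟩
    · rw [(hlo' τ).2 h]
    · rw [(hhi' τ).2 h]
  have hnext : ∀ τ, (τ % (2 * d) + 1 < 2 * d ∧ (τ + 1) % (2 * d) = τ % (2 * d) + 1 ∧
        (τ + 1) / (2 * d) = τ / (2 * d)) ∨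
      (τ % (2 * d) + 1 = 2 * d ∧ (τ + 1) % (2 * d) = 0 ∧
        (τ + 1) / (2 * d) = τ / (2 * d) + 1) := by
    intro τ
    have hr := Nat.mod_lt τ (show 0 < 2 * d by omega)
    have hq := Nat.div_add_mod τ (2 * d)
    rcases Nat.lt_or_ge (τ % (2 * d) + 1) (2 * d) with h | h
    · refine Or.inl ⟨h, ?_⟩
      have := (Nat.div_mod_unique (a := τ + 1) (b := 2 * d) (c := τ % (2 * d) + 1)
        (d := τ / (2 * d)) (by omega)).2 ⟨by omega, h⟩
      exact ⟨this.2, this.1⟩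
    · refine Or.inr ⟨by omega, ?_⟩
      have := (Nat.div_mod_unique (a := τ + 1) (b := 2 * d) (c := 0)
        (d := τ / (2 * d) + 1) (by omega)).2 ⟨by rw [mul_add]; omega, by omega⟩
      exact ⟨this.2, this.1⟩
  have hbb : 1 - (1 - b) = b := by clear * -; revert b; decide
  refine ⟨fun τ => if lo < τ % (2 * d) ∧ τ % (2 * d) ≤ hi then 1 - b else b,
    fun τ => 2 * (τ / (2 * d)) + (if lo < τ % (2 * d) then 1 else 0) +
      (if hi < τ % (2 * d) then 1 else 0), by simp, ?_, ?_, ?_⟩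
  · intro τ hτ
    rcases hcases τ hτ with ⟨hb, hr⟩ | ⟨hb, hr⟩
    · rcases hnext τ with ⟨h, h', h''⟩ | ⟨h, h', h''⟩
      · simp only [h', h'', hr, hb]
        refine ⟨by simp, ?_, ?_⟩
        · rw [if_pos (by omega), if_neg (by omega)]
        · split_ifs <;> omega
      · omega
    · rcases hnext τ with ⟨h, h', h''⟩ | ⟨h, h', h''⟩
      · simp only [h', h'', hr, hb]
        refine ⟨by simp [hlt], ?_, ?_⟩
        · rw [if_neg (by omega), if_pos (by omega), hbb]
        · split_ifs <;> omega
      · simp only [h', h'', hr, hb]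
        refine ⟨by simp [hlt], ?_, ?_⟩
        · rw [if_neg (by omega), if_pos (by omega), hbb]
        · split_ifs <;> omega
  · intro τ hτ
    obtain ⟨hr1, hr2⟩ := hne τ hτ
    rcases hnext τ with ⟨h, h', h''⟩ | ⟨h, h', h''⟩
    · simp only [h', h'']
      refine ⟨?_, by split_ifs <;> omega⟩
      split_ifs <;> first | rfl | omega
    · simp only [h', h'']
      refine ⟨?_, by split_ifs <;> omega⟩
      split_ifs <;> first | rfl | omega
  · intro τ
    have hq := Nat.div_add_mod τ (2 * d)
    have h2 : d * (2 * (τ / (2 * d)) + (if lo < τ % (2 * d) then 1 else 0) +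
      (if hi < τ % (2 * d) then 1 else 0)) ≤ d * (2 * (τ / (2 * d)) + 2) :=
      Nat.mul_le_mul_left _ (by split_ifs <;> omega)
    refine h2.trans ?_
    have : d * (2 * (τ / (2 * d)) + 2) = 2 * d * (τ / (2 * d)) + 2 * d := by ring
    omega

/-- The centre of the pair of parity `b` that contains `n`; it may lie outside of the box if `n`
has no partner. -/
noncomputable def pairCentre (b : Fin 2) (n : ℕ) : ℝ := if n % 2 = b then n + 1 / 2 else n - 1 / 2

/-- In a step of parity `b`, the centre of the pair of the other parity moves by one from the
centre of the pair of parity `b`, to either side with equal probability; a reflection at the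
boundary only brings it closer to the start. -/
theorem cosh_pairCentre_le (i : Fin d) (b : Fin 2) (l : ℝ) (s x : Mode m L) :
    (Real.cosh (l * (pairCentre (1 - b) (x i) - (s i : ℕ))) +
      Real.cosh (l * (pairCentre (1 - b) (partner i b x i) - (s i : ℕ)))) / 2 ≤
      Real.cosh l * Real.cosh (l * (pairCentre b (x i) - (s i : ℕ))) := by
  have hb1 : ((1 - b : Fin 2) : ℕ) = 1 - b := by revert b; decide
  have hb2 := b.isLt
  have hs : (s i : ℕ) + 1 ≤ m i * L := (s i).isLt
  have hx := (x i).isLt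
  have hsR : (0 : ℝ) ≤ (s i : ℕ) := Nat.cast_nonneg _
  have two : ∀ a : ℝ, (Real.cosh (a - l) + Real.cosh (a + l)) / 2 = Real.cosh l * Real.cosh a := by
    intro a
    rw [Real.cosh_add, Real.cosh_sub]
    ring
  have refl : ∀ a c : ℝ, |a| ≤ |c| →
      (Real.cosh (l * a) + Real.cosh (l * a)) / 2 ≤ Real.cosh l * Real.cosh (l * c) := by
    intro a c hac
    have h1 : Real.cosh (l * a) ≤ Real.cosh (l * c) := by
      rw [Real.cosh_le_cosh, abs_mul, abs_mul]
      gcongr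
    have h2 := Real.one_le_cosh l
    have h3 := Real.cosh_pos (l * c)
    nlinarith
  have hv := partner_val i b x
  unfold pairCentre
  rw [hb1]
  by_cases h : (x i : ℕ) % 2 = b
  · rw [if_pos h] at hv
    split_ifs at hv with h'
    · rw [hv, if_pos h, if_neg (by omega), if_pos (by omega), ← two]
      push_cast
      apply le_of_eq
      congr 3 <;> ring
    · rw [hv, if_pos h, if_neg (by omega)]
      apply refl
      have : (s i : ℕ) ≤ (x i : ℕ) := by omega
      have : ((s i : ℕ) : ℝ) ≤ (x i : ℕ) := by exact_mod_cast this
      rw [← sq_le_sq]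
      nlinarith
  · rw [if_neg h] at hv
    rcases Nat.eq_zero_or_pos (x i : ℕ) with h0 | h0
    · rw [hv, h0, if_pos (by omega), if_neg (by omega)]
      apply refl
      rw [← sq_le_sq]
      push_cast
      nlinarith
    · rw [hv, if_neg h, if_pos (by omega), if_neg (by omega), ← two, add_comm]
      rw [Nat.cast_sub (by omega)]
      push_cast
      apply le_of_eq
      congr 3 <;> ring

/-- The potential argument: the mean of the hyperbolic cosine of the displacement grows at most by
the factor `cosh l` in each step of direction `i`. -/
theorem sum_walkProb_cosh_le (sched : ℕ → Fin d × Fin 2) (s : Mode m L) (i : Fin d) (l : ℝ)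
    (β : ℕ → Fin 2) (cnt : ℕ → ℕ) (h0 : cnt 0 = 0)
    (h1 : ∀ τ, (sched τ).1 = i →
        (sched τ).2 = β τ ∧ β (τ + 1) = 1 - β τ ∧ cnt (τ + 1) = cnt τ + 1)
    (h2 : ∀ τ, (sched τ).1 ≠ i → β (τ + 1) = β τ ∧ cnt (τ + 1) = cnt τ) (D : ℕ) :
    ∑ x, walkProb sched s D x * Real.cosh (l * (pairCentre (β D) (x i) - (s i : ℕ))) ≤
      Real.cosh l ^ cnt D * Real.cosh (l / 2) := by
  induction D with
  | zero =>
    simp only [walkProb, ite_mul, one_mul, zero_mul, Finset.sum_ite_eq', Finset.mem_univ, if_true,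
      h0, pow_zero]
    unfold pairCentre
    rw [Real.cosh_le_cosh]
    apply le_of_eq
    split_ifs
    · congr 1; ring
    · rw [← abs_neg]; congr 1; ring
  | succ D ih =>
    have hswap : ∀ G : Mode m L → ℝ, ∑ x, walkProb sched s (D + 1) x * G x =
        ∑ x, walkProb sched s D x *
          ((G x + G (partner (sched D).1 (sched D).2 x)) / 2) := by
      intro G
      have hinv := partner_involutive (m := m) (L := L) (sched D).1 (sched D).2
      have h := Equiv.sum_comp hinv.toPerm
        (fun x => walkProb sched s D x * G (partner (sched D).1 (sched D).2 x))
      simp only [Function.Involutive.coe_toPerm, hinv _] at h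
      have e1 : ∀ x, walkProb sched s (D + 1) x * G x = walkProb sched s D x * G x / 2 +
          walkProb sched s D (partner (sched D).1 (sched D).2 x) * G x / 2 := by
        intro x; rw [walkProb]; ring
      have e2 : ∀ x, walkProb sched s D x *
          ((G x + G (partner (sched D).1 (sched D).2 x)) / 2) = walkProb sched s D x * G x / 2 +
          walkProb sched s D x * G (partner (sched D).1 (sched D).2 x) / 2 := by
        intro x; ring
      simp only [e1, e2, Finset.sum_add_distrib, ← Finset.sum_div, h]
    rw [hswap]
    by_cases hi : (sched D).1 = i
    · obtain ⟨hb, hβ, hc⟩ := h1 D hi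
      rw [hβ, hc, hi, hb, pow_succ]
      calc _ ≤ ∑ x, walkProb sched s D x *
            (Real.cosh l * Real.cosh (l * (pairCentre (β D) (x i) - (s i : ℕ)))) :=
            Finset.sum_le_sum fun x _ => mul_le_mul_of_nonneg_left
              (cosh_pairCentre_le i (β D) l s x) (walkProb_nonneg _ _ _ _)
        _ = Real.cosh l * ∑ x, walkProb sched s D x *
            Real.cosh (l * (pairCentre (β D) (x i) - (s i : ℕ))) := by
            rw [Finset.mul_sum]
            exact Finset.sum_congr rfl fun x _ => by ring
        _ ≤ Real.cosh l * (Real.cosh l ^ cnt D * Real.cosh (l / 2)) :=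
            mul_le_mul_of_nonneg_left ih (Real.cosh_pos l).le
        _ = _ := by ring
    · obtain ⟨hβ, hc⟩ := h2 D hi
      rw [hβ, hc]
      refine le_trans (le_of_eq ?_) ih
      refine Finset.sum_congr rfl fun x _ => ?_
      rw [partner_of_ne _ i _ x (Ne.symm hi)]
      ring

/-! ### The leakage of random circuits -/

section Leakage

open MeasureTheory

theorem cosh_le_exp {l : ℝ} (hl : 0 ≤ l) : Real.cosh l ≤ Real.exp l := by
  rw [Real.cosh_eq]
  have : Real.exp (-l) ≤ Real.exp l := Real.exp_le_exp.2 (by linarith)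
  linarith

/-- Outside of its sublattice, a photon has moved at least half an edge length. -/
theorem exists_displacement (o : Fin d → Fin L) (ho : IsCentral o) (α : Cell m) (x : Mode m L)
    (hx : cellOf x ≠ α) (b : Fin d → Fin 2) :
    ∃ i, ((L : ℝ) - 1) / 2 ≤ |pairCentre (b i) (x i) - (source o α i : ℕ)| := by
  obtain ⟨i, hi⟩ := Function.ne_iff.1 hx
  refine ⟨i, ?_⟩
  have h1 : (x i : ℕ) / L ≠ α i := fun h => hi (Fin.ext h)
  have hs : (source o α i : ℕ) = α i * L + o i := rfl
  have hL : 0 < L := lt_of_le_of_lt (Nat.zero_le _) (o i).isLt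
  obtain ⟨ho1, ho2⟩ := ho i
  have hcase : 2 * (x i : ℕ) + L ≤ 2 * (source o α i : ℕ) ∨
      2 * (source o α i : ℕ) + L ≤ 2 * (x i : ℕ) := by
    rcases lt_or_gt_of_ne h1 with h | h
    · left
      have := (Nat.div_lt_iff_lt_mul hL).1 h
      omega
    · right
      have := (Nat.le_div_iff_mul_le hL).1 (Nat.succ_le_of_lt h)
      rw [Nat.succ_mul] at this
      omega
  rw [le_abs]
  unfold pairCentre
  rcases hcase with h | h
  · right
    have : (2 * (x i : ℕ) + L : ℝ) ≤ 2 * (source o α i : ℕ) := by exact_mod_cast h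
    split_ifs <;> linarith
  · left
    have : (2 * (source o α i : ℕ) + L : ℝ) ≤ 2 * (x i : ℕ) := by exact_mod_cast h
    split_ifs <;> linarith

/-- The tail bound for the random walk: at most `D / d + 2` of the `D` steps belong to each
direction, and the parameter `l` of the exponential moment is free. -/
theorem sum_walkProb_outside_le (hd : 0 < d) (sched : ℕ → Fin d × Fin 2) (hs : IsSchedule sched)
    (o : Fin d → Fin L) (ho : IsCentral o) (D : ℕ) (α : Cell m) (l : ℝ) (hl : 0 ≤ l) :
    ∑ x : Mode m L, (if cellOf x = α then 0 else walkProb sched (source o α) D x) ≤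
      2 * d * Real.exp (D * l ^ 2 / (2 * d) + 3 * l - l * L / 2) := by
  choose β cnt h0 h1 h2 h3 using exists_parity hd sched hs
  have hL : (1 : ℝ) ≤ L := by
    have : 0 < L := lt_of_le_of_lt (Nat.zero_le _) (o ⟨0, hd⟩).isLt
    exact_mod_cast this
  set y := l * ((L - 1) / 2) with hy
  have hy0 : 0 ≤ y := by have : (0:ℝ) ≤ (L - 1) / 2 := by linarith
                         positivity
  set G : Fin d → Mode m L → ℝ := fun i x =>
    Real.cosh (l * (pairCentre (β i D) (x i) - (source o α i : ℕ))) with hG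
  have hcnt : ∀ i, Real.cosh l ^ cnt i D ≤ Real.exp (D * l ^ 2 / (2 * d) + 2 * l) := by
    intro i
    have hc : (d * (cnt i D - 2) : ℕ) ≤ D := by
      have := h3 i D
      rw [Nat.mul_sub]
      omega
    have hc' : ((cnt i D - 2 : ℕ) : ℝ) ≤ D / d := by
      rw [le_div_iff₀ (by exact_mod_cast hd), mul_comm]
      exact_mod_cast hc
    calc Real.cosh l ^ cnt i D ≤ Real.cosh l ^ ((cnt i D - 2) + 2) :=
          pow_le_pow_right₀ (Real.one_le_cosh l) (by omega)
      _ = Real.cosh l ^ (cnt i D - 2) * Real.cosh l ^ 2 := pow_add _ _ _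
      _ ≤ Real.exp (l ^ 2 / 2) ^ (cnt i D - 2) * Real.exp l ^ 2 := by
          have hp := (Real.cosh_pos l).le
          gcongr
          · exact Real.cosh_le_exp_half_sq l
          · exact cosh_le_exp hl
      _ = Real.exp ((cnt i D - 2 : ℕ) * (l ^ 2 / 2) + 2 * l) := by
          rw [← Real.exp_nat_mul, ← Real.exp_nat_mul, ← Real.exp_add]
          norm_cast
      _ ≤ _ := by
          rw [Real.exp_le_exp]
          have := mul_le_mul_of_nonneg_right hc' (show 0 ≤ l ^ 2 / 2 by positivity)
          have e : (D : ℝ) / d * (l ^ 2 / 2) = D * l ^ 2 / (2 * d) := by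
            field_simp
          linarith
  have hpt : ∀ x : Mode m L, Real.cosh y *
      (if cellOf x = α then 0 else walkProb sched (source o α) D x) ≤
      ∑ i, walkProb sched (source o α) D x * G i x := by
    intro x
    have hw := walkProb_nonneg sched (source o α) D x
    have hnn : ∀ i ∈ Finset.univ, 0 ≤ walkProb sched (source o α) D x * G i x := fun i _ =>
      mul_nonneg hw (Real.cosh_pos _).le
    split_ifs with hx
    · rw [mul_zero]
      exact Finset.sum_nonneg hnn
    · obtain ⟨i, hi⟩ := exists_displacement o ho α x hx (fun i => β i D)
      refine le_trans ?_ (Finset.single_le_sum hnn (Finset.mem_univ i))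
      rw [mul_comm]
      refine mul_le_mul_of_nonneg_left ?_ hw
      rw [hG, Real.cosh_le_cosh, abs_of_nonneg hy0, abs_mul, abs_of_nonneg hl]
      exact mul_le_mul_of_nonneg_left hi hl
  have hsum : Real.cosh y *
      ∑ x : Mode m L, (if cellOf x = α then 0 else walkProb sched (source o α) D x) ≤
      d * (Real.exp (D * l ^ 2 / (2 * d) + 2 * l) * Real.exp (l / 2)) := by
    rw [Finset.mul_sum]
    refine (Finset.sum_le_sum fun x _ => hpt x).trans ?_
    rw [Finset.sum_comm]
    calc _ ≤ ∑ _i : Fin d, (Real.exp (D * l ^ 2 / (2 * d) + 2 * l) * Real.exp (l / 2)) := by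
          refine Finset.sum_le_sum fun i _ => ?_
          refine (sum_walkProb_cosh_le sched (source o α) i l (β i) (cnt i) (h0 i) (h1 i) (h2 i)
            D).trans ?_
          exact mul_le_mul (hcnt i) (cosh_le_exp (by positivity)) (Real.cosh_pos _).le
            (Real.exp_pos _).le
      _ = _ := by simp
  have hcy : Real.exp y / 2 ≤ Real.cosh y := by
    rw [Real.cosh_eq]
    have := Real.exp_pos (-y)
    linarith
  have hS : 0 ≤ ∑ x : Mode m L, (if cellOf x = α then 0 else walkProb sched (source o α) D x) :=
    Finset.sum_nonneg fun x _ => by split_ifs <;> simp [walkProb_nonneg]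
  set S := ∑ x : Mode m L, (if cellOf x = α then 0 else walkProb sched (source o α) D x)
  have h4 : Real.exp y * S ≤
      2 * (d * (Real.exp (D * l ^ 2 / (2 * d) + 2 * l) * Real.exp (l / 2))) := by
    have := mul_le_mul_of_nonneg_right hcy hS
    linarith
  calc S = Real.exp (-y) * (Real.exp y * S) := by rw [← mul_assoc, ← Real.exp_add]; simp
    _ ≤ Real.exp (-y) *
        (2 * (d * (Real.exp (D * l ^ 2 / (2 * d) + 2 * l) * Real.exp (l / 2)))) := by gcongr
    _ = 2 * d * (Real.exp (-y) * Real.exp (D * l ^ 2 / (2 * d) + 2 * l) * Real.exp (l / 2)) := by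
        ring
    _ = _ := by
        rw [← Real.exp_add, ← Real.exp_add, hy]
        ring_nf

/-- Markov's inequality for the total leakage of all sources. -/
theorem measure_maxLeakage_gt_le (hd : 0 < d) (sched : ℕ → Fin d × Fin 2) (hs : IsSchedule sched)
    (o : Fin d → Fin L) (ho : IsCentral o) (D : ℕ) (l : ℝ) (hl : 0 ≤ l) (ε : ℝ) :
    circuitMeasure m L D {ω | ¬ maxLeakage o (circuit sched D ω) ≤ Real.exp (-ε)} ≤
      ENNReal.ofReal (2 * d * (∏ i, m i : ℕ) *
        Real.exp (D * l ^ 2 / (2 * d) + 3 * l - l * L / 2 + ε)) := by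
  have hterm : ∀ (α : Cell m) (x : Mode m L), Measurable fun ω : Angles m L D =>
      if cellOf x = α then (0 : ℝ≥0∞)
        else ENNReal.ofReal (‖circuit sched D ω x (source o α)‖ ^ 2) := by
    intro α x
    split_ifs
    · exact measurable_const
    · exact (ENNReal.continuous_ofReal.comp
        ((continuous_circuit sched D x (source o α)).norm.pow 2)).measurable
  have hleak : ∀ (α : Cell m) (ω : Angles m L D),
      ENNReal.ofReal (leakage o (circuit sched D ω) α) = ∑ x : Mode m L,
        if cellOf x = α then (0 : ℝ≥0∞)
        else ENNReal.ofReal (‖circuit sched D ω x (source o α)‖ ^ 2) := by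
    intro α ω
    unfold leakage
    rw [ENNReal.ofReal_sum_of_nonneg fun x _ => by split_ifs <;> positivity]
    refine Finset.sum_congr rfl fun x _ => ?_
    split_ifs <;> simp
  have hmean : ∀ α : Cell m, ∫⁻ ω, ENNReal.ofReal (leakage o (circuit sched D ω) α)
      ∂(circuitMeasure m L D) ≤
      ENNReal.ofReal (2 * d * Real.exp (D * l ^ 2 / (2 * d) + 3 * l - l * L / 2)) := by
    intro α
    simp only [hleak]
    rw [lintegral_finsetSum _ fun x _ => hterm α x]
    refine le_trans (le_of_eq ?_) (ENNReal.ofReal_le_ofReal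
      (sum_walkProb_outside_le hd sched hs o ho D α l hl))
    rw [ENNReal.ofReal_sum_of_nonneg fun x _ => by
      split_ifs <;> simp [walkProb_nonneg]]
    refine Finset.sum_congr rfl fun x _ => ?_
    split_ifs
    · simp
    · exact lintegral_circuit sched (source o α) D x
  have hsub : {ω : Angles m L D | ¬ maxLeakage o (circuit sched D ω) ≤ Real.exp (-ε)} ⊆
      {ω | ENNReal.ofReal (Real.exp (-ε)) ≤
        ∑ α : Cell m, ENNReal.ofReal (leakage o (circuit sched D ω) α)} := by
    intro ω hω
    rw [Set.mem_ofPred_eq, ← ENNReal.ofReal_sum_of_nonneg fun α _ => leakage_nonneg o _ α]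
    refine ENNReal.ofReal_le_ofReal ((not_le.1 hω).le.trans ?_)
    exact Real.iSup_le (fun α => Finset.single_le_sum
      (fun α _ => leakage_nonneg o _ α) (Finset.mem_univ α))
      (Finset.sum_nonneg fun α _ => leakage_nonneg o _ α)
  have hmeas : ∀ α : Cell m, Measurable fun ω : Angles m L D =>
      ENNReal.ofReal (leakage o (circuit sched D ω) α) := by
    intro α
    simp only [hleak]
    exact Finset.measurable_sum _ fun x _ => hterm α x
  refine (measure_mono hsub).trans ((meas_ge_le_lintegral_div
    (Finset.measurable_sum _ fun α _ => hmeas α).aemeasurable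
    (by simp [Real.exp_pos]) ENNReal.ofReal_ne_top).trans ?_)
  rw [lintegral_finsetSum _ fun α _ => hmeas α]
  calc _ ≤ (∑ _α : Cell m, ENNReal.ofReal
        (2 * d * Real.exp (D * l ^ 2 / (2 * d) + 3 * l - l * L / 2))) /
        ENNReal.ofReal (Real.exp (-ε)) := by
        gcongr with α
        exact hmean α
    _ = _ := by
        rw [Finset.sum_const, nsmul_eq_mul, Finset.card_univ, Fintype.card_pi]
        simp only [Fintype.card_fin]
        rw [← ENNReal.ofReal_natCast, ← ENNReal.ofReal_mul (by positivity),
          ← ENNReal.ofReal_div_of_pos (Real.exp_pos _), div_eq_mul_inv, ← Real.exp_neg, neg_neg,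
          Real.exp_add _ ε]
        congr 1
        ring

end Leakage

/-! ### Couplings of program runs with abstract samplers -/

/-- The distributions `ν` and `μ` have a coupling that is supported in the relation `Q`. Programs
are compared with abstract samplers by such couplings, which compose along `bind`. -/
def Couples {α β : Type} (ν : PMF α) (μ : PMF β) (Q : α → β → Prop) : Prop :=
  ∃ ρ : PMF (α × β), ρ.map Prod.fst = ν ∧ ρ.map Prod.snd = μ ∧ ∀ z ∈ ρ.support, Q z.1 z.2

/-- All possible outcomes of `μ` satisfy `Q`. -/
def Ensures {β : Type} (μ : PMF β) (Q : β → Prop) : Prop := ∀ s ∈ μ.support, Q s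

section Coupling

variable {α β γ δ : Type}

theorem Ensures.mono {μ : PMF β} {Q R : β → Prop} (h : Ensures μ Q) (hQR : ∀ s, Q s → R s) :
    Ensures μ R := fun s hs => hQR s (h s hs)

theorem ensures_pure {b : β} {Q : β → Prop} (h : Q b) : Ensures (PMF.pure b) Q := by
  intro s hs
  rw [PMF.mem_support_pure_iff] at hs
  exact hs ▸ h

theorem Ensures.bind {μ : PMF β} {k : β → PMF δ} {Q : β → Prop} {R : δ → Prop}
    (h : Ensures μ Q) (hk : ∀ s, Q s → Ensures (k s) R) : Ensures (μ.bind k) R := by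
  intro t ht
  obtain ⟨s, hs, hst⟩ := (PMF.mem_support_bind_iff _ _ _).1 ht
  exact hk s (h s hs) t hst

theorem bind_congr_support (ν : PMF α) (f g : α → PMF β) (h : ∀ a ∈ ν.support, f a = g a) :
    ν.bind f = ν.bind g := by
  ext b
  rw [PMF.bind_apply, PMF.bind_apply]
  refine tsum_congr fun a => ?_
  by_cases ha : ν a = 0
  · simp [ha]
  · rw [h a ((PMF.mem_support_iff _ _).2 ha)]

theorem Couples.mono {ν : PMF α} {μ : PMF β} {Q R : α → β → Prop} (h : Couples ν μ Q)
    (hQR : ∀ a s, Q a s → R a s) : Couples ν μ R := by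
  obtain ⟨ρ, h1, h2, h3⟩ := h
  exact ⟨ρ, h1, h2, fun z hz => hQR _ _ (h3 z hz)⟩

theorem couples_refl (ν : PMF α) : Couples ν ν Eq := by
  refine ⟨ν.map fun a => (a, a), ?_, ?_, ?_⟩
  · rw [PMF.map_comp]; exact PMF.map_id ν
  · rw [PMF.map_comp]; exact PMF.map_id ν
  · intro z hz
    obtain ⟨a, _, rfl⟩ := (PMF.mem_support_map_iff _ _ _).1 hz
    rfl

theorem Ensures.couples {μ : PMF β} {Q : β → Prop} (h : Ensures μ Q) (a : α) :
    Couples (PMF.pure a) μ fun a' s => a' = a ∧ Q s := by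
  refine ⟨μ.map fun s => (a, s), ?_, ?_, ?_⟩
  · rw [PMF.map_comp]; exact PMF.map_const μ a
  · rw [PMF.map_comp]; exact PMF.map_id μ
  · intro z hz
    obtain ⟨s, hs, rfl⟩ := (PMF.mem_support_map_iff _ _ _).1 hz
    exact ⟨rfl, h s hs⟩

theorem Couples.bind {ν : PMF α} {μ : PMF β} {Q : α → β → Prop} {k : α → PMF γ}
    {k' : β → PMF δ} {R : γ → δ → Prop} (h : Couples ν μ Q)
    (hk : ∀ a s, Q a s → Couples (k a) (k' s) R) : Couples (ν.bind k) (μ.bind k') R := by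
  classical
  obtain ⟨ρ, h1, h2, h3⟩ := h
  have : Nonempty (PMF (γ × δ)) := by
    obtain ⟨z, hz⟩ := ρ.support_nonempty
    exact ⟨(hk _ _ (h3 z hz)).choose⟩
  choose! K hK1 hK2 hK3 using hk
  refine ⟨ρ.bind fun z => K z.1 z.2, ?_, ?_, ?_⟩
  · rw [PMF.map_bind, ← h1, PMF.bind_map]
    exact bind_congr_support _ _ _ fun z hz => hK1 _ _ (h3 z hz)
  · rw [PMF.map_bind, ← h2, PMF.bind_map]
    exact bind_congr_support _ _ _ fun z hz => hK2 _ _ (h3 z hz)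
  · intro t ht
    obtain ⟨z, hz, hzt⟩ := (PMF.mem_support_bind_iff _ _ _).1 ht
    exact hK3 _ _ (h3 z hz) t hzt

theorem Couples.map_eq {ν : PMF α} {μ : PMF β} {Q : α → β → Prop} (h : Couples ν μ Q)
    (F : α → γ) (G : β → γ) (hFG : ∀ a s, Q a s → F a = G s) : μ.map G = ν.map F := by
  obtain ⟨ρ, h1, h2, h3⟩ := h
  rw [← h1, ← h2, PMF.map_comp, PMF.map_comp]
  exact bind_congr_support _ _ _ fun z hz => congrArg PMF.pure (hFG _ _ (h3 z hz)).symm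

theorem Couples.ensures {ν : PMF α} {μ : PMF β} {Q : α → β → Prop} (h : Couples ν μ Q)
    {R : β → Prop} (hR : ∀ a s, Q a s → R s) : Ensures μ R := by
  obtain ⟨ρ, _, h2, h3⟩ := h
  intro s hs
  rw [← h2] at hs
  obtain ⟨z, hz, rfl⟩ := (PMF.mem_support_map_iff _ _ _).1 hs
  exact hR _ _ (h3 z hz)

/-- The state of an abstract sampler after `n` rounds. -/
noncomputable def iterPMF (a : α) (k : ℕ → α → PMF α) : ℕ → PMF α
  | 0 => PMF.pure a
  | n + 1 => (iterPMF a k n).bind (k n)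

end Coupling

/-! ### Rules for programs -/

section Rules

variable {inp : ℕ → ℤ}

/-- The effect of an instruction that writes `v` to register `x` at a cost of at most `c`. -/
def Writes (x : ℕ) (v : ℤ) (c : ℕ) (s s' : State) : Prop :=
  s'.reg = Function.update s.reg x v ∧ s'.mem = s.mem ∧ s'.cost ≤ s.cost + c

theorem ensures_seq {p q : Prog} {s : State} {R Q : State → Prop} (h : Ensures (p.run inp s) R)
    (hq : ∀ s', R s' → Ensures (q.run inp s') Q) : Ensures ((Prog.seq p q).run inp s) Q :=
  Ensures.bind h hq

theorem couples_seq {α γ : Type} {ν : PMF α} {k : α → PMF γ} {p q : Prog} {s : State}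
    {R : α → State → Prop} {Q : γ → State → Prop} (h : Couples ν (p.run inp s) R)
    (hq : ∀ a s', R a s' → Couples (k a) (q.run inp s') Q) :
    Couples (ν.bind k) ((Prog.seq p q).run inp s) Q :=
  Couples.bind h hq

/-- Invariants of loops, relative to the rounds of an abstract sampler. -/
theorem couples_loop {α : Type} {a : α} {k : ℕ → α → PMF α} {x n : ℕ} {p : Prog} {s : State}
    (hn : s.reg x = n) (I : ℕ → α → State → Prop) (h0 : I 0 a (s.tick (1 + bits (s.reg x))))
    (hs : ∀ i < n, ∀ a s', I i a s' → Couples (k i a) (p.run inp (s'.tick 1)) (I (i + 1))) :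
    Couples (iterPMF a k n) ((Prog.loop x p).run inp s) (I n) := by
  have hr : (s.reg x).toNat = n := by rw [hn]; exact Int.toNat_natCast n
  rw [Prog.run, hr]
  have : ∀ i ≤ n, Couples (iterPMF a k i)
      (Nat.rec (motive := fun _ => PMF State) (PMF.pure (s.tick (1 + bits (s.reg x))))
        (fun _ acc => acc.bind fun s' => p.run inp (s'.tick 1)) i) (I i) := by
    intro i
    induction i with
    | zero =>
      intro _
      refine (Ensures.couples (Q := I 0 a) (ensures_pure h0) a).mono ?_
      rintro a' s' ⟨rfl, h⟩
      exact h
    | succ i ih => exact fun hi => (ih (by omega)).bind (hs i (by omega))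
  exact this n le_rfl

theorem ensures_loop {x n : ℕ} {p : Prog} {s : State}
    (hn : s.reg x = n) (I : ℕ → State → Prop) (h0 : I 0 (s.tick (1 + bits (s.reg x))))
    (hs : ∀ i < n, ∀ s', I i s' → Ensures (p.run inp (s'.tick 1)) (I (i + 1))) :
    Ensures ((Prog.loop x p).run inp s) (I n) := by
  refine (couples_loop (a := ()) (k := fun _ _ => PMF.pure ()) hn (fun i _ => I i) h0
    fun i hi a s' h => ((hs i hi s' h).couples ()).mono fun _ _ h => h.2).ensures
    fun _ _ h => h

variable {V ℓ : ℕ} (hB : ∀ v : ℤ, |v| ≤ V → bits v ≤ ℓ) {s : State}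
include hB

theorem ensures_const {x : ℕ} {v : ℤ} (hv : |v| ≤ V) :
    Ensures ((Prog.const x v).run inp s) (Writes x v ((1 + ℓ) ^ 2) s) := by
  refine ensures_pure ⟨rfl, rfl, ?_⟩
  have := hB v hv
  simp only [State.set]
  nlinarith

theorem ensures_add {x y z : ℕ} (hy : |s.reg y| ≤ V) (hz : |s.reg z| ≤ V) :
    Ensures ((Prog.add x y z).run inp s) (Writes x (s.reg y + s.reg z) ((1 + ℓ) ^ 2) s) := by
  refine ensures_pure ⟨rfl, rfl, ?_⟩
  have := hB _ hy
  have := hB _ hz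
  simp only [State.set]
  nlinarith

theorem ensures_sub {x y z : ℕ} (hy : |s.reg y| ≤ V) (hz : |s.reg z| ≤ V) :
    Ensures ((Prog.sub x y z).run inp s) (Writes x (s.reg y - s.reg z) ((1 + ℓ) ^ 2) s) := by
  refine ensures_pure ⟨rfl, rfl, ?_⟩
  have := hB _ hy
  have := hB _ hz
  simp only [State.set]
  nlinarith

theorem ensures_mul {x y z : ℕ} (hy : |s.reg y| ≤ V) (hz : |s.reg z| ≤ V) :
    Ensures ((Prog.mul x y z).run inp s) (Writes x (s.reg y * s.reg z) ((1 + ℓ) ^ 2) s) := by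
  refine ensures_pure ⟨rfl, rfl, ?_⟩
  have h1 := hB _ hy
  have h2 := hB _ hz
  simp only [State.set]
  have := Nat.mul_le_mul (Nat.add_le_add_left h1 1) (Nat.add_le_add_left h2 1)
  rw [sq]
  omega

theorem ensures_read {x y : ℕ} (hy : |s.reg y| ≤ V) (hz : |inp (s.reg y).toNat| ≤ V) :
    Ensures ((Prog.read x y).run inp s) (Writes x (inp (s.reg y).toNat) ((1 + ℓ) ^ 2) s) := by
  refine ensures_pure ⟨rfl, rfl, ?_⟩
  have := hB _ hy
  have := hB _ hz
  simp only [State.set]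
  nlinarith

theorem ensures_load {x y : ℕ} (hy : |s.reg y| ≤ V) (hz : |s.mem (s.reg y).toNat| ≤ V) :
    Ensures ((Prog.load x y).run inp s) (Writes x (s.mem (s.reg y).toNat) ((1 + ℓ) ^ 2) s) := by
  refine ensures_pure ⟨rfl, rfl, ?_⟩
  have := hB _ hy
  have := hB _ hz
  simp only [State.set]
  nlinarith

theorem ensures_store {x y : ℕ} (hy : |s.reg x| ≤ V) (hz : |s.reg y| ≤ V) :
    Ensures ((Prog.store x y).run inp s) fun s' => s'.reg = s.reg ∧
      s'.mem = Function.update s.mem (s.reg x).toNat (s.reg y) ∧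
      s'.cost ≤ s.cost + (1 + ℓ) ^ 2 := by
  refine ensures_pure ⟨rfl, rfl, ?_⟩
  have := hB _ hy
  have := hB _ hz
  show s.cost + _ ≤ _
  nlinarith

theorem tick_bits_le {x : ℕ} (hx : |s.reg x| ≤ V) : 1 + bits (s.reg x) ≤ (1 + ℓ) ^ 2 := by
  have := hB _ hx
  nlinarith

end Rules

/-! ### The sampling program -/

/-- Register `8` receives a random number with as many binary digits as register `4` says. -/
def randomProg : Prog :=
  .seq (.const 8 0) (.loop 4 (.seq (.flip 9) (.seq (.add 8 8 8) (.add 8 8 9))))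

/-- One row of the scan: subtract the weight of the row at address `10` from register `8`, and count
the row in register `11` if register `8` is still nonnegative. The last instruction has no effect;
it only fills the second branch. -/
def rowProg : Prog :=
  .seq (.read 12 10) <| .seq (.mul 12 12 12) <| .seq (.add 13 10 5) <| .seq (.read 13 13) <|
  .seq (.mul 13 13 13) <| .seq (.add 12 12 13) <| .seq (.sub 8 8 12) <| .seq (.add 10 10 1) <|
  .seq (.add 9 8 3) (.ifPos 9 (.add 11 11 3) (.const 12 0))

/-- Find the mode of the photon of the source at address `7` from the random number in register `8`,
and count it in the memory. -/
def placeProg : Prog :=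
  .seq (.add 10 0 7) <| .seq (.const 11 0) <| .seq (.loop 1 rowProg) <|
  .seq (.load 12 11) <| .seq (.add 12 12 3) <| .seq (.store 11 12) (.add 6 6 3)

/-- The algorithm: for each source, draw a random number with `2 p` binary digits and compare it
with the cumulative sums of the squared moduli of the given entries. The registers `3` to `7` hold
`1`, `2 p`, the squared number of modes, the number of the current source and the number of its
mode. A random number beyond the total weight of the column is counted in the memory cell after
those of the modes, so that the photon is lost. -/
def samplerProg : Prog :=
  .seq (.const 3 1) <| .seq (.add 4 2 2) <| .seq (.mul 5 1 1) <|
  .loop 0 (.seq (.read 7 6) (.seq randomProg placeProg))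

/-- A random number with `n` binary digits. -/
noncomputable def randBits (n : ℕ) : PMF ℕ :=
  iterPMF 0 (fun _ r => (PMF.uniformOfFintype Bool).bind fun b =>
    PMF.pure (2 * r + if b then 1 else 0)) n

/-- The weight of row `x`, for a column of the input that starts at the address `a`. -/
def rowWeight (inp : ℕ → ℤ) (M : ℕ) (a : ℤ) (x : ℕ) : ℤ :=
  inp (a + x * M).toNat ^ 2 + inp (a + x * M + M * M).toNat ^ 2

/-- The cumulative weight of the rows before row `y`. -/
def cumWeight (inp : ℕ → ℤ) (M : ℕ) (a : ℤ) (y : ℕ) : ℤ :=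
  ∑ x ∈ Finset.range y, rowWeight inp M a x

/-- The number of the row in which the random number `r` falls, among the first `y` rows; it is `y`
if `r` is not below the total weight. -/
def landing (inp : ℕ → ℤ) (M : ℕ) (a : ℤ) (r y : ℕ) : ℕ :=
  ((Finset.range y).filter fun x => cumWeight inp M a (x + 1) ≤ r).card

/-- The abstract sampler: the occupation numbers after the first sources. -/
noncomputable def sampler (inp : ℕ → ℤ) (N M p : ℕ) : ℕ → PMF (ℕ → ℕ) :=
  iterPMF (fun _ => 0) fun j occ => (randBits (2 * p)).bind fun r =>
    PMF.pure (Function.update occ (landing inp M (N + inp j) r M)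
      (occ (landing inp M (N + inp j) r M) + 1))

/-- The state between two sources, after the first `j` sources, with a cost of at most `c`. -/
structure MainInv (N M p j : ℕ) (occ : ℕ → ℕ) (c : ℕ) (s : State) : Prop where
  reg0 : s.reg 0 = N
  reg1 : s.reg 1 = M
  reg3 : s.reg 3 = 1
  reg4 : s.reg 4 = (2 * p : ℕ)
  reg5 : s.reg 5 = M * M
  reg6 : s.reg 6 = j
  mem : s.mem = fun a => (occ a : ℤ)
  occ_le : ∀ a, occ a ≤ j
  cost : s.cost ≤ c

/-! ### Verification of the sampling program -/

theorem couples_flip {inp : ℕ → ℤ} {x c : ℕ} (hc : 1 ≤ c) (s : State) :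
    Couples (PMF.uniformOfFintype Bool) ((Prog.flip x).run inp s)
      fun b s' => Writes x (if b then 1 else 0) c s s' := by
  have h := (couples_refl (PMF.uniformOfFintype Bool)).bind
    (k := PMF.pure) (k' := fun b => PMF.pure (s.set x (if b then 1 else 0) 1))
    (R := fun b s' => Writes x (if b then 1 else 0) c s s') (by
      rintro a _ rfl
      refine (Ensures.couples (μ := PMF.pure (s.set x (if a then 1 else 0) 1))
        (Q := Writes x (if a then 1 else 0) c s)
        (ensures_pure ⟨rfl, rfl, Nat.add_le_add_left hc _⟩) a).mono ?_
      rintro _ s' ⟨rfl, h⟩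
      exact h)
  rwa [PMF.bind_pure] at h

/-- The cumulative weights in terms of a bound `E` for the entries. -/
theorem cumWeight_bounds {inp : ℕ → ℤ} {E : ℕ} (hE : ∀ a, |inp a| ≤ E) (M : ℕ) (a : ℤ) (y : ℕ) :
    0 ≤ cumWeight inp M a y ∧ cumWeight inp M a y ≤ y * (2 * (E : ℤ) ^ 2) := by
  have hsq : ∀ b, inp b ^ 2 ≤ (E : ℤ) ^ 2 := fun b =>
    sq_le_sq' (abs_le.1 (hE b)).1 (abs_le.1 (hE b)).2
  unfold cumWeight rowWeight
  constructor
  · exact Finset.sum_nonneg fun x _ => by positivity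
  · refine (Finset.sum_le_card_nsmul _ _ (2 * (E : ℤ) ^ 2) fun x _ => ?_).trans_eq (by simp)
    have h1 := hsq (a + x * M).toNat
    have h2 := hsq (a + x * M + M * M).toNat
    linarith

section Verification

variable {inp : ℕ → ℤ} {V ℓ : ℕ}

/-- The program for random numbers realizes `randBits`. -/
theorem couples_random (hB : ∀ v : ℤ, |v| ≤ V → bits v ≤ ℓ) {n : ℕ} {s : State}
    (h4 : s.reg 4 = n) (hn : n ≤ V) (h2 : 2 ^ n ≤ V) :
    Couples (randBits n) (randomProg.run inp s) fun r s' => r < 2 ^ n ∧ s'.reg 8 = r ∧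
      (∀ k ≤ 7, s'.reg k = s.reg k) ∧ s'.mem = s.mem ∧
      s'.cost ≤ s.cost + (2 + 4 * n) * (1 + ℓ) ^ 2 := by
  set C := (1 + ℓ) ^ 2 with hC
  have hC1 : 1 ≤ C := Nat.one_le_pow _ _ (by omega)
  rw [← PMF.pure_bind () fun _ => randBits n]
  refine couples_seq ((ensures_const hB (by simp)).couples ()) ?_
  rintro _ s1 ⟨-, r1, m1, c1⟩
  have h4' : s1.reg 4 = n := by rw [r1]; simpa using h4
  refine (couples_loop h4' (fun i (r : ℕ) s' => r < 2 ^ i ∧ s'.reg 8 = r ∧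
    (∀ k ≤ 7, s'.reg k = s.reg k) ∧ s'.mem = s.mem ∧
    s'.cost ≤ s.cost + (2 + 4 * i) * C) ?_ ?_)
  · have ht := tick_bits_le hB (s := s1) (x := 4) (by rw [h4']; simpa using hn)
    refine ⟨by simp, ?_, ?_, m1, ?_⟩
    · show s1.reg 8 = _
      simp [r1]
    · intro k hk
      show s1.reg k = _
      rw [r1, Function.update_of_ne (by omega)]
    · show s1.cost + _ ≤ _
      omega
  · rintro i hi r s2 ⟨hr, e8, ek, em, ec⟩
    have hpow : 2 ^ (i + 1) ≤ V := (Nat.pow_le_pow_right (by norm_num) hi).trans h2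
    rw [pow_succ] at hpow
    refine couples_seq (couples_flip hC1 _) ?_
    rintro b s3 ⟨r3, m3, c3⟩
    have e3 : s3.reg 8 = r := by rw [r3]; simpa [State.tick] using e8
    refine (Ensures.couples (Q := fun s' : State => s'.reg 8 = (2 * r + if b then 1 else 0 : ℕ) ∧
      (∀ k ≤ 7, s'.reg k = s.reg k) ∧ s'.mem = s.mem ∧
      s'.cost ≤ s.cost + (2 + 4 * (i + 1)) * C) ?_ _).mono ?_
    · refine ensures_seq (ensures_add hB (by rw [e3, Nat.abs_cast]; exact_mod_cast (by omega))
        (by rw [e3, Nat.abs_cast]; exact_mod_cast (by omega))) ?_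
      rintro s4 ⟨r4, m4, c4⟩
      have e4 : s4.reg 8 = (2 * r : ℕ) := by
        rw [r4, Function.update_self, e3]; push_cast; ring
      have e4' : s4.reg 9 = if b then 1 else 0 := by simp [r4, r3]
      refine (ensures_add hB (by rw [e4, Nat.abs_cast]; exact_mod_cast (by omega)) ?_).mono ?_
      · rw [e4']
        have : 1 ≤ V := by have := Nat.one_le_two_pow (n := n); omega
        split_ifs <;> simp [this]
      · rintro s5 ⟨r5, m5, c5⟩
        refine ⟨?_, ?_, ?_, ?_⟩
        · rw [r5, Function.update_self, e4, e4']; push_cast; split_ifs <;> simp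
        · intro k hk
          rw [r5, Function.update_of_ne (by omega), r4, Function.update_of_ne (by omega), r3,
            Function.update_of_ne (by omega)]
          exact ek k hk
        · rw [m5, m4, m3]; exact em
        · have : (s2.tick 1).cost = s2.cost + 1 := rfl
          rw [this] at c3
          nlinarith
    · rintro r' s' ⟨rfl, h1, h2', h3, h4⟩
      refine ⟨?_, h1, h2', h3, h4⟩
      rw [pow_succ]
      split_ifs <;> omega

theorem landing_succ (M : ℕ) (a : ℤ) (r y : ℕ) : landing inp M a r (y + 1) =
    landing inp M a r y + if cumWeight inp M a (y + 1) ≤ r then 1 else 0 := by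
  unfold landing
  rw [Finset.range_add_one, Finset.filter_insert]
  split_ifs
  · rw [Finset.card_insert_of_notMem (by simp)]
  · simp

theorem landing_le (M : ℕ) (a : ℤ) (r y : ℕ) : landing inp M a r y ≤ y :=
  (Finset.card_filter_le _ _).trans_eq (Finset.card_range y)

/-- A bound for the absolute values of all numbers that occur in the computation, if the cells of
the input are at most `E`. -/
def valueBound (N M p E : ℕ) : ℕ :=
  4 ^ p + 2 * M * E ^ 2 + 2 * E ^ 2 + E + N + 2 * (M * M) + M + 2 * p + 2

/-- The state in the scan of the rows, after the first `y` rows. -/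
structure RowInv (inp : ℕ → ℤ) (M : ℕ) (a : ℤ) (r : ℕ) (s₀ : State) (c y : ℕ) (s : State) :
    Prop where
  reg8 : s.reg 8 = r - cumWeight inp M a y
  reg10 : s.reg 10 = a + y * M
  reg11 : s.reg 11 = landing inp M a r y
  reg : ∀ k ≤ 7, s.reg k = s₀.reg k
  mem : s.mem = s₀.mem
  cost : s.cost ≤ c

set_option maxHeartbeats 1000000 in
/-- One row of the scan keeps the invariant; every value that occurs is a cumulative weight, an
address or a count, so it is within `valueBound`. -/
theorem ensures_row (hB : ∀ v : ℤ, |v| ≤ V → bits v ≤ ℓ) {E N M p : ℕ}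
    (hE : ∀ a, |inp a| ≤ E) (hV : valueBound N M p E ≤ V) {a : ℤ} (ha : |a| ≤ N + E) {r : ℕ}
    (hr : r < 4 ^ p) {s₀ : State} (h1 : s₀.reg 1 = M) (h3 : s₀.reg 3 = 1)
    (h5 : s₀.reg 5 = M * M) {y : ℕ} (hy : y < M) {c : ℕ} {s : State}
    (hI : RowInv inp M a r s₀ c y s) :
    Ensures (rowProg.run inp s) (RowInv inp M a r s₀ (c + 11 * (1 + ℓ) ^ 2) (y + 1)) := by
  set C := (1 + ℓ) ^ 2 with hC
  obtain ⟨e8, e10, e11, ek, em, ec⟩ := hI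
  have f1 : s.reg 1 = M := (ek 1 (by norm_num)).trans h1
  have f3 : s.reg 3 = 1 := (ek 3 (by norm_num)).trans h3
  have f5 : s.reg 5 = M * M := (ek 5 (by norm_num)).trans h5
  -- the bounds for all values that occur
  have hVz : ((4 : ℤ) ^ p + 2 * M * E ^ 2 + 2 * E ^ 2 + E + N + 2 * (M * M) + M + 2 * p + 2) ≤
      V := by
    have : ((valueBound N M p E : ℕ) : ℤ) ≤ V := by exact_mod_cast hV
    unfold valueBound at this
    push_cast at this
    exact this
  have hrz : (r : ℤ) < 4 ^ p := by exact_mod_cast hr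
  have hyz : (y : ℤ) * M ≤ M * M := by
    exact_mod_cast Nat.mul_le_mul_right M hy.le
  have hyM : (y : ℤ) + 1 ≤ M := by exact_mod_cast hy
  have hME : (0 : ℤ) ≤ M * E ^ 2 := by positivity
  have hMM : (0 : ℤ) ≤ (M : ℤ) * M := by positivity
  have hEE : (0 : ℤ) ≤ (E : ℤ) ^ 2 := by positivity
  have hyM0 : (0 : ℤ) ≤ (y : ℤ) * M := by positivity
  have hp0 : (0 : ℤ) < 4 ^ p := by positivity
  have hE0 : (0 : ℤ) ≤ E := by positivity
  have hN0 : (0 : ℤ) ≤ N := by positivity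
  have hM0 : (0 : ℤ) ≤ M := by positivity
  have hpp0 : (0 : ℤ) ≤ p := by positivity
  have hr0 : (0 : ℤ) ≤ r := by positivity
  have hinp : ∀ b, |inp b| ≤ V := fun b => (hE b).trans (by linarith)
  have hsq : ∀ b, inp b ^ 2 ≤ (E : ℤ) ^ 2 := fun b =>
    sq_le_sq' (abs_le.1 (hE b)).1 (abs_le.1 (hE b)).2
  have hsq0 : ∀ b, 0 ≤ inp b ^ 2 := fun b => sq_nonneg _
  obtain ⟨hS0, hS1⟩ := cumWeight_bounds hE M a y
  obtain ⟨hT0, hT1⟩ := cumWeight_bounds hE M a (y + 1)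
  have hS2 : cumWeight inp M a y ≤ 2 * M * E ^ 2 := hS1.trans (by
    have : (y : ℤ) ≤ M := by linarith
    nlinarith)
  have hT2 : cumWeight inp M a (y + 1) ≤ 2 * M * E ^ 2 := hT1.trans (by
    push_cast
    nlinarith)
  have hTS : cumWeight inp M a (y + 1) = cumWeight inp M a y + rowWeight inp M a y :=
    Finset.sum_range_succ _ _
  obtain ⟨ha1, ha2⟩ := abs_le.1 ha
  unfold rowProg
  refine ensures_seq (ensures_read hB (by rw [e10, abs_le]; constructor <;> linarith) (hinp _)) ?_
  rintro s1 ⟨r1, m1, c1⟩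
  rw [e10] at r1
  refine ensures_seq (ensures_mul hB (by simpa [r1] using hinp _) (by simpa [r1] using hinp _)) ?_
  rintro s2 ⟨r2, m2, c2⟩
  have g2 : s2.reg 12 = inp (a + y * M).toNat ^ 2 := by simp [r2, r1, sq]
  have g2' : s2.reg 10 = a + y * M := by simp [r2, r1, e10]
  have g2'' : s2.reg 5 = M * M := by simp [r2, r1, f5]
  refine ensures_seq (ensures_add hB (by rw [g2', abs_le]; constructor <;> linarith)
    (by rw [g2'', abs_le]; constructor <;> linarith)) ?_
  rintro s3 ⟨r3, m3, c3⟩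
  have g3 : s3.reg 13 = a + y * M + M * M := by rw [r3, Function.update_self, g2', g2'']
  refine ensures_seq (ensures_read hB (by rw [g3, abs_le]; constructor <;> linarith) (hinp _)) ?_
  rintro s4 ⟨r4, m4, c4⟩
  rw [g3] at r4
  refine ensures_seq (ensures_mul hB (by simpa [r4] using hinp _) (by simpa [r4] using hinp _)) ?_
  rintro s5 ⟨r5, m5, c5⟩
  have g5 : s5.reg 13 = inp (a + y * M + M * M).toNat ^ 2 := by simp [r5, r4, sq]
  have g5' : s5.reg 12 = inp (a + y * M).toNat ^ 2 := by
    rw [← g2]; simp [r5, r4, r3]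
  have hq1 := hsq (a + y * M).toNat
  have hq2 := hsq (a + y * M + M * M).toNat
  have hq3 := hsq0 (a + y * M).toNat
  have hq4 := hsq0 (a + y * M + M * M).toNat
  refine ensures_seq (ensures_add hB (by rw [g5', abs_le]; constructor <;> linarith)
    (by rw [g5, abs_le]; constructor <;> linarith)) ?_
  rintro s6 ⟨r6, m6, c6⟩
  have g6 : s6.reg 12 = rowWeight inp M a y := by
    rw [r6, Function.update_self, g5, g5']; rfl
  have g6' : s6.reg 8 = r - cumWeight inp M a y := by
    rw [← e8]; simp [r6, r5, r4, r3, r2, r1]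
  have hw : rowWeight inp M a y = inp (a + y * M).toNat ^ 2 +
    inp (a + y * M + M * M).toNat ^ 2 := rfl
  refine ensures_seq (ensures_sub hB (by rw [g6', abs_le]; constructor <;> linarith)
    (by rw [g6, abs_le]; constructor <;> linarith)) ?_
  rintro s7 ⟨r7, m7, c7⟩
  have g7 : s7.reg 8 = r - cumWeight inp M a (y + 1) := by
    rw [r7, Function.update_self, g6, g6', hTS]; ring
  have g7' : s7.reg 10 = a + y * M := by rw [← g2']; simp [r7, r6, r5, r4, r3]
  have g7'' : s7.reg 1 = M := by rw [← f1]; simp [r7, r6, r5, r4, r3, r2, r1]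
  refine ensures_seq (ensures_add hB (by rw [g7', abs_le]; constructor <;> linarith)
    (by rw [g7'', abs_le]; constructor <;> linarith)) ?_
  rintro s8 ⟨r8, m8, c8⟩
  have g8 : s8.reg 8 = r - cumWeight inp M a (y + 1) := by rw [← g7]; simp [r8]
  have g8' : s8.reg 3 = 1 := by rw [← f3]; simp [r8, r7, r6, r5, r4, r3, r2, r1]
  refine ensures_seq (ensures_add hB (by rw [g8, abs_le]; constructor <;> linarith)
    (by rw [g8', abs_le]; constructor <;> linarith)) ?_
  rintro s9 ⟨r9, m9, c9⟩
  have g9 : s9.reg 9 = r - cumWeight inp M a (y + 1) + 1 := by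
    rw [r9, Function.update_self, g8, g8']
  have g98 : s9.reg 8 = r - cumWeight inp M a (y + 1) := by rw [← g8]; simp [r9]
  have g910 : s9.reg 10 = a + (y + 1 : ℕ) * M := by
    have : s9.reg 10 = s8.reg 10 := by simp [r9]
    rw [this, r8, Function.update_self, g7', g7'']; push_cast; ring
  have g911 : s9.reg 11 = landing inp M a r y := by
    rw [← e11]; simp [r9, r8, r7, r6, r5, r4, r3, r2, r1]
  have g9k : ∀ k ≤ 7, s9.reg k = s₀.reg k := by
    intro k hk
    rw [← ek k hk, r9, Function.update_of_ne (by omega), r8, Function.update_of_ne (by omega), r7,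
      Function.update_of_ne (by omega), r6, Function.update_of_ne (by omega), r5,
      Function.update_of_ne (by omega), r4, Function.update_of_ne (by omega), r3,
      Function.update_of_ne (by omega), r2, Function.update_of_ne (by omega), r1,
      Function.update_of_ne (by omega)]
  have g93 : s9.reg 3 = 1 := (g9k 3 (by norm_num)).trans h3
  have g9m : s9.mem = s₀.mem := by rw [m9, m8, m7, m6, m5, m4, m3, m2, m1, em]
  have ht := tick_bits_le hB (s := s9) (x := 9) (by rw [g9, abs_le]; constructor <;> linarith)
  have hland : (landing inp M a r y : ℤ) ≤ y := by exact_mod_cast landing_le M a r y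
  have hland0 : (0 : ℤ) ≤ (landing inp M a r y : ℤ) := by positivity
  rw [Prog.run]
  split_ifs with hpos
  · rw [g9] at hpos
    have hle : cumWeight inp M a (y + 1) ≤ r := by linarith
    refine (ensures_add hB (s := s9.tick (1 + bits (s9.reg 9))) (y := 11) (z := 3) ?_ ?_).mono ?_
    · show |s9.reg 11| ≤ _
      rw [g911, abs_le]; constructor <;> linarith
    · show |s9.reg 3| ≤ _
      rw [g93, abs_le]; constructor <;> linarith
    · rintro s10 ⟨r10, m10, c10⟩
      change s10.reg = Function.update s9.reg 11 (s9.reg 11 + s9.reg 3) at r10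
      change s10.mem = s9.mem at m10
      change s10.cost ≤ s9.cost + (1 + bits (s9.reg 9)) + C at c10
      refine ⟨?_, ?_, ?_, ?_, m10.trans g9m, ?_⟩
      · rw [← g98]; simp [r10]
      · rw [← g910]; simp [r10]
      · rw [r10, Function.update_self, g911, g93, landing_succ, if_pos hle]; push_cast; rfl
      · intro k hk
        rw [r10, Function.update_of_ne (by omega), g9k k hk]
      · omega
  · rw [g9] at hpos
    have hle : ¬ cumWeight inp M a (y + 1) ≤ r := by
      intro h
      exact hpos (by linarith)
    refine (ensures_const hB (s := s9.tick (1 + bits (s9.reg 9))) (x := 12) (v := 0)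
      (by simp)).mono ?_
    rintro s10 ⟨r10, m10, c10⟩
    change s10.reg = Function.update s9.reg 12 0 at r10
    change s10.mem = s9.mem at m10
    change s10.cost ≤ s9.cost + (1 + bits (s9.reg 9)) + C at c10
    refine ⟨?_, ?_, ?_, ?_, m10.trans g9m, ?_⟩
    · rw [← g98]; simp [r10]
    · rw [← g910]; simp [r10]
    · rw [landing_succ, if_neg hle, add_zero, ← g911]; simp [r10]
    · intro k hk
      rw [r10, Function.update_of_ne (by omega), g9k k hk]
    · omega

theorem le_of_valueBound_le {N M p E : ℕ} (hV : valueBound N M p E ≤ V) :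
    E + N + M + 2 * p + 2 ≤ V ∧ 4 ^ p ≤ V := by
  unfold valueBound at hV
  have h1 := Nat.zero_le (2 * M * E ^ 2)
  have h2 := Nat.zero_le (4 ^ p)
  have h3 := Nat.zero_le (E ^ 2)
  have h4 := Nat.zero_le (M * M)
  generalize 2 * M * E ^ 2 = a at *
  generalize 4 ^ p = b at *
  generalize E ^ 2 = c at *
  generalize M * M = e at *
  omega

/-- After the scan of all rows, register `11` holds the place where the random number lands. -/
theorem ensures_scan (hB : ∀ v : ℤ, |v| ≤ V → bits v ≤ ℓ) {E N M p : ℕ}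
    (hE : ∀ a, |inp a| ≤ E) (hV : valueBound N M p E ≤ V) {a : ℤ} (ha : |a| ≤ N + E) {r : ℕ}
    (hr : r < 4 ^ p) {s : State} (h1 : s.reg 1 = M) (h3 : s.reg 3 = 1)
    (h5 : s.reg 5 = M * M) (h8 : s.reg 8 = r) (h10 : s.reg 10 = a) (h11 : s.reg 11 = 0) :
    Ensures ((Prog.loop 1 rowProg).run inp s)
      (RowInv inp M a r s (s.cost + (1 + 12 * M) * (1 + ℓ) ^ 2) M) := by
  set C := (1 + ℓ) ^ 2 with hC
  have hC1 : 1 ≤ C := Nat.one_le_pow _ _ (by omega)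
  have hMV : M ≤ V := by have := (le_of_valueBound_le hV).1; omega
  refine ensures_loop h1 (fun y s' => RowInv inp M a r s (s.cost + (1 + 12 * y) * C) y s') ?_ ?_
  · refine ⟨?_, ?_, ?_, fun k _ => rfl, rfl, ?_⟩
    · show s.reg 8 = _
      simp [h8, cumWeight]
    · show s.reg 10 = _
      simp [h10]
    · show s.reg 11 = _
      simp [h11, landing]
    · show s.cost + _ ≤ _
      have := tick_bits_le hB (s := s) (x := 1) (by rw [h1, Nat.abs_cast]; exact_mod_cast hMV)
      omega
  · rintro y hy s' ⟨e8, e10, e11, ek, em, ec⟩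
    have hI : RowInv inp M a r s (s.cost + (1 + 12 * y) * C + 1) y (s'.tick 1) :=
      ⟨e8, e10, e11, ek, em, Nat.add_le_add_right ec 1⟩
    refine (ensures_row hB hE hV ha hr h1 h3 h5 hy hI).mono ?_
    rintro s'' ⟨f8, f10, f11, fk, fm, fc⟩
    exact ⟨f8, f10, f11, fk, fm, fc.trans (by rw [← hC]; nlinarith)⟩

/-- The photon of the source `j` is counted at the place where the random number lands. -/
theorem ensures_place (hB : ∀ v : ℤ, |v| ≤ V → bits v ≤ ℓ) {E N M p : ℕ}
    (hE : ∀ a, |inp a| ≤ E) (hV : valueBound N M p E ≤ V) {j r : ℕ} (hj : j < N)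
    (hr : r < 4 ^ p) {s : State} {occ : ℕ → ℕ} {c : ℕ} (hI : MainInv N M p j occ c s)
    (h7 : s.reg 7 = inp j) (h8 : s.reg 8 = r) :
    Ensures (placeProg.run inp s) (MainInv N M p (j + 1)
      (Function.update occ (landing inp M (N + inp j) r M)
        (occ (landing inp M (N + inp j) r M) + 1)) (c + (7 + 12 * M) * (1 + ℓ) ^ 2)) := by
  set C := (1 + ℓ) ^ 2 with hC
  set a : ℤ := N + inp j with ha
  set t := landing inp M a r M with ht
  obtain ⟨h0, h1, h3, h4, h5, h6, hm, hocc, hc⟩ := hI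
  have hVz : (E + N + M + 2 : ℤ) ≤ V := by
    have : E + N + M + 2 ≤ V := by have := (le_of_valueBound_le hV).1; omega
    exact_mod_cast this
  have hE0 : (0 : ℤ) ≤ E := by positivity
  have hN0 : (0 : ℤ) ≤ N := by positivity
  have hM0 : (0 : ℤ) ≤ M := by positivity
  have htM : (t : ℤ) ≤ M := by exact_mod_cast landing_le M a r M
  have ht0 : (0 : ℤ) ≤ t := by positivity
  obtain ⟨hi1, hi2⟩ := abs_le.1 (hE j)
  have haE : |a| ≤ N + E := by rw [ha, abs_le]; constructor <;> linarith
  unfold placeProg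
  refine ensures_seq (ensures_add hB (by rw [h0, abs_le]; constructor <;> linarith)
    (by rw [h7, abs_le]; constructor <;> linarith)) ?_
  rintro s1 ⟨r1, m1, c1⟩
  rw [h0, h7] at r1
  refine ensures_seq (ensures_const hB (by simp)) ?_
  rintro s2 ⟨r2, m2, c2⟩
  have g2 : ∀ k ≤ 9, s2.reg k = s.reg k := fun k hk => by
    rw [r2, Function.update_of_ne (by omega), r1, Function.update_of_ne (by omega)]
  refine ensures_seq (ensures_scan hB hE hV haE hr ((g2 1 (by norm_num)).trans h1)
    ((g2 3 (by norm_num)).trans h3) ((g2 5 (by norm_num)).trans h5) ((g2 8 (by norm_num)).trans h8)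
    (by rw [r2, Function.update_of_ne (by norm_num), r1, Function.update_self])
    (by rw [r2, Function.update_self])) ?_
  rintro s3 ⟨-, -, e11, ek, em, ec⟩
  rw [← ht] at e11
  have g3m : s3.mem = fun a => (occ a : ℤ) := by rw [em, m2, m1, hm]
  have g3 : ∀ k ≤ 7, s3.reg k = s.reg k := fun k hk => (ek k hk).trans (g2 k (by omega))
  have hocct : (occ t : ℤ) ≤ j := by exact_mod_cast hocc t
  have hocct0 : (0 : ℤ) ≤ occ t := by positivity
  have hjN : (j : ℤ) + 1 ≤ N := by exact_mod_cast hj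
  have hload : s3.mem (s3.reg 11).toNat = occ t := by rw [e11, g3m]; simp
  refine ensures_seq (ensures_load hB (by rw [e11, abs_le]; constructor <;> linarith)
    (by rw [hload, abs_le]; constructor <;> linarith)) ?_
  rintro s4 ⟨r4, m4, c4⟩
  rw [hload] at r4
  have g4 : ∀ k ≤ 11, s4.reg k = s3.reg k := fun k hk => by
    rw [r4, Function.update_of_ne (by omega)]
  have g43 : s4.reg 3 = 1 := (g4 3 (by norm_num)).trans ((g3 3 (by norm_num)).trans h3)
  have g412 : s4.reg 12 = occ t := by rw [r4, Function.update_self]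
  refine ensures_seq (ensures_add hB (by rw [g412, abs_le]; constructor <;> linarith)
    (by rw [g43, abs_le]; constructor <;> linarith)) ?_
  rintro s5 ⟨r5, m5, c5⟩
  rw [g412, g43] at r5
  have g5 : ∀ k ≤ 11, s5.reg k = s3.reg k := fun k hk => by
    rw [r5, Function.update_of_ne (by omega), g4 k hk]
  have g512 : s5.reg 12 = occ t + 1 := by rw [r5, Function.update_self]
  have g511 : s5.reg 11 = t := (g5 11 le_rfl).trans e11
  refine ensures_seq (ensures_store hB (by rw [g511, abs_le]; constructor <;> linarith)
    (by rw [g512, abs_le]; constructor <;> linarith)) ?_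
  rintro s6 ⟨r6, m6, c6⟩
  rw [g511, g512] at m6
  have g6 : ∀ k ≤ 7, s6.reg k = s.reg k := fun k hk => by
    rw [r6, g5 k (by omega), g3 k hk]
  have g66 : s6.reg 6 = j := (g6 6 (by norm_num)).trans h6
  have g63 : s6.reg 3 = 1 := (g6 3 (by norm_num)).trans h3
  refine (ensures_add hB (by rw [g66, abs_le]; constructor <;> linarith)
    (by rw [g63, abs_le]; constructor <;> linarith)).mono ?_
  rintro s7 ⟨r7, m7, c7⟩
  have g7 : ∀ k ≤ 5, s7.reg k = s.reg k := fun k hk => by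
    rw [r7, Function.update_of_ne (by omega), g6 k (by omega)]
  refine ⟨(g7 0 (by norm_num)).trans h0, (g7 1 (by norm_num)).trans h1,
    (g7 3 (by norm_num)).trans h3, (g7 4 (by norm_num)).trans h4, (g7 5 (by norm_num)).trans h5,
    ?_, ?_, ?_, ?_⟩
  · rw [r7, Function.update_self, g66, g63]; push_cast; rfl
  · rw [m7, m6, m5, m4, g3m]
    funext b
    by_cases hb : b = t
    · subst hb; simp
    · simp [hb]
  · intro b
    by_cases hb : b = t
    · rw [hb, Function.update_self]
      exact Nat.succ_le_succ (hocc _)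
    · rw [Function.update_of_ne hb]
      exact (hocc b).trans (Nat.le_succ j)
  · rw [← hC] at ec c1 c2 c4 c5 c6 c7
    have e1 : (1 + 12 * M) * C = C + 12 * (M * C) := by ring
    have e2 : (7 + 12 * M) * C = 7 * C + 12 * (M * C) := by ring
    rw [e1] at ec
    rw [e2]
    generalize M * C = q at *
    omega

/-- The program realizes the abstract sampler, with a bound for its cost. -/
theorem couples_samplerProg (hB : ∀ v : ℤ, |v| ≤ V → bits v ≤ ℓ) {E N M p : ℕ}
    (hE : ∀ a, |inp a| ≤ E) (hV : valueBound N M p E ≤ V) {s : State}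
    (h0 : s.reg 0 = N) (h1 : s.reg 1 = M) (h2 : s.reg 2 = p) (h6 : s.reg 6 = 0)
    (hm : s.mem = fun _ => 0) (hc : s.cost = 0) :
    Couples (sampler inp N M p N) (samplerProg.run inp s) fun occ s' =>
      s'.mem = (fun a => (occ a : ℤ)) ∧
        s'.cost ≤ (4 + N * (11 + 8 * p + 12 * M)) * (1 + ℓ) ^ 2 := by
  set C := (1 + ℓ) ^ 2 with hC
  have hC1 : 1 ≤ C := Nat.one_le_pow _ _ (by omega)
  obtain ⟨hV1, hV2⟩ := le_of_valueBound_le hV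
  have h4p : (2 : ℕ) ^ (2 * p) = 4 ^ p := by rw [pow_mul]; norm_num
  rw [← PMF.pure_bind () fun _ => sampler inp N M p N]
  refine couples_seq ((ensures_const hB
    (by rw [abs_one]; exact_mod_cast (by omega : 1 ≤ V))).couples ()) ?_
  rintro _ s1 ⟨-, r1, m1, c1⟩
  have g1 : ∀ k ≤ 2, s1.reg k = s.reg k := fun k hk => by
    rw [r1, Function.update_of_ne (by omega)]
  have g12 : s1.reg 2 = p := (g1 2 le_rfl).trans h2
  rw [← PMF.pure_bind () fun _ => sampler inp N M p N]
  refine couples_seq ((ensures_add hB (by rw [g12, Nat.abs_cast, Nat.cast_le]; omega)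
    (by rw [g12, Nat.abs_cast, Nat.cast_le]; omega)).couples ()) ?_
  rintro _ s2 ⟨-, r2, m2, c2⟩
  rw [g12] at r2
  have g2 : ∀ k ≤ 2, s2.reg k = s.reg k := fun k hk => by
    rw [r2, Function.update_of_ne (by omega), g1 k hk]
  have g21 : s2.reg 1 = M := (g2 1 (by norm_num)).trans h1
  rw [← PMF.pure_bind () fun _ => sampler inp N M p N]
  refine couples_seq ((ensures_mul hB (by rw [g21, Nat.abs_cast, Nat.cast_le]; omega)
    (by rw [g21, Nat.abs_cast, Nat.cast_le]; omega)).couples ()) ?_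
  rintro _ s3 ⟨-, r3, m3, c3⟩
  rw [g21] at r3
  have g3 : ∀ k ≤ 2, s3.reg k = s.reg k := fun k hk => by
    rw [r3, Function.update_of_ne (by omega), g2 k hk]
  have g30 : s3.reg 0 = N := (g3 0 (by norm_num)).trans h0
  refine (couples_loop g30
    (fun j occ s' => MainInv N M p j occ ((4 + j * (11 + 8 * p + 12 * M)) * C) s') ?_ ?_).mono ?_
  · have ht := tick_bits_le hB (s := s3) (x := 0)
      (by rw [g30, Nat.abs_cast, Nat.cast_le]; omega)
    refine ⟨g30, (g3 1 (by norm_num)).trans h1, ?_, ?_, ?_, ?_, ?_, fun _ => le_rfl, ?_⟩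
    · show s3.reg 3 = _
      simp [r3, r2, r1]
    · show s3.reg 4 = _
      simp only [r3, r2]
      rw [Function.update_of_ne (by norm_num), Function.update_self]
      push_cast
      ring
    · show s3.reg 5 = _
      rw [r3, Function.update_self]
    · show s3.reg 6 = _
      simp [r3, r2, r1, h6]
    · show s3.mem = _
      rw [m3, m2, m1, hm]
      rfl
    · show s3.cost + _ ≤ _
      omega
  · rintro j hj occ s4 ⟨e0, e1, e3, e4, e5, e6, em, eocc, ec⟩
    rw [← PMF.pure_bind () fun _ => (randBits (2 * p)).bind _]
    have e6' : (s4.tick 1).reg 6 = j := e6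
    refine couples_seq ((ensures_read hB (by rw [e6', Nat.abs_cast, Nat.cast_le]; omega)
      ((hE _).trans (by rw [Nat.cast_le]; omega))).couples ()) ?_
    rintro _ s5 ⟨-, r5, m5, c5⟩
    rw [e6', Int.toNat_natCast] at r5
    change s5.mem = s4.mem at m5
    change s5.cost ≤ s4.cost + 1 + C at c5
    have g5 : ∀ k ≤ 6, s5.reg k = s4.reg k := fun k hk => by
      rw [r5, Function.update_of_ne (by omega)]; rfl
    refine couples_seq (couples_random hB ((g5 4 (by norm_num)).trans e4) (by omega)
      (by rw [h4p]; exact hV2)) ?_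
    rintro r s6 ⟨hr, e8, ek, em6, ec6⟩
    rw [h4p] at hr
    have g6 : ∀ k ≤ 6, s6.reg k = s4.reg k := fun k hk => (ek k (by omega)).trans (g5 k hk)
    have hI : MainInv N M p j occ
        ((4 + j * (11 + 8 * p + 12 * M)) * C + 1 + C + (2 + 4 * (2 * p)) * C) s6 :=
      ⟨(g6 0 (by norm_num)).trans e0, (g6 1 (by norm_num)).trans e1,
        (g6 3 (by norm_num)).trans e3, (g6 4 (by norm_num)).trans e4,
        (g6 5 (by norm_num)).trans e5, (g6 6 (by norm_num)).trans e6,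
        by rw [em6, m5, em], eocc, by rw [← hC] at ec6; omega⟩
    have h7 : s6.reg 7 = inp j := by
      rw [ek 7 le_rfl, r5, Function.update_self]
    refine ((ensures_place hB hE hV hj hr hI h7 e8).couples _).mono ?_
    rintro _ s7 ⟨rfl, i0, i1, i3, i4, i5, i6, im, iocc, ic⟩
    refine ⟨i0, i1, i3, i4, i5, i6, im, iocc, ic.trans (le_of_le_of_eq ?_
      (show (4 + j * (11 + 8 * p + 12 * M)) * C + (11 + 8 * p + 12 * M) * C = _ by ring))⟩
    rw [← hC]
    have e1 : (2 + 4 * (2 * p)) * C = 2 * C + 8 * (p * C) := by ring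
    have e2 : (7 + 12 * M) * C = 7 * C + 12 * (M * C) := by ring
    have e3 : (11 + 8 * p + 12 * M) * C = 11 * C + 8 * (p * C) + 12 * (M * C) := by ring
    rw [e1, e2, e3]
    generalize (4 + j * (11 + 8 * p + 12 * M)) * C = u
    generalize p * C = v
    generalize M * C = w
    omega
  · rintro occ s' h
    exact ⟨h.mem, h.cost⟩

end Verification

/-! ### The law of the abstract sampler -/

theorem tsum_pure_mul {α : Type} (a : α) (F : α → ℝ≥0∞) :
    ∑' b, PMF.pure a b * F b = F a := by
  rw [tsum_eq_single a (by intro b hb; simp [hb])]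
  simp

theorem tsum_bind_mul {α β : Type} (μ : PMF α) (k : α → PMF β) (F : β → ℝ≥0∞) :
    ∑' b, (μ.bind k) b * F b = ∑' a, μ a * ∑' b, k a b * F b := by
  simp only [PMF.bind_apply, ← ENNReal.tsum_mul_right, ← ENNReal.tsum_mul_left]
  rw [ENNReal.tsum_comm]
  simp only [mul_assoc]

theorem sum_range_two_mul (F : ℕ → ℝ≥0∞) (n : ℕ) :
    ∑ r ∈ Finset.range (2 * n), F r = ∑ r ∈ Finset.range n, (F (2 * r) + F (2 * r + 1)) := by
  induction n with
  | zero => simp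
  | succ n ih =>
    rw [show 2 * (n + 1) = 2 * n + 1 + 1 by ring, Finset.sum_range_succ, Finset.sum_range_succ,
      Finset.sum_range_succ, ih, add_assoc]

/-- The random number is uniformly distributed. -/
theorem tsum_randBits_mul (n : ℕ) (F : ℕ → ℝ≥0∞) :
    ∑' r, randBits n r * F r = (2 ^ n)⁻¹ * ∑ r ∈ Finset.range (2 ^ n), F r := by
  unfold randBits
  induction n generalizing F with
  | zero =>
    simp only [iterPMF]
    rw [tsum_pure_mul]
    simp
  | succ n ih =>
    simp only [iterPMF]
    rw [tsum_bind_mul, ih, pow_succ' 2 n, pow_succ' 2 n, sum_range_two_mul]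
    have h : ∀ r : ℕ, ∑' b, ((PMF.uniformOfFintype Bool).bind fun b =>
        PMF.pure (2 * r + if b = true then 1 else 0)) b * F b =
        2⁻¹ * (F (2 * r) + F (2 * r + 1)) := by
      intro r
      rw [tsum_bind_mul, tsum_bool]
      simp only [tsum_pure_mul, PMF.uniformOfFintype_apply]
      simp [mul_add]
    simp only [h]
    rw [← Finset.mul_sum, ← mul_assoc, mul_comm (2 : ℝ≥0∞) (2 ^ n),
      ENNReal.mul_inv (by simp) (by simp)]

/-- The occupation numbers of the places `g j`. -/
def countPlaces {n K : ℕ} (g : Fin n → Fin K) : ℕ → ℕ := fun a =>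
  (Finset.univ.filter fun j => (g j : ℕ) = a).card

theorem countPlaces_snoc {n K : ℕ} (g : Fin n → Fin K) (t : Fin K) :
    countPlaces (Fin.snoc (α := fun _ => Fin K) g t : Fin (n + 1) → Fin K) =
      Function.update (countPlaces g) t (countPlaces g t + 1) := by
  funext a
  unfold countPlaces
  rw [Finset.card_filter, Fin.sum_univ_castSucc]
  simp only [Fin.snoc_castSucc, Fin.snoc_last]
  rw [← Finset.card_filter]
  by_cases ha : a = t
  · subst ha; simp
  · rw [Function.update_of_ne ha, if_neg (Ne.symm ha), add_zero]

theorem sum_snoc {M X : Type} [AddCommMonoid M] [Fintype X] (n : ℕ) (F : (Fin (n + 1) → X) → M) :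
    ∑ g, F g = ∑ g : Fin n → X, ∑ t, F (Fin.snoc (α := fun _ => X) g t) := by
  rw [← Equiv.sum_comp (Fin.snocEquiv fun _ => X), Fintype.sum_prod_type, Finset.sum_comm]
  rfl

/-- Independent placements: the law of the occupation numbers as a sum over all assignments. -/
theorem tsum_iterPMF_mul {K : ℕ} (q : ℕ → PMF ℕ) (hq : ∀ j t, K ≤ t → q j t = 0) (n : ℕ)
    (F : (ℕ → ℕ) → ℝ≥0∞) :
    ∑' occ, iterPMF (fun _ => 0) (fun j occ => (q j).bind fun t =>
      PMF.pure (Function.update occ t (occ t + 1))) n occ * F occ =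
    ∑ g : Fin n → Fin K, (∏ j : Fin n, q j (g j)) * F (countPlaces g) := by
  induction n generalizing F with
  | zero =>
    simp only [iterPMF]
    rw [tsum_pure_mul]
    simp
    rfl
  | succ n ih =>
    simp only [iterPMF]
    rw [tsum_bind_mul, ih, sum_snoc]
    refine Finset.sum_congr rfl fun g _ => ?_
    rw [tsum_bind_mul, tsum_eq_sum (s := Finset.range K) (fun t ht => by
      rw [hq n t (by simpa using ht), zero_mul]), Finset.sum_range, Finset.mul_sum]
    refine Finset.sum_congr rfl fun t _ => ?_
    rw [tsum_pure_mul, countPlaces_snoc, Fin.prod_univ_castSucc]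
    simp only [Fin.snoc_castSucc, Fin.snoc_last, Fin.val_castSucc, Fin.val_last]
    rw [mul_assoc]

/-- The difference of two product distributions is at most the sum of the differences of the
factors. -/
theorem sum_abs_prod_sub_le {X : Type} [Fintype X] (n : ℕ) (a b : Fin n → X → ℝ)
    (ha : ∀ j x, 0 ≤ a j x) (hb : ∀ j x, 0 ≤ b j x) (ha1 : ∀ j, ∑ x, a j x ≤ 1)
    (hb1 : ∀ j, ∑ x, b j x ≤ 1) :
    ∑ g : Fin n → X, |∏ j, a j (g j) - ∏ j, b j (g j)| ≤ ∑ j, ∑ x, |a j x - b j x| := by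
  induction n with
  | zero => simp
  | succ n ih =>
    rw [sum_snoc, Fin.sum_univ_castSucc]
    have ih' := ih (fun j => a j.castSucc) (fun j => b j.castSucc) (fun j => ha _) (fun j => hb _)
      (fun j => ha1 _) (fun j => hb1 _)
    have hB : ∑ g : Fin n → X, ∏ j : Fin n, b j.castSucc (g j) ≤ 1 := by
      classical
      rw [← Fintype.piFinset_univ, ← Finset.prod_univ_sum]
      exact Finset.prod_le_one (fun j _ => Finset.sum_nonneg fun x _ => hb _ x) fun j _ => hb1 _
    calc _ ≤ ∑ g : Fin n → X, ∑ t, (|∏ j : Fin n, a j.castSucc (g j) -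
          ∏ j : Fin n, b j.castSucc (g j)| * a (Fin.last n) t +
          (∏ j : Fin n, b j.castSucc (g j)) * |a (Fin.last n) t - b (Fin.last n) t|) := by
          refine Finset.sum_le_sum fun g _ => Finset.sum_le_sum fun t _ => ?_
          rw [Fin.prod_univ_castSucc, Fin.prod_univ_castSucc]
          simp only [Fin.snoc_castSucc, Fin.snoc_last]
          have h1 : 0 ≤ ∏ j : Fin n, b j.castSucc (g j) := Finset.prod_nonneg fun j _ => hb _ _
          have h2 := ha (Fin.last n) t
          set A := ∏ j : Fin n, a j.castSucc (g j)
          set B := ∏ j : Fin n, b j.castSucc (g j)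
          have e1 : |A - B| * a (Fin.last n) t = |(A - B) * a (Fin.last n) t| := by
            rw [abs_mul, abs_of_nonneg h2]
          have e2 : B * |a (Fin.last n) t - b (Fin.last n) t| =
              |B * (a (Fin.last n) t - b (Fin.last n) t)| := by
            rw [abs_mul, abs_of_nonneg h1]
          rw [e1, e2]
          refine le_trans (le_of_eq ?_) (abs_add_le _ _)
          congr 1
          ring
      _ = (∑ g : Fin n → X, |∏ j : Fin n, a j.castSucc (g j) -
          ∏ j : Fin n, b j.castSucc (g j)|) * ∑ t, a (Fin.last n) t +
          (∑ g : Fin n → X, ∏ j : Fin n, b j.castSucc (g j)) *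
            ∑ t, |a (Fin.last n) t - b (Fin.last n) t| := by
          simp only [Finset.sum_add_distrib, Finset.sum_mul_sum]
      _ ≤ _ := by
          refine add_le_add ((mul_le_of_le_one_right (Finset.sum_nonneg fun _ _ => abs_nonneg _)
            (ha1 _)).trans ih') (mul_le_of_le_one_left (Finset.sum_nonneg fun _ _ => abs_nonneg _)
            hB)

/-- The law of the place of a photon. -/
noncomputable def landingPMF (inp : ℕ → ℤ) (M p : ℕ) (a : ℤ) : PMF ℕ :=
  (randBits (2 * p)).map fun r => landing inp M a r M

theorem sampler_eq (inp : ℕ → ℤ) (N M p : ℕ) : sampler inp N M p =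
    iterPMF (fun _ => 0) (fun j occ => (landingPMF inp M p (N + inp j)).bind fun t =>
      PMF.pure (Function.update occ t (occ t + 1))) := by
  unfold sampler landingPMF
  congr 1
  funext j occ
  rw [PMF.bind_map]
  rfl

theorem landingPMF_apply (inp : ℕ → ℤ) (M p : ℕ) (a : ℤ) (t : ℕ) :
    (landingPMF inp M p a t).toReal =
      (((Finset.range (4 ^ p)).filter fun r => landing inp M a r M = t).card : ℝ) / 4 ^ p := by
  have h : landingPMF inp M p a t = ∑' r, randBits (2 * p) r *
      if landing inp M a r M = t then 1 else 0 := by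
    unfold landingPMF
    rw [PMF.map_apply]
    refine tsum_congr fun r => ?_
    by_cases hr : landing inp M a r M = t
    · simp [hr]
    · simp [hr, Ne.symm hr]
  have h1 : (2 : ℝ≥0∞) ^ (2 * p) = 4 ^ p := by rw [pow_mul]; norm_num
  have h2 : 2 ^ (2 * p) = 4 ^ p := by rw [pow_mul]; norm_num
  rw [h, tsum_randBits_mul, h1, h2, ENNReal.toReal_mul, Finset.sum_boole, ENNReal.toReal_natCast,
    ENNReal.toReal_inv, ENNReal.toReal_pow, ENNReal.toReal_ofNat, div_eq_inv_mul]

theorem landingPMF_eq_zero (inp : ℕ → ℤ) (M p : ℕ) (a : ℤ) (t : ℕ) (ht : M + 1 ≤ t) :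
    landingPMF inp M p a t = 0 := by
  rw [PMF.apply_eq_zero_iff]
  intro h
  obtain ⟨r, _, rfl⟩ := (PMF.mem_support_map_iff _ _ _).1 h
  have : landing inp M a r M ≤ M := landing_le M a r M
  omega

theorem rowWeight_nonneg (inp : ℕ → ℤ) (M : ℕ) (a : ℤ) (x : ℕ) : 0 ≤ rowWeight inp M a x := by
  unfold rowWeight
  positivity

theorem cumWeight_mono (inp : ℕ → ℤ) (M : ℕ) (a : ℤ) : Monotone (cumWeight inp M a) :=
  monotone_nat_of_le_succ fun n => by
    unfold cumWeight
    rw [Finset.sum_range_succ]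
    linarith [rowWeight_nonneg inp M a n]

/-- The rows whose cumulative weight is at most the random number form an initial segment. -/
theorem le_landing_iff (inp : ℕ → ℤ) (M : ℕ) (a : ℤ) (r y t : ℕ) (ht : t ≤ y) :
    t ≤ landing inp M a r y ↔ cumWeight inp M a t ≤ r := by
  rcases Nat.eq_zero_or_pos t with rfl | ht0
  · simp [cumWeight]
  constructor
  · intro h
    by_contra hlt
    have hsub : (Finset.range y).filter (fun x => cumWeight inp M a (x + 1) ≤ r) ⊆
        Finset.range (t - 1) := by
      intro x hx
      rw [Finset.mem_filter] at hx
      rw [Finset.mem_range]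
      by_contra hx'
      exact hlt ((cumWeight_mono inp M a (by omega)).trans hx.2)
    have := Finset.card_le_card hsub
    rw [Finset.card_range] at this
    unfold landing at h
    omega
  · intro h
    have hsub : Finset.range t ⊆
        (Finset.range y).filter (fun x => cumWeight inp M a (x + 1) ≤ r) := by
      intro x hx
      rw [Finset.mem_range] at hx
      rw [Finset.mem_filter, Finset.mem_range]
      exact ⟨by omega, (cumWeight_mono inp M a (by omega)).trans h⟩
    have := Finset.card_le_card hsub
    rwa [Finset.card_range] at this

/-- The law of the landing place in terms of the truncated cumulative weights. -/
theorem landingPMF_eq (inp : ℕ → ℤ) (M p : ℕ) (a : ℤ) (t : ℕ) (ht : t ≤ M) :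
    (landingPMF inp M p a t).toReal =
      (if t = M then 1 else min 1 ((cumWeight inp M a (t + 1) : ℝ) / 4 ^ p)) -
        min 1 ((cumWeight inp M a t : ℝ) / 4 ^ p) := by
  rw [landingPMF_apply]
  have hQ : (0 : ℝ) < 4 ^ p := by positivity
  have hS0 : ∀ t, 0 ≤ cumWeight inp M a t := fun t =>
    Finset.sum_nonneg fun x _ => rowWeight_nonneg inp M a x
  -- the number of random numbers beyond a cumulative weight
  have hcard : ∀ t ≤ M, (((Finset.range (4 ^ p)).filter fun r =>
      t ≤ landing inp M a r M).card : ℝ) / 4 ^ p =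
      1 - min 1 ((cumWeight inp M a t : ℝ) / 4 ^ p) := by
    intro t ht
    obtain ⟨n, hn⟩ := Int.eq_ofNat_of_zero_le (hS0 t)
    have h1 : (Finset.range (4 ^ p)).filter (fun r => t ≤ landing inp M a r M) =
        Finset.Ico n (4 ^ p) := by
      ext r
      rw [Finset.mem_filter, le_landing_iff inp M a r M t ht, hn, Finset.mem_range,
        Finset.mem_Ico, Nat.cast_le]
      tauto
    rw [h1, Nat.card_Ico, hn, Int.cast_natCast]
    rcases le_total (4 ^ p) n with h | h
    · have h' : (4 : ℝ) ^ p ≤ n := by exact_mod_cast h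
      rw [Nat.sub_eq_zero_of_le h, min_eq_left ((one_le_div hQ).2 h')]
      simp
    · have h' : (n : ℝ) ≤ 4 ^ p := by exact_mod_cast h
      rw [Nat.cast_sub h, min_eq_right ((div_le_one hQ).2 h')]
      push_cast
      field_simp
  by_cases htM : t = M
  · rw [if_pos htM, ← hcard t ht]
    congr 3
    ext r
    have := landing_le (inp := inp) M a r M
    simp only [Finset.mem_filter]
    constructor <;> rintro ⟨h1, h2⟩ <;> exact ⟨h1, by omega⟩
  · rw [if_neg htM]
    have h1 := hcard t ht
    have h2 := hcard (t + 1) (by omega)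
    have h3 : ((Finset.range (4 ^ p)).filter fun r => t ≤ landing inp M a r M).card =
        ((Finset.range (4 ^ p)).filter fun r => landing inp M a r M = t).card +
        ((Finset.range (4 ^ p)).filter fun r => t + 1 ≤ landing inp M a r M).card := by
      rw [← Finset.card_union_of_disjoint]
      · congr 1
        ext r
        simp only [Finset.mem_union, Finset.mem_filter]
        constructor
        · rintro ⟨h1, h2⟩
          rcases Nat.eq_or_lt_of_le h2 with h | h
          · exact Or.inl ⟨h1, h.symm⟩
          · exact Or.inr ⟨h1, h⟩
        · rintro (⟨h1, h2⟩ | ⟨h1, h2⟩) <;> exact ⟨h1, by omega⟩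
      · rw [Finset.disjoint_filter]
        intro r _ h
        omega
    rw [h3] at h1
    push_cast at h1 h2
    rw [add_div] at h1
    linarith

/-- If the weights of the rows are close to probabilities `u`, so is the law of the landing
place. -/
theorem sum_abs_landingPMF_sub_le (inp : ℕ → ℤ) (M p : ℕ) (a : ℤ) (u : ℕ → ℝ) (ε : ℝ) (hε : 0 ≤ ε)
    (hu0 : ∀ x, 0 ≤ u x) (hu1 : ∑ x ∈ Finset.range M, u x = 1)
    (hu : ∀ x < M, |(rowWeight inp M a x : ℝ) / 4 ^ p - u x| ≤ ε) :
    ∑ t : Fin (M + 1), |(if (t : ℕ) < M then u t else 0) - (landingPMF inp M p a t).toReal| ≤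
      (M + 1) * (2 * M * ε) := by
  set T : ℕ → ℝ := fun t => min 1 ((cumWeight inp M a t : ℝ) / 4 ^ p) with hT
  set S : ℕ → ℝ := fun t => ∑ x ∈ Finset.range t, u x with hS
  have hS1 : ∀ t ≤ M, S t ≤ 1 := fun t ht => by
    rw [← hu1]
    exact Finset.sum_le_sum_of_subset_of_nonneg (Finset.range_mono ht) fun x _ _ => hu0 x
  have hTS : ∀ t ≤ M, |S t - T t| ≤ M * ε := by
    intro t ht
    have h1 : |S t - (cumWeight inp M a t : ℝ) / 4 ^ p| ≤ t * ε := by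
      have e : S t - (cumWeight inp M a t : ℝ) / 4 ^ p =
          ∑ x ∈ Finset.range t, (u x - (rowWeight inp M a x : ℝ) / 4 ^ p) := by
        unfold cumWeight
        push_cast
        rw [Finset.sum_sub_distrib, Finset.sum_div]
      rw [e]
      refine (Finset.abs_sum_le_sum_abs _ _).trans ?_
      refine (Finset.sum_le_card_nsmul _ _ ε fun x hx => ?_).trans_eq (by simp)
      rw [abs_sub_comm]
      exact hu x (by rw [Finset.mem_range] at hx; omega)
    have h2 : (t : ℝ) * ε ≤ M * ε := by
      have : (t : ℝ) ≤ M := by exact_mod_cast ht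
      gcongr
    have h3 := hS1 t ht
    simp only [hT]
    rw [abs_le] at h1 ⊢
    rcases min_cases 1 ((cumWeight inp M a t : ℝ) / 4 ^ p) with ⟨h, h'⟩ | ⟨h, h'⟩ <;>
      rw [h] <;> constructor <;> linarith
  refine (Finset.sum_le_card_nsmul _ _ (2 * M * ε) fun t _ => ?_).trans_eq (by simp)
  have ht : (t : ℕ) ≤ M := Nat.lt_succ_iff.1 t.isLt
  rw [landingPMF_eq inp M p a t ht]
  have h1 := abs_le.1 (hTS t ht)
  have hM0 : 0 ≤ (M : ℝ) * ε := by positivity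
  by_cases htM : (t : ℕ) = M
  · rw [if_neg (by omega), if_pos htM]
    have h2 : S t = 1 := by rw [htM]; exact hu1
    change |0 - (1 - T t)| ≤ _
    rw [abs_le]
    constructor <;> linarith
  · rw [if_pos (by omega), if_neg htM]
    have h2 := abs_le.1 (hTS (t + 1) (by omega))
    have h3 : S (t + 1) = S t + u t := Finset.sum_range_succ _ _
    change |u t - (T (t + 1) - T t)| ≤ _
    rw [abs_le]
    constructor <;> linarith

/-! ### Reading the input -/

/-- The number of sources. -/
abbrev numSources {d : ℕ} (m : Fin d → ℕ) : ℕ := ∏ i, m i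

/-- The number of modes. -/
abbrev numModes {d : ℕ} (m : Fin d → ℕ) (L : ℕ) : ℕ := ∏ i, (m i * L)

theorem getD_ofFn_append {n : ℕ} (f : Fin n → ℤ) (l : List ℤ) (a : ℕ) (h : a < n) :
    (List.ofFn f ++ l).getD a 0 = f ⟨a, h⟩ := by
  rw [List.getD_append _ _ _ _ (by simpa using h), List.getD_eq_getElem _ _ (by simpa using h),
    List.getElem_ofFn]

theorem getD_ofFn_append_right {n : ℕ} (f : Fin n → ℤ) (l : List ℤ) (a : ℕ) :
    (List.ofFn f ++ l).getD (n + a) 0 = l.getD a 0 := by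
  rw [List.getD_append_right _ _ _ _ (by simp)]
  simp

section Input

variable (o : Fin d → Fin L) (p : ℕ) (U : Matrix (Mode m L) (Mode m L) ℂ)

theorem inputArray_source (j : Fin (numSources m)) :
    inputArray o p U j = modeIndex (source o (finPiFinEquiv.symm j)) := by
  unfold inputArray
  rw [List.append_assoc, getD_ofFn_append _ _ _ j.isLt]

theorem inputArray_re (x y : Fin (numModes m L)) :
    inputArray o p U (numSources m + (x * numModes m L + y)) =
      ⌊(2 : ℝ) ^ p * (U (finPiFinEquiv.symm x) (finPiFinEquiv.symm y)).re⌋ := by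
  have h : (x * numModes m L + y : ℕ) < numModes m L * numModes m L := by
    have h1 := x.isLt
    have h2 := y.isLt
    nlinarith
  unfold inputArray
  rw [List.append_assoc, getD_ofFn_append_right, getD_ofFn_append _ _ _ h]
  have e1 : (⟨x * numModes m L + y, h⟩ : Fin (numModes m L * numModes m L)).divNat = x := by
    refine Fin.ext ?_
    simp only [Fin.divNat]
    rw [mul_comm, Nat.mul_add_div (lt_of_le_of_lt (Nat.zero_le _) y.isLt),
      Nat.div_eq_of_lt y.isLt, add_zero]
  have e2 : (⟨x * numModes m L + y, h⟩ : Fin (numModes m L * numModes m L)).modNat = y := by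
    refine Fin.ext ?_
    simp only [Fin.modNat]
    rw [mul_comm, Nat.mul_add_mod, Nat.mod_eq_of_lt y.isLt]
  rw [e1, e2]

theorem inputArray_im (x y : Fin (numModes m L)) :
    inputArray o p U
      (numSources m + (numModes m L * numModes m L + (x * numModes m L + y))) =
      ⌊(2 : ℝ) ^ p * (U (finPiFinEquiv.symm x) (finPiFinEquiv.symm y)).im⌋ := by
  have h : (x * numModes m L + y : ℕ) < numModes m L * numModes m L := by
    have h1 := x.isLt
    have h2 := y.isLt
    nlinarith
  unfold inputArray
  rw [List.append_assoc, getD_ofFn_append_right, getD_ofFn_append_right,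
    ← List.append_nil (List.ofFn _), getD_ofFn_append _ _ _ h]
  have e1 : (⟨x * numModes m L + y, h⟩ : Fin (numModes m L * numModes m L)).divNat = x := by
    refine Fin.ext ?_
    simp only [Fin.divNat]
    rw [mul_comm, Nat.mul_add_div (lt_of_le_of_lt (Nat.zero_le _) y.isLt),
      Nat.div_eq_of_lt y.isLt, add_zero]
  have e2 : (⟨x * numModes m L + y, h⟩ : Fin (numModes m L * numModes m L)).modNat = y := by
    refine Fin.ext ?_
    simp only [Fin.modNat]
    rw [mul_comm, Nat.mul_add_mod, Nat.mod_eq_of_lt y.isLt]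
  rw [e1, e2]

theorem abs_floor_le {a : ℝ} (ha : |a| ≤ 1) (p : ℕ) :
    |⌊(2 : ℝ) ^ p * a⌋| ≤ ((2 ^ p : ℕ) : ℤ) := by
  obtain ⟨h1, h2⟩ := abs_le.1 ha
  have hp : (0 : ℝ) < 2 ^ p := by positivity
  rw [abs_le]
  constructor
  · rw [Int.le_floor]
    push_cast
    nlinarith
  · rw [← Int.cast_le (R := ℝ)]
    refine (Int.floor_le _).trans ?_
    push_cast
    nlinarith

theorem abs_inputArray_le (hU : ∀ x y, ‖U x y‖ ≤ 1) (a : ℕ) :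
    |inputArray o p U a| ≤ ((2 ^ p + numModes m L : ℕ) : ℤ) := by
  have key : ∀ l : List ℤ, (∀ v ∈ l, |v| ≤ ((2 ^ p + numModes m L : ℕ) : ℤ)) →
      |l.getD a 0| ≤ ((2 ^ p + numModes m L : ℕ) : ℤ) := by
    intro l hl
    by_cases h : a < l.length
    · rw [List.getD_eq_getElem _ _ h]
      exact hl _ (List.getElem_mem h)
    · rw [List.getD_eq_default _ _ (by omega), abs_zero]
      positivity
  refine key _ fun v hv => ?_
  have hle : ((2 ^ p : ℕ) : ℤ) ≤ ((2 ^ p + numModes m L : ℕ) : ℤ) := by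
    exact_mod_cast Nat.le_add_right _ _
  rw [List.mem_append, List.mem_append, List.mem_ofFn', List.mem_ofFn', List.mem_ofFn'] at hv
  rcases hv with (⟨j, rfl⟩ | ⟨q, rfl⟩) | ⟨q, rfl⟩
  · rw [Nat.abs_cast, Nat.cast_le]
    exact (finPiFinEquiv (source o (finPiFinEquiv.symm j))).isLt.le.trans (Nat.le_add_left _ _)
  · exact (abs_floor_le ((Complex.abs_re_le_norm _).trans (hU _ _)) p).trans hle
  · exact (abs_floor_le ((Complex.abs_im_le_norm _).trans (hU _ _)) p).trans hle

theorem abs_floor_sq_sub_le {a : ℝ} (ha : |a| ≤ 1) (p : ℕ) :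
    |(⌊(2 : ℝ) ^ p * a⌋ : ℝ) ^ 2 / 4 ^ p - a ^ 2| ≤ 3 / 2 ^ p := by
  have hp : (0 : ℝ) < 2 ^ p := by positivity
  have hp1 : (1 : ℝ) ≤ 2 ^ p := one_le_pow₀ (by norm_num)
  have h4 : (4 : ℝ) ^ p = 2 ^ p * 2 ^ p := by rw [← mul_pow]; norm_num
  set q : ℝ := (⌊(2 : ℝ) ^ p * a⌋ : ℝ) / 2 ^ p with hq
  have h1 : q ≤ a := by
    rw [hq, div_le_iff₀ hp, mul_comm]
    exact Int.floor_le _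
  have h2 : a - q ≤ 1 / 2 ^ p := by
    have := (Int.lt_floor_add_one ((2 : ℝ) ^ p * a)).le
    have e : a - q = (2 ^ p * a - ⌊(2 : ℝ) ^ p * a⌋) / 2 ^ p := by
      rw [hq]; field_simp
    rw [e]
    gcongr
    linarith
  have h3 : (1 : ℝ) / 2 ^ p ≤ 1 := by rw [div_le_one hp]; exact hp1
  have e : (⌊(2 : ℝ) ^ p * a⌋ : ℝ) ^ 2 / 4 ^ p - a ^ 2 = -((a - q) * (a + q)) := by
    rw [h4, hq]; field_simp; ring
  obtain ⟨h5, h6⟩ := abs_le.1 ha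
  rw [e, abs_neg, abs_mul, abs_of_nonneg (by linarith)]
  have h7 : |a + q| ≤ 3 := by rw [abs_le]; constructor <;> linarith
  calc (a - q) * |a + q| ≤ (1 / 2 ^ p) * 3 := by gcongr
    _ = 3 / 2 ^ p := by ring

/-- The weights that the program computes approximate the transition probabilities. -/
theorem abs_rowWeight_sub_le (hU : ∀ x y, ‖U x y‖ ≤ 1) (j : Fin (numSources m))
    (x : Fin (numModes m L)) :
    |(rowWeight (inputArray o p U) (numModes m L) (numSources m + inputArray o p U j) x : ℝ) / 4 ^ p
      - ‖U (finPiFinEquiv.symm x) (source o (finPiFinEquiv.symm j))‖ ^ 2| ≤ 6 / 2 ^ p := by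
  set y : Fin (numModes m L) := finPiFinEquiv (source o (finPiFinEquiv.symm j)) with hy
  have hys : finPiFinEquiv.symm y = source o (finPiFinEquiv.symm j) := by rw [hy]; simp
  have e0 : inputArray o p U j = ((y : ℕ) : ℤ) := inputArray_source o p U j
  have e1 : ((numSources m : ℤ) + inputArray o p U j + (x : ℕ) * (numModes m L : ℕ)).toNat =
      numSources m + (x * numModes m L + y) := by
    rw [e0, ← Int.toNat_natCast (numSources m + (x * numModes m L + y))]
    congr 1
    push_cast
    ring
  have e2 : ((numSources m : ℤ) + inputArray o p U j + (x : ℕ) * (numModes m L : ℕ) +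
      (numModes m L : ℕ) * (numModes m L : ℕ)).toNat =
      numSources m + (numModes m L * numModes m L + (x * numModes m L + y)) := by
    rw [e0, ← Int.toNat_natCast
      (numSources m + (numModes m L * numModes m L + (x * numModes m L + y)))]
    congr 1
    push_cast
    ring
  unfold rowWeight
  rw [e1, e2, inputArray_re, inputArray_im, hys]
  set z := U (finPiFinEquiv.symm x) (source o (finPiFinEquiv.symm j)) with hz
  have h1 := abs_floor_sq_sub_le ((Complex.abs_re_le_norm z).trans (hU _ _)) p
  have h2 := abs_floor_sq_sub_le ((Complex.abs_im_le_norm z).trans (hU _ _)) p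
  have h3 : ‖z‖ ^ 2 = z.re ^ 2 + z.im ^ 2 := by
    rw [← Complex.normSq_eq_norm_sq, Complex.normSq_apply]; ring
  rw [h3]
  push_cast
  rw [add_div]
  rw [abs_le] at h1 h2 ⊢
  have h6 : (6 : ℝ) / 2 ^ p = 3 / 2 ^ p + 3 / 2 ^ p := by ring
  constructor <;> linarith

/-! ### The output of the program -/

theorem valueBound_lt_two_pow (N M p : ℕ) :
    valueBound N M p (2 ^ p + M) < 2 ^ (2 * p + 3 * M + N + 4) := by
  have hM : M < 2 ^ M := Nat.lt_two_pow_self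
  have hN : N < 2 ^ N := Nat.lt_two_pow_self
  have hp : p < 2 ^ p := Nat.lt_two_pow_self
  have h4 : 4 ^ p = 2 ^ p * 2 ^ p := by rw [← mul_pow]; norm_num
  have hexp : 2 ^ (2 * p + 3 * M + N + 4) =
      16 * (2 ^ p * 2 ^ p * (2 ^ M * 2 ^ M * 2 ^ M) * 2 ^ N) := by
    ring
  rw [hexp]
  unfold valueBound
  rw [h4]
  have hE : 2 ^ p + M ≤ 2 ^ p * 2 ^ M := by
    have : 1 ≤ 2 ^ p := Nat.one_le_two_pow
    nlinarith
  have hE2 : (2 ^ p + M) ^ 2 ≤ 2 ^ p * 2 ^ p * (2 ^ M * 2 ^ M) := by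
    calc (2 ^ p + M) ^ 2 ≤ (2 ^ p * 2 ^ M) ^ 2 := Nat.pow_le_pow_left hE 2
      _ = _ := by ring
  have hP1 : 1 ≤ 2 ^ p := Nat.one_le_two_pow
  have hM1 : 1 ≤ 2 ^ M := Nat.one_le_two_pow
  have hN1 : 1 ≤ 2 ^ N := Nat.one_le_two_pow
  generalize 2 ^ p + M = E at *
  generalize 2 ^ p = P at *
  generalize 2 ^ M = A at *
  generalize 2 ^ N = B at *
  set X := P * P * (A * A * A) * B with hX
  have k1 : P * P ≤ X := by
    calc P * P = P * P * (1 * 1 * 1) * 1 := by ring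
      _ ≤ X := by rw [hX]; gcongr
  have k2 : M * E ^ 2 ≤ X := by
    calc M * E ^ 2 ≤ A * (P * P * (A * A)) := Nat.mul_le_mul hM.le hE2
      _ = P * P * (A * A * A) * 1 := by ring
      _ ≤ X := by rw [hX]; gcongr
  have k3 : E ^ 2 ≤ X := by
    calc E ^ 2 ≤ P * P * (A * A) := hE2
      _ = P * P * (A * A * 1) * 1 := by ring
      _ ≤ X := by rw [hX]; gcongr
  have k4 : E ≤ X := by
    calc E ≤ P * A := hE
      _ = P * 1 * (A * 1 * 1) * 1 := by ring
      _ ≤ X := by rw [hX]; gcongr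
  have k5 : N ≤ X := by
    calc N ≤ B := hN.le
      _ = 1 * 1 * (1 * 1 * 1) * B := by ring
      _ ≤ X := by rw [hX]; gcongr
  have k6 : M * M ≤ X := by
    calc M * M ≤ A * A := Nat.mul_le_mul hM.le hM.le
      _ = 1 * 1 * (A * A * 1) * 1 := by ring
      _ ≤ X := by rw [hX]; gcongr
  have k7 : M ≤ X := by
    calc M ≤ A := hM.le
      _ = 1 * 1 * (A * 1 * 1) * 1 := by ring
      _ ≤ X := by rw [hX]; gcongr
  have k8 : p ≤ X := by
    calc p ≤ P := hp.le
      _ = P * 1 * (1 * 1 * 1) * 1 := by ring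
      _ ≤ X := by rw [hX]; gcongr
  have k9 : 1 ≤ X := by
    calc 1 = 1 * 1 * (1 * 1 * 1) * 1 := by ring
      _ ≤ X := by rw [hX]; gcongr
  have e : 2 * M * E ^ 2 = 2 * (M * E ^ 2) := by ring
  rw [e]
  omega

/-- The program realizes the abstract sampler on the given input. -/
theorem couples_finalState (hU : ∀ x y, ‖U x y‖ ≤ 1) :
    Couples (sampler (inputArray o p U) (numSources m) (numModes m L) p (numSources m))
      (finalState samplerProg o p U) fun occ s => s.mem = (fun a => (occ a : ℤ)) ∧
        s.cost ≤ (4 + numSources m * (11 + 8 * p + 12 * numModes m L)) *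
          (1 + (2 * p + 3 * numModes m L + numSources m + 4)) ^ 2 := by
  refine couples_samplerProg (V := valueBound (numSources m) (numModes m L) p
    (2 ^ p + numModes m L)) ?_ (abs_inputArray_le o p U hU) le_rfl ?_ ?_ ?_ ?_ rfl rfl
  · intro v hv
    unfold bits
    rw [Nat.size_le]
    refine lt_of_le_of_lt ?_ (valueBound_lt_two_pow _ _ _)
    rw [Int.abs_eq_natAbs] at hv
    exact_mod_cast hv
  all_goals simp [initState]

/-- The output distribution as a sum over assignments of the photons to the cells of the memory. -/
theorem outputProb_eq (hU : ∀ x y, ‖U x y‖ ≤ 1) (t : Mode m L → ℕ) :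
    outputProb samplerProg o p U t =
      ∑ g : Fin (numSources m) → Fin (numModes m L + 1),
        if (fun x : Mode m L => countPlaces g (modeIndex x)) = t then
          ∏ j : Fin (numSources m), (landingPMF (inputArray o p U) (numModes m L) p
            (numSources m + inputArray o p U j) (g j)).toReal else 0 := by
  unfold outputProb
  rw [(couples_finalState o p U hU).map_eq (fun occ (x : Mode m L) => occ (modeIndex x))
    (fun s (x : Mode m L) => (s.mem (modeIndex x)).toNat) (by
      rintro occ s ⟨h, -⟩
      funext x
      rw [h, Int.toNat_natCast])]
  have h : ((sampler (inputArray o p U) (numSources m) (numModes m L) p (numSources m)).map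
      fun occ (x : Mode m L) => occ (modeIndex x)) t =
      ∑' occ, sampler (inputArray o p U) (numSources m) (numModes m L) p (numSources m) occ *
        if (fun x : Mode m L => occ (modeIndex x)) = t then 1 else 0 := by
    rw [PMF.map_apply]
    refine tsum_congr fun occ => ?_
    by_cases hr : (fun x : Mode m L => occ (modeIndex x)) = t
    · simp [hr]
    · simp [hr, Ne.symm hr]
  rw [h, sampler_eq, tsum_iterPMF_mul (K := numModes m L + 1)
    (fun j => landingPMF (inputArray o p U) (numModes m L) p (numSources m + inputArray o p U j))
    (fun j t ht => landingPMF_eq_zero _ _ _ _ _ ht), ENNReal.toReal_sum]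
  · refine Finset.sum_congr rfl fun g _ => ?_
    split_ifs
    · rw [mul_one, ENNReal.toReal_prod]
    · simp
  · intro g _
    refine ENNReal.mul_ne_top (ENNReal.prod_ne_top fun j _ => PMF.apply_ne_top _ _) ?_
    split_ifs <;> simp

/-- The transition probabilities of the photon of the source `j`, by the numbers of the modes;
there is no mode with the number `numModes m L`. -/
noncomputable def placeProb (j : Fin (numSources m)) (t : ℕ) : ℝ :=
  if h : t < numModes m L then
    ‖U (finPiFinEquiv.symm ⟨t, h⟩) (source o (finPiFinEquiv.symm j))‖ ^ 2 else 0

theorem placeProb_nonneg (j : Fin (numSources m)) (t : ℕ) : 0 ≤ placeProb o U j t := by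
  unfold placeProb
  split_ifs <;> positivity

theorem sum_placeProb (hU : ∀ s, ∑ x, ‖U x s‖ ^ 2 = 1) (j : Fin (numSources m)) :
    ∑ t ∈ Finset.range (numModes m L), placeProb o U j t = 1 := by
  rw [Finset.sum_range, ← hU (source o (finPiFinEquiv.symm j)),
    ← Equiv.sum_comp (finPiFinEquiv (m := d) (n := fun i => m i * L)).symm]
  refine Finset.sum_congr rfl fun t _ => ?_
  rw [placeProb, dif_pos t.isLt]

/-- The distribution for distinguishable photons in the form of `outputProb_eq`. -/
theorem distinguishableProb_eq (t : Mode m L → ℕ) :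
    distinguishableProb o U t =
      ∑ g : Fin (numSources m) → Fin (numModes m L + 1),
        if (fun x : Mode m L => countPlaces g (modeIndex x)) = t then
          ∏ j, placeProb o U j (g j) else 0 := by
  unfold distinguishableProb
  set e : (Cell m → Mode m L) → Fin (numSources m) → Fin (numModes m L + 1) := fun f j =>
    Fin.castSucc (finPiFinEquiv (f (finPiFinEquiv.symm j))) with he
  refine Fintype.sum_of_injective e ?_ _ _ ?_ ?_
  · intro f f' hff
    funext α
    have := congrFun hff (finPiFinEquiv α)
    simpa [he] using this
  · intro g hg
    by_cases hall : ∀ j, (g j : ℕ) < numModes m L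
    · exfalso
      refine hg ⟨fun α => finPiFinEquiv.symm ⟨g (finPiFinEquiv α), hall _⟩, ?_⟩
      funext j
      refine Fin.ext ?_
      simp [he]
    · push Not at hall
      obtain ⟨j, hj⟩ := hall
      rw [Finset.prod_eq_zero (Finset.mem_univ j), ite_self]
      rw [placeProb, dif_neg (by omega)]
  · intro f
    have h1 : (fun x : Mode m L => countPlaces (e f) (modeIndex x)) = occupation f := by
      funext x
      unfold countPlaces occupation
      refine Finset.card_equiv finPiFinEquiv.symm fun j => ?_
      simp only [Finset.mem_filter, Finset.mem_univ, true_and, he, Fin.val_castSucc]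
      unfold modeIndex
      rw [← Fin.ext_iff, EmbeddingLike.apply_eq_iff_eq]
    have h2 : ∏ j, placeProb o U j (e f j) = ∏ α, ‖U (f α) (source o α)‖ ^ 2 := by
      rw [← Equiv.prod_comp (finPiFinEquiv (m := d) (n := m)).symm]
      refine Finset.prod_congr rfl fun j _ => ?_
      rw [placeProb, dif_pos (by simp [he])]
      simp [he]
    rw [h1, h2]

/-- The program samples the distinguishable photons up to the rounding errors of all entries. -/
theorem tvDist_outputProb_le (hU : ∀ s, ∑ x, ‖U x s‖ ^ 2 = 1) (hU1 : ∀ x y, ‖U x y‖ ≤ 1) :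
    tvDist (distinguishableProb o U) (outputProb samplerProg o p U) ≤
      ENNReal.ofReal
        (numSources m * ((numModes m L + 1) * (2 * numModes m L * (6 / 2 ^ p))) / 2) := by
  set q : Fin (numSources m) → Fin (numModes m L + 1) → ℝ := fun j t =>
    (landingPMF (inputArray o p U) (numModes m L) p (numSources m + inputArray o p U j) t).toReal
    with hq
  refine (tvDist_le_of_fiber _ _
    (fun g : Fin (numSources m) → Fin (numModes m L + 1) =>
      fun x : Mode m L => countPlaces g (modeIndex x))
    (fun g => |∏ j, placeProb o U j (g j) - ∏ j, q j (g j)|) (fun _ => abs_nonneg _) ?_).trans ?_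
  · intro t
    rw [distinguishableProb_eq, outputProb_eq o p U hU1, ← Finset.sum_sub_distrib]
    refine (Finset.abs_sum_le_sum_abs _ _).trans (Finset.sum_le_sum fun g _ => ?_)
    split_ifs <;> simp [hq]
  · refine ENNReal.ofReal_le_ofReal ?_
    gcongr
    refine (sum_abs_prod_sub_le _
      (fun j (t : Fin (numModes m L + 1)) => placeProb o U j (t : ℕ)) q
      (fun j t => placeProb_nonneg o U j t) (fun j t => ENNReal.toReal_nonneg) ?_ ?_).trans ?_
    · intro j
      rw [Fin.sum_univ_castSucc]
      simp only [Fin.val_castSucc, Fin.val_last]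
      rw [← Finset.sum_range, sum_placeProb o U hU, placeProb, dif_neg (lt_irrefl _), add_zero]
    · intro j
      rw [hq, ← ENNReal.toReal_sum fun t _ => PMF.apply_ne_top _ _]
      refine ENNReal.toReal_le_of_le_ofReal zero_le_one ?_
      rw [ENNReal.ofReal_one, ← Finset.sum_range, ← (landingPMF _ _ _ _).tsum_coe]
      exact ENNReal.sum_le_tsum _
    · refine le_trans (Finset.sum_le_card_nsmul _ _
        (((numModes m L : ℝ) + 1) * (2 * numModes m L * (6 / 2 ^ p))) fun j _ => ?_)
        (le_of_eq (by simp))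
      refine le_trans (le_of_eq ?_) (sum_abs_landingPMF_sub_le (inputArray o p U) (numModes m L) p
        (numSources m + inputArray o p U j) (placeProb o U j) (6 / 2 ^ p) (by positivity)
        (placeProb_nonneg o U j) (sum_placeProb o U hU j) ?_)
      · refine Finset.sum_congr rfl fun t _ => ?_
        congr 2
        by_cases ht : (t : ℕ) < numModes m L
        · rw [if_pos ht]
        · rw [if_neg ht, placeProb, dif_neg ht]
      · intro x hx
        rw [placeProb, dif_pos hx]
        exact abs_rowWeight_sub_le o p U hU1 j ⟨x, hx⟩

end Input

/-! ### Asymptotic estimates -/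

/-- Powers are bounded against stretched exponentials. -/
theorem exists_rpow_mul_exp_le (s c κ : ℝ) (hc : 0 < c) (hκ : 0 < κ) :
    ∃ B : ℝ, 0 < B ∧ ∀ x : ℝ, 1 ≤ x → x ^ s * Real.exp (-κ * x ^ c) ≤ B := by
  obtain ⟨n, hn⟩ := exists_nat_ge (s / c)
  refine ⟨n.factorial / κ ^ n, by positivity, fun x hx => ?_⟩
  have hx0 : 0 < x := by linarith
  have h1 : x ^ s ≤ (x ^ c) ^ n := by
    rw [← Real.rpow_natCast, ← Real.rpow_mul hx0.le]
    refine Real.rpow_le_rpow_of_exponent_le hx ?_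
    rwa [div_le_iff₀ hc, mul_comm] at hn
  have h2 : (κ * x ^ c) ^ n / n.factorial ≤ Real.exp (κ * x ^ c) :=
    Real.pow_div_factorial_le_exp _ (by positivity) n
  rw [neg_mul, Real.exp_neg, ← div_eq_mul_inv, div_le_div_iff₀ (Real.exp_pos _) (by positivity)]
  rw [div_le_iff₀ (by positivity), mul_pow] at h2
  calc x ^ s * κ ^ n ≤ (x ^ c) ^ n * κ ^ n := by gcongr
    _ ≤ n.factorial * Real.exp (κ * x ^ c) := by linarith

/-- A smaller power is dominated by any multiple of a larger one, up to a constant. -/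
theorem exists_rpow_sub_le (c δ a ε : ℝ) (hc : 0 < c) (hδ : 0 < δ) (ha : 0 < a) (hε : 0 < ε) :
    ∃ B : ℝ, ∀ x : ℝ, 1 ≤ x → a * x ^ (c - δ) ≤ ε * x ^ c + B := by
  refine ⟨a * ((a / ε) ^ δ⁻¹) ^ c, fun x hx => ?_⟩
  have hx0 : 0 < x := by linarith
  have hxc : 0 < x ^ c := Real.rpow_pos_of_pos hx0 c
  rcases le_total (a / ε) (x ^ δ) with h | h
  · have h1 : a * x ^ (c - δ) ≤ ε * x ^ c := by
      rw [Real.rpow_sub hx0, ← mul_div_assoc, div_le_iff₀ (Real.rpow_pos_of_pos hx0 δ)]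
      rw [div_le_iff₀ hε] at h
      nlinarith
    have : 0 ≤ a * ((a / ε) ^ δ⁻¹) ^ c := by positivity
    linarith
  · have h1 : x ≤ (a / ε) ^ δ⁻¹ := by
      calc x = (x ^ δ) ^ δ⁻¹ := by
            rw [← Real.rpow_mul hx0.le, mul_inv_cancel₀ hδ.ne', Real.rpow_one]
        _ ≤ _ := Real.rpow_le_rpow (by positivity) h (by positivity)
    have h2 : x ^ (c - δ) ≤ x ^ c := Real.rpow_le_rpow_of_exponent_le hx (by linarith)
    have h3 : x ^ c ≤ ((a / ε) ^ δ⁻¹) ^ c := Real.rpow_le_rpow hx0.le h1 hc.le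
    have h4 : a * x ^ (c - δ) ≤ a * ((a / ε) ^ δ⁻¹) ^ c := by
      have := h2.trans h3
      gcongr
    have : 0 ≤ ε * x ^ c := by positivity
    linarith

theorem one_add_pow_sub_le (n : ℕ) {v : ℝ} (hv : 0 ≤ v) :
    (v + 1) ^ n - n * v - 1 ≤ (n * v) ^ 2 * Real.exp (n * v) := by
  have h1 : (v + 1) ^ n ≤ Real.exp (n * v) := by
    rw [Real.exp_nat_mul]
    exact pow_le_pow_left₀ (by positivity) (Real.add_one_le_exp v) n
  set x := (n : ℝ) * v with hx
  have hx0 : 0 ≤ x := by positivity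
  have h2 : Real.exp x - 1 ≤ x * Real.exp x := by
    have h := Real.add_one_le_exp (-x)
    have e : Real.exp (-x) * Real.exp x = 1 := by rw [← Real.exp_add]; simp
    have := mul_le_mul_of_nonneg_right h (Real.exp_pos x).le
    linarith
  have h3 := mul_le_mul_of_nonneg_left h2 hx0
  nlinarith

/-- The error bound for an exponentially small leakage. -/
theorem exists_errorBound_le (k γ κ c : ℝ) (hk : 0 < k) (hκ : 0 < κ) (hc : 0 < c) :
    ∃ B : ℝ, 0 < B ∧ ∀ (N : ℕ) (η : ℝ), 0 < N → 0 ≤ η → η ≤ Real.exp (-κ * (N : ℝ) ^ c) →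
      errorBound k γ N η ≤ B * (N : ℝ) ^ (γ + 3) * Real.exp (-κ * (N : ℝ) ^ c) := by
  obtain ⟨B, hB, hBN⟩ := exists_rpow_mul_exp_le (γ + 3) c κ hc hκ
  refine ⟨2 * k * Real.exp (Real.sqrt (4 * k * B)), by positivity, ?_⟩
  intro N η hN hη hle
  have hN1 : (1 : ℝ) ≤ N := by exact_mod_cast hN
  have hN0 : (0 : ℝ) < N := by linarith
  set P := (N : ℝ) ^ (γ + 3) with hP
  set e := Real.exp (-κ * (N : ℝ) ^ c) with he
  set v := 2 * Real.sqrt (η * k * (N : ℝ) ^ (γ + 1)) with hv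
  have hsq : (N * v) ^ 2 ≤ 4 * k * (P * e) := by
    have h1 : (N * v) ^ 2 = 4 * k * (η * P) := by
      have e3 : P = (N : ℝ) ^ (γ + 1) * (N : ℝ) ^ 2 := by
        rw [hP, ← Real.rpow_natCast, ← Real.rpow_add hN0]
        norm_num
        ring_nf
      rw [hv, mul_pow, mul_pow, Real.sq_sqrt (by positivity), e3]
      ring
    rw [h1, mul_comm P e]
    gcongr
  have hx : N * v ≤ Real.sqrt (4 * k * B) := by
    refine Real.le_sqrt_of_sq_le (hsq.trans ?_)
    have := hBN N hN1
    gcongr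
  have h := one_add_pow_sub_le N (show 0 ≤ v by positivity)
  unfold errorBound
  rw [← hv, div_le_iff₀ (by norm_num)]
  calc _ ≤ (N * v) ^ 2 * Real.exp (N * v) := h
    _ ≤ (4 * k * (P * e)) * Real.exp (Real.sqrt (4 * k * B)) := by gcongr
    _ = _ := by ring

/-- The polynomial bounds for the running time and for the precision of the program. -/
theorem exists_samplesWithin (k γ : ℝ) :
    ∃ b : ℕ, 0 < b ∧ ∀ (d L p : ℕ) (m : Fin d → ℕ) (o : Fin d → Fin L)
      (U : Matrix (Mode m L) (Mode m L) ℂ), 0 < numSources m → 0 < L →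
      (numModes m L : ℝ) = k * (numSources m : ℝ) ^ γ →
      (∀ s, ∑ x, ‖U x s‖ ^ 2 = 1) → (∀ x y, ‖U x y‖ ≤ 1) →
      SamplesWithin samplerProg o p (b * (numSources m + p) ^ b) U (distinguishableProb o U)
        (b * (numSources m : ℝ) ^ b / 2 ^ p) := by
  set H := ⌈k⌉₊ + 1 with hH
  set g := ⌈γ⌉₊ + 1 with hg
  set b := 4235 * H ^ 4 + 12 * H ^ 2 + 4 * g + 1 with hb
  refine ⟨b, by omega, ?_⟩
  intro d L p m o U hN hL hM hU hU1
  set N := numSources m with hNdef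
  set M := numModes m L with hMdef
  have hN1 : (1 : ℝ) ≤ N := by exact_mod_cast hN
  have hMle : M ≤ H * N ^ g := by
    have h : (M : ℝ) ≤ H * (N : ℝ) ^ g := by
      rw [hM]
      refine mul_le_mul ?_ ?_ (by positivity) (by positivity)
      · rw [hH]; push_cast; linarith [Nat.le_ceil k]
      · rw [← Real.rpow_natCast]
        refine Real.rpow_le_rpow_of_exponent_le hN1 ?_
        rw [hg]; push_cast; linarith [Nat.le_ceil γ]
    exact_mod_cast h
  have hM1 : 1 ≤ M := by
    have : N ≤ M := Finset.prod_le_prod' fun i _ => Nat.le_mul_of_pos_right _ hL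
    omega
  have hH1 : 1 ≤ H := by omega
  constructor
  · refine (couples_finalState o p U hU1).ensures ?_
    rintro occ s ⟨-, hc⟩
    refine hc.trans ?_
    rw [← hNdef, ← hMdef]
    set Z := N + p with hZ
    have hZ1 : 1 ≤ Z := by omega
    set Y := H * Z ^ g with hY
    have hZY : Z ≤ Y := by
      calc Z = 1 * Z ^ 1 := by ring
        _ ≤ Y := Nat.mul_le_mul hH1 (Nat.pow_le_pow_right hZ1 (by omega))
    have hMY : M ≤ Y := hMle.trans (Nat.mul_le_mul_left _ (Nat.pow_le_pow_left (by omega) _))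
    have hY1 : 1 ≤ Y := by omega
    have h1 : 4 + N * (11 + 8 * p + 12 * M) ≤ 35 * Y ^ 2 := by
      have h2 : N * (11 + 8 * p + 12 * M) ≤ Y * (31 * Y) :=
        Nat.mul_le_mul (by omega) (by omega)
      have h3 : 4 ≤ 4 * (Y * Y) := by
        have := Nat.mul_le_mul hY1 hY1
        omega
      calc 4 + N * (11 + 8 * p + 12 * M) ≤ 4 * (Y * Y) + Y * (31 * Y) := Nat.add_le_add h3 h2
        _ = _ := by ring
    calc _ ≤ (35 * Y ^ 2) * (11 * Y) ^ 2 :=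
          Nat.mul_le_mul h1 (Nat.pow_le_pow_left (by omega) 2)
      _ = 4235 * H ^ 4 * Z ^ (4 * g) := by rw [hY]; ring
      _ ≤ b * Z ^ b := Nat.mul_le_mul (by omega) (Nat.pow_le_pow_right hZ1 (by omega))
  · refine (tvDist_outputProb_le o p U hU hU1).trans (ENNReal.ofReal_le_ofReal ?_)
    rw [← hNdef, ← hMdef]
    have hM1' : (1 : ℝ) ≤ M := by exact_mod_cast hM1
    have hnat : 12 * (N * M ^ 2) ≤ b * N ^ b := by
      calc 12 * (N * M ^ 2) ≤ 12 * (N * (H * N ^ g) ^ 2) := by gcongr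
        _ = 12 * H ^ 2 * N ^ (2 * g + 1) := by ring
        _ ≤ b * N ^ b := Nat.mul_le_mul (by omega) (Nat.pow_le_pow_right hN (by omega))
    have hreal : 12 * ((N : ℝ) * (M : ℝ) ^ 2) ≤ b * (N : ℝ) ^ b := by exact_mod_cast hnat
    have e : (N : ℝ) * ((M + 1) * (2 * M * (6 / 2 ^ p))) / 2 =
        6 * (N * (M * (M + 1))) / 2 ^ p := by ring
    rw [e]
    refine div_le_div_of_nonneg_right (le_trans ?_ hreal) (by positivity)
    have : (M : ℝ) * (M + 1) ≤ 2 * M ^ 2 := by nlinarith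
    calc 6 * ((N : ℝ) * (M * (M + 1))) ≤ 6 * (N * (2 * M ^ 2)) := by gcongr
      _ = _ := by ring

theorem SamplesWithin.mono {A : Prog} {o : Fin d → Fin L} {p T T' : ℕ}
    {U : Matrix (Mode m L) (Mode m L) ℂ} {P : (Mode m L → ℕ) → ℝ} {ε ε' : ℝ}
    (h : SamplesWithin A o p T U P ε) (hT : T ≤ T') (hε : ε ≤ ε') :
    SamplesWithin A o p T' U P ε' :=
  ⟨fun s hs => (h.1 s hs).trans hT, h.2.trans (ENNReal.ofReal_le_ofReal hε)⟩

/-- The tail bound for the leakage in terms of the number of sources. -/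
theorem exists_measure_maxLeakage_le (hd : 0 < d) (k γ c₁ c₂ κ : ℝ) (hk : 0 < k) (hγ : 1 < γ)
    (hc₁ : 0 < c₁) (hc₂ : 0 < c₂) (hκ' : κ < d * k ^ (2 / (d : ℝ)) / (8 * c₁)) :
    ∃ K κ' : ℝ, 0 < κ' ∧ ∀ (L D : ℕ) (m : Fin d → ℕ) (o : Fin d → Fin L)
      (sched : ℕ → Fin d × Fin 2), 0 < numSources m →
      (numModes m L : ℝ) = k * (numSources m : ℝ) ^ γ → IsCentral o → IsSchedule sched →
      (D : ℝ) ≤ c₁ * (numSources m : ℝ) ^ (2 * (γ - 1) / d - c₂) →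
      circuitMeasure m L D {ω | ¬ maxLeakage o (circuit sched D ω) ≤
        Real.exp (-κ * (numSources m : ℝ) ^ c₂)} ≤
        ENNReal.ofReal (K * Real.exp (-κ' * (numSources m : ℝ) ^ c₂)) := by
  have hd0 : (0 : ℝ) < d := by exact_mod_cast hd
  set κ₀ := d * k ^ (2 / (d : ℝ)) / (8 * c₁) with hκ₀
  set κ' := (κ₀ - κ) / 2 with hκ'def
  have hκ'0 : 0 < κ' := by rw [hκ'def]; linarith
  set δ := (γ - 1) / d with hδ
  have hδ0 : 0 < δ := div_pos (by linarith) hd0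
  set C := 3 * (d * k ^ (1 / (d : ℝ)) / (2 * c₁)) with hC
  have hC0 : 0 < C := by positivity
  obtain ⟨B, hB⟩ := exists_rpow_sub_le c₂ δ C (κ' / 2) hc₂ hδ0 hC0 (by linarith)
  obtain ⟨B', hB'0, hB'⟩ := exists_rpow_mul_exp_le 1 c₂ (κ' / 2) hc₂ (by linarith)
  refine ⟨2 * d * Real.exp B * B', κ', hκ'0, ?_⟩
  intro L D m o sched hN hM ho hs hD
  set N := numSources m with hNdef
  have hN1 : (1 : ℝ) ≤ N := by exact_mod_cast hN
  have hN0 : (0 : ℝ) < N := by linarith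
  -- the edge length
  have hL0 : (0 : ℝ) ≤ L := by positivity
  have hLd : (L : ℝ) ^ d = k * (N : ℝ) ^ (γ - 1) := by
    have h1 : (numModes m L : ℝ) = N * (L : ℝ) ^ d := by
      rw [hNdef]
      unfold numModes numSources
      rw [Finset.prod_mul_distrib]
      simp
    rw [h1] at hM
    rw [Real.rpow_sub hN0, Real.rpow_one]
    field_simp
    linarith
  have hL : (L : ℝ) = k ^ (1 / (d : ℝ)) * (N : ℝ) ^ δ := by
    have h1 : (L : ℝ) = ((L : ℝ) ^ d) ^ (1 / (d : ℝ)) := by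
      rw [one_div, Real.pow_rpow_inv_natCast hL0 hd.ne']
    rw [h1, hLd, Real.mul_rpow hk.le (by positivity), ← Real.rpow_mul hN0.le, hδ]
    congr 2
    ring
  have hL2 : (L : ℝ) ^ 2 = k ^ (2 / (d : ℝ)) * (N : ℝ) ^ (2 * δ) := by
    rw [hL, mul_pow, ← Real.rpow_natCast, ← Real.rpow_natCast, ← Real.rpow_mul hk.le,
      ← Real.rpow_mul hN0.le]
    push_cast
    congr 2 <;> ring
  -- the optimal parameter of the exponential moment
  have hexp : 2 * (γ - 1) / d - c₂ = 2 * δ - c₂ := by rw [hδ]; ring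
  rw [hexp] at hD
  set T := c₁ * (N : ℝ) ^ (2 * δ - c₂) with hT
  have hT0 : 0 < T := by positivity
  set l := L * d / (2 * T) with hl
  have hl0 : 0 ≤ l := by positivity
  have hNsplit : (N : ℝ) ^ (2 * δ - c₂) * (N : ℝ) ^ c₂ = (N : ℝ) ^ (2 * δ) := by
    rw [← Real.rpow_add hN0]; congr 1; ring
  have hquad : L ^ 2 * d / (8 * T) = κ₀ * (N : ℝ) ^ c₂ := by
    rw [hL2, hκ₀, hT, ← hNsplit]
    have : (N : ℝ) ^ (2 * δ - c₂) ≠ 0 := (Real.rpow_pos_of_pos hN0 _).ne'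
    field_simp
  have hlin : 3 * l = C * (N : ℝ) ^ (c₂ - δ) := by
    have e : (N : ℝ) ^ δ = (N : ℝ) ^ (c₂ - δ) * (N : ℝ) ^ (2 * δ - c₂) := by
      rw [← Real.rpow_add hN0]; congr 1; ring
    rw [hl, hL, hT, hC, e]
    have : (N : ℝ) ^ (2 * δ - c₂) ≠ 0 := (Real.rpow_pos_of_pos hN0 _).ne'
    field_simp
  have hmain : D * l ^ 2 / (2 * d) + 3 * l - l * L / 2 + κ * (N : ℝ) ^ c₂ ≤
      -(3 / 2 * κ') * (N : ℝ) ^ c₂ + B := by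
    have h1 : D * l ^ 2 / (2 * d) ≤ T * l ^ 2 / (2 * d) := by gcongr
    have h2 : T * l ^ 2 / (2 * d) = L ^ 2 * d / (8 * T) := by
      rw [hl]; field_simp; ring
    have h3 : l * L / 2 = 2 * (L ^ 2 * d / (8 * T)) := by
      rw [hl]; field_simp; ring
    have h4 := hB N hN1
    rw [h2, hquad] at h1
    rw [hquad] at h3
    have h5 : κ₀ = κ + 2 * κ' := by rw [hκ'def]; ring
    rw [h5] at h1 h3
    rw [hlin]
    linarith
  have hmeas := measure_maxLeakage_gt_le (m := m) hd sched hs o ho D l hl0 (κ * (N : ℝ) ^ c₂)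
  rw [← neg_mul] at hmeas
  refine hmeas.trans (ENNReal.ofReal_le_ofReal ?_)
  have h6 := hB' N hN1
  rw [Real.rpow_one] at h6
  calc 2 * d * (N : ℝ) * Real.exp (D * l ^ 2 / (2 * d) + 3 * l - l * L / 2 + κ * (N : ℝ) ^ c₂)
      ≤ 2 * d * (N : ℝ) * Real.exp (-(3 / 2 * κ') * (N : ℝ) ^ c₂ + B) := by gcongr
    _ = 2 * d * Real.exp B * ((N : ℝ) * Real.exp (-(κ' / 2) * (N : ℝ) ^ c₂)) *
        Real.exp (-κ' * (N : ℝ) ^ c₂) := by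
        have e : -(3 / 2 * κ') * (N : ℝ) ^ c₂ + B =
          B + -(κ' / 2) * (N : ℝ) ^ c₂ + -κ' * (N : ℝ) ^ c₂ := by ring
        rw [e, Real.exp_add, Real.exp_add]
        ring
    _ ≤ _ := by gcongr

end LinearOptics

theorem theorem2 (d : ℕ) (hd : 0 < d) (k γ c₁ c₂ κ : ℝ) (hk : 0 < k) (hγ : 1 < γ)
    (hc₁ : 0 < c₁) (hc₂ : 0 < c₂) (hκ : 0 < κ)
    (hκ' : κ < d * k ^ (2 / (d : ℝ)) / (8 * c₁)) :
    ∃ (A : Prog) (a b : ℕ) (K κ' : ℝ) (f : ℕ → ℝ),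
      0 < κ' ∧ f =o[Filter.atTop] (fun N : ℕ => (N : ℝ) ^ c₂) ∧
      ∀ (N L D : ℕ) (m : Fin d → ℕ) (o : Fin d → Fin L) (sched : ℕ → Fin d × Fin 2),
        0 < N → ∏ i, m i = N → ((∏ i, (m i * L) : ℕ) : ℝ) = k * (N : ℝ) ^ γ →
        IsCentral o → IsSchedule sched →
        (D : ℝ) ≤ c₁ * (N : ℝ) ^ (2 * (γ - 1) / d - c₂) →
        -- the error of treating the photons as distinguishable, for every circuit
        (∀ ω : Angles m L D,
          tvDist (idealProb o (circuit sched D ω)) (distinguishableProb o (circuit sched D ω)) ≤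
            ENNReal.ofReal (errorBound k γ N (maxLeakage o (circuit sched D ω)))) ∧
        -- `A` samples the distinguishable photons in polynomial time, for every circuit
        (∀ (ω : Angles m L D) (p : ℕ),
          SamplesWithin A o p (b * (N + p) ^ b) (circuit sched D ω)
            (distinguishableProb o (circuit sched D ω)) (b * (N : ℝ) ^ b / 2 ^ p)) ∧
        -- with probability at least `1 - δ`, the errors are exponentially small, and `A` solves
        -- the sampling problem in polynomial time
        circuitMeasure m L D {ω | ¬ (
            maxLeakage o (circuit sched D ω) ≤ Real.exp (-κ * (N : ℝ) ^ c₂) ∧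
            errorBound k γ N (maxLeakage o (circuit sched D ω)) ≤
              Real.exp (-κ * (N : ℝ) ^ c₂ + f N) ∧
            SamplesWithin A o (a * N ^ a) (b * N ^ b) (circuit sched D ω)
              (idealProb o (circuit sched D ω)) (Real.exp (-κ * (N : ℝ) ^ c₂ + f N)))} ≤
          ENNReal.ofReal (K * Real.exp (-κ' * (N : ℝ) ^ c₂)) := by
  obtain ⟨b₁, hb₁, hsampler⟩ := exists_samplesWithin k γ
  obtain ⟨K, κ', hκ'0, hleak⟩ := exists_measure_maxLeakage_le hd k γ c₁ c₂ κ hk hγ hc₁ hc₂ hκ'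
  obtain ⟨B, hB0, hB⟩ := exists_errorBound_le k γ κ c₂ hk hκ hc₂
  -- with `a N ^ a` digits, rounding costs less than the leakage
  set a := ⌈c₂⌉₊ + ⌈κ / Real.log 2⌉₊ with ha
  set b := b₁ * (1 + a) ^ b₁ + (a + 1) * b₁ with hb
  set s : ℕ := ⌈γ⌉₊ + 3 + b₁ with hs
  refine ⟨samplerProg, a, b, K, κ', fun N => Real.log (B + b₁) + s * Real.log N, hκ'0, ?_, ?_⟩
  · have hlog : (fun N : ℕ => Real.log N) =o[Filter.atTop] (fun N : ℕ => (N : ℝ) ^ c₂) :=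
      (isLittleO_log_rpow_atTop hc₂).comp_tendsto tendsto_natCast_atTop_atTop
    have hone : (fun _ : ℕ => Real.log (B + b₁)) =o[Filter.atTop]
        (fun N : ℕ => (N : ℝ) ^ c₂) := by
      refine Asymptotics.isLittleO_const_left.2 (Or.inr ?_)
      exact tendsto_norm_atTop_atTop.comp
        ((tendsto_rpow_atTop hc₂).comp tendsto_natCast_atTop_atTop)
    exact hone.add (hlog.const_mul_left _)
  intro N L D m o sched hN hm hM ho hsched hD
  subst hm
  have hL : 0 < L := lt_of_le_of_lt (Nat.zero_le _) (o ⟨0, hd⟩).isLt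
  set N := ∏ i, m i with hNdef
  have hN1 : (1 : ℝ) ≤ N := by exact_mod_cast hN
  have hN0 : (0 : ℝ) < N := by linarith
  have hb₁b : b₁ ≤ b := by
    have := Nat.le_mul_of_pos_right b₁ (Nat.pow_pos (n := b₁) (show 0 < 1 + a by omega))
    omega
  have hpart1 : ∀ ω : Angles m L D,
      tvDist (idealProb o (circuit sched D ω)) (distinguishableProb o (circuit sched D ω)) ≤
        ENNReal.ofReal (errorBound k γ N (maxLeakage o (circuit sched D ω))) := fun ω =>
    tvDist_ideal_distinguishable k γ N o _ (sum_normSq_circuit sched D ω) hL hN rfl hM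
  have hpart2 : ∀ (ω : Angles m L D) (p : ℕ), SamplesWithin samplerProg o p (b₁ * (N + p) ^ b₁)
      (circuit sched D ω) (distinguishableProb o (circuit sched D ω))
      (b₁ * (N : ℝ) ^ b₁ / 2 ^ p) := fun ω p =>
    hsampler d L p m o _ hN hL hM (sum_normSq_circuit sched D ω) (norm_circuit_le_one sched D ω)
  refine ⟨hpart1, fun ω p => (hpart2 ω p).mono ?_ ?_, ?_⟩
  · exact Nat.mul_le_mul hb₁b (Nat.pow_le_pow_right (by omega) hb₁b)
  · have h : (b₁ : ℝ) ≤ b := by exact_mod_cast hb₁b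
    gcongr
  refine le_trans (MeasureTheory.measure_mono ?_) (hleak L D m o sched hN hM ho hsched hD)
  intro ω hω hη
  refine hω ?_
  set e := Real.exp (-κ * (N : ℝ) ^ c₂) with he
  have he0 : 0 < e := Real.exp_pos _
  have hBb : 0 < B + b₁ := by positivity
  have hf : Real.exp (-κ * (N : ℝ) ^ c₂ + (Real.log (B + b₁) + s * Real.log N)) =
      e * ((B + b₁) * (N : ℝ) ^ s) := by
    rw [Real.exp_add, Real.exp_add, Real.exp_log hBb, Real.exp_nat_mul, Real.exp_log hN0]
  have hpow1 : (N : ℝ) ^ (γ + 3) ≤ (N : ℝ) ^ s := by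
    rw [← Real.rpow_natCast]
    refine Real.rpow_le_rpow_of_exponent_le hN1 ?_
    rw [hs]
    push_cast
    have := Nat.le_ceil γ
    have : (0 : ℝ) ≤ b₁ := by positivity
    linarith
  have hpow2 : (N : ℝ) ^ b₁ ≤ (N : ℝ) ^ s := pow_le_pow_right₀ hN1 (by omega)
  have herr : errorBound k γ N (maxLeakage o (circuit sched D ω)) ≤ e * (B * (N : ℝ) ^ s) := by
    refine (hB N _ hN (maxLeakage_nonneg o _) hη).trans ?_
    rw [mul_comm]
    gcongr
  have hprec : (b₁ : ℝ) * (N : ℝ) ^ b₁ / 2 ^ (a * N ^ a) ≤ e * (b₁ * (N : ℝ) ^ s) := by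
    have h2 : ((2 : ℝ) ^ (a * N ^ a))⁻¹ ≤ e := by
      rw [← Real.exp_log (show (0 : ℝ) < 2 by norm_num), ← Real.exp_nat_mul, ← Real.exp_neg, he,
        Real.exp_le_exp, neg_mul, neg_le_neg_iff]
      have hlog2 : 0 < Real.log 2 := Real.log_pos (by norm_num)
      have h3 : κ ≤ a * Real.log 2 := by
        have h4 := Nat.le_ceil (κ / Real.log 2)
        rw [div_le_iff₀ hlog2] at h4
        refine h4.trans ?_
        gcongr
        rw [ha]
        exact Nat.le_add_left _ _
      have h5 : (N : ℝ) ^ c₂ ≤ (N : ℝ) ^ a := by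
        rw [← Real.rpow_natCast]
        refine Real.rpow_le_rpow_of_exponent_le hN1 ?_
        rw [ha]
        push_cast
        have := Nat.le_ceil c₂
        have : (0 : ℝ) ≤ (⌈κ / Real.log 2⌉₊ : ℝ) := by positivity
        linarith
      calc κ * (N : ℝ) ^ c₂ ≤ (a * Real.log 2) * (N : ℝ) ^ a := by gcongr
        _ = _ := by push_cast; ring
    rw [div_eq_mul_inv, mul_comm]
    gcongr
  refine ⟨hη, ?_, ?_, ?_⟩
  · rw [hf]
    refine herr.trans ?_
    have : 0 ≤ e * (b₁ * (N : ℝ) ^ s) := by positivity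
    linarith
  · intro t ht
    refine ((hpart2 ω (a * N ^ a)).1 t ht).trans ?_
    have h1 : N + a * N ^ a ≤ (1 + a) * N ^ (a + 1) := by
      have h2 : N ≤ N ^ (a + 1) := Nat.le_self_pow (by omega) N
      have h3 : N ^ a ≤ N ^ (a + 1) := Nat.pow_le_pow_right hN (by omega)
      nlinarith
    calc b₁ * (N + a * N ^ a) ^ b₁ ≤ b₁ * ((1 + a) * N ^ (a + 1)) ^ b₁ := by gcongr
      _ = b₁ * (1 + a) ^ b₁ * N ^ ((a + 1) * b₁) := by rw [mul_pow, pow_mul, mul_assoc]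
      _ ≤ b * N ^ b := Nat.mul_le_mul (by omega) (Nat.pow_le_pow_right hN (by omega))
  · refine (tvDist_triangle _ (distinguishableProb o (circuit sched D ω)) _).trans ?_
    refine (add_le_add (hpart1 ω) (hpart2 ω (a * N ^ a)).2).trans ?_
    refine (add_le_add (ENNReal.ofReal_le_ofReal herr) (ENNReal.ofReal_le_ofReal hprec)).trans ?_
    rw [← ENNReal.ofReal_add (by positivity) (by positivity), hf]
    exact ENNReal.ofReal_le_ofReal (le_of_eq (by ring))
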